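/- All sites are small, all sheaves are sheaves of sets, and for a site $A$ its topos of sheaves is written $\widetilde A$. A functor $F\colon A\to B$ between sites is continuous if composition with $F$ sends sheaves to sheaves; then $F^s\colon\widetilde B\to\widetilde A$ denotes this composition functor and $F_s$ its left adjoint. $F$ induces a morphism of sites $B\to A$ if it is continuous and $F_s$ preserves finite limits; the associated morphism of topoi $\widetilde B\to\widetilde A$ has inverse image $F_s$ and direct image $F^s$. $F$ is cocontinuous if every covering of $F(U)$ is refined by the image of a covering of $U$; it then induces a morphism of topoi $\widetilde A\to\widetilde B$, whose inverse image sends $G$ to the sheaf associated to $G\circ F$. A 2-morphism $f\to g$ between morphisms of topoi is a transformation $f_*\to g_*$, equivalently $g^*\to f^*$. **Setup.** Let $C_1, C_2, E, E', D$ be sites and let $$C_1\xrightarrow{\,g_1\,}E'\xrightarrow{\,a\,}E\xleftarrow{\,g\,}D,\qquad f_2\colon D\to C_2$$ be functors such that 1. $E$ is subcanonical, and $C_2$ and $D$ have finite limits; 2. $g_1$ is continuous and cocontinuous, and $a$ and $g$ induce morphisms of sites $E\to E'$ and $E\to D$; 3. the morphism $E\to E'$ induces an equivalence of topoi, i.e.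 $a^s\colon\widetilde E\to\widetilde{E'}$ is an equivalence; 4. $f_2$ preserves finite limits and induces a morphism of sites $C_2\to D$. Put $f_1=a\circ g_1\colon C_1\to E$. There are morphisms of topoi $\mathbf f_1\colon\widetilde C_1\to\widetilde{E'}\simeq\widetilde E\to\widetilde D$, with inverse image $g_1^s a^s g_s$ (the first arrow is induced by the cocontinuous functor $g_1$), and $\mathbf f_2\colon\widetilde C_2\to\widetilde D$, with inverse image $(f_2)_s$. The oriented product $\widetilde C_1\overleftarrow{\times}_{\widetilde D}\widetilde C_2$ is the topos $P$, equipped with $p_1\colon P\to\widetilde C_1$, $p_2\colon P\to\widetilde C_2$ and a 2-morphism $\tau\colon\mathbf f_2p_2\to\mathbf f_1p_1$, which is universal: for every topos $T$, the functor $h\mapsto(p_1h,\,p_2h,\,\tau h)$ is an equivalence from the category of morphisms of topoi $T\to P$ to the category of triples $(x\colon T\to\widetilde C_1,\ y\colon T\to\widetilde C_2,\ t\colon\mathbf f_2y\to\mathbf f_1x)$. Let $C$ be the category of 5-tuples $(U,V,W,\ f_1(U)\to g(W),\ V\to f_2(W))$ with $U\in C_1$, $V\in C_2$, $W\in D$ and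 morphisms in $E$ and in $C_2$ respectively, written $(U\to W\leftarrow V)$; a morphism to $(U'\to W'\leftarrow V')$ consists of morphisms $U\to U'$, $V\to V'$, $W\to W'$ for which the two evident squares, in $E$ and in $C_2$, commute. Give $C$ the topology generated by the families $\{(U_i\to W_i\leftarrow V_i)\to(U\to W\leftarrow V)\}_{i\in I}$ of the following types: (a) $V_i=V$ and $W_i=W$ for all $i$, and $(U_i\to U)_{i\in I}$ is a covering; (b) $U_i=U$ and $W_i=W$ for all $i$, and $(V_i\to V)_{i\in I}$ is a covering; (c) a single morphism $(U\to W\leftarrow V)\to(U\to W'\leftarrow V')$ that is the identity on $U$ and for which $V\to V'$ is the base change of $f_2(W)\to f_2(W')$ along $V'\to f_2(W')$. **Proposition.** There is a canonical equivalence of topoi $$\widetilde C_1\overleftarrow{\times}_{\widetilde D}\widetilde C_2\;\simeq\;\widetilde C .$$ Precisely: let $p_1\colon\widetilde C\to\widetilde C_1$ and $p_2\colon\widetilde C\to\widetilde C_2$ be the morphisms induced by the functors $(U\to W\leftarrow V)\mapsto U$ and $(U\to W\leftarrow V)\mapsto V$, which are cocontinuous. There is a 2-morphism $\tau\colon\mathbf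 f_2p_2\to\mathbf f_1p_1$ whose transformation $p_1^*\mathbf f_1^*F\to p_2^*\mathbf f_2^*F$ sends, for every sheaf $F$ on $D$, every object $(U\to W\leftarrow V)$ of $C$ and every $s\in F(W)$, the pullback of $s$ along $f_1(U)\to g(W)$ to the pullback of $s$ along $V\to f_2(W)$, and such that $(\widetilde C,p_1,p_2,\tau)$ has the universal property of the oriented product. Moreover, for every topos $P$ with a triple $(p_1',p_2',\tau')$ that is an oriented product of $\mathbf f_1$ and $\mathbf f_2$, there is an equivalence of topoi $e\colon P\to\widetilde C$ such that $(p_1e,p_2e,\tau e)\cong(p_1',p_2',\tau')$. -/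

import Mathlib

open CategoryTheory CategoryTheory.Limits Opposite

universe w₁ w₂ w₃ w₄ v₁ v₂ v₃ v₄ u

noncomputable section

/-! ### Topoi, morphisms of topoi and their 2-morphisms -/

/-- `T` is a (Grothendieck) topos: it is equivalent to the category of sheaves of sets on a
small site. -/
def IsGrothendieckTopos (T : Type (u + 1)) [LargeCategory.{u} T] : Prop :=
  ∃ (S : Type u) (_ : SmallCategory S) (J : GrothendieckTopology S),
    Nonempty (T ≌ Sheaf J (Type u))

/-- A morphism of topoi `X → Y`: a functor `f_* : X ⥤ Y` with a left exact left adjoint `f^*`. -/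
structure GeometricMorphism (X : Type w₁) [Category.{v₁} X] (Y : Type w₂) [Category.{v₂} Y] where
  pushforward : X ⥤ Y
  pullback : Y ⥤ X
  adj : pullback ⊣ pushforward
  exact : PreservesFiniteLimits pullback

namespace GeometricMorphism

section

variable {X : Type w₁} [Category.{v₁} X] {Y : Type w₂} [Category.{v₂} Y]
  {Z : Type w₃} [Category.{v₃} Z]

/-- A 2-morphism `f → g`: a transformation `g^* ⟶ f^*` (equivalently, by taking mates, a
transformation `f_* ⟶ g_*`). -/
@[ext]
structure Hom (f g : GeometricMorphism X Y) where
  app : g.pullback ⟶ f.pullback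

instance : Category (GeometricMorphism X Y) where
  Hom f g := Hom f g
  id f := ⟨𝟙 f.pullback⟩
  comp α β := ⟨β.app ≫ α.app⟩

@[ext]
lemma hom_ext {f g : GeometricMorphism X Y} {α β : f ⟶ g} (h : α.app = β.app) : α = β :=
  Hom.ext h

@[simp] lemma id_app (f : GeometricMorphism X Y) : Hom.app (𝟙 f) = 𝟙 f.pullback := rfl

@[simp] lemma comp_app {f g h : GeometricMorphism X Y} (α : f ⟶ g) (β : g ⟶ h) :
    (α ≫ β).app = β.app ≫ α.app := rfl

/-- The composite `X → Y → Z` of morphisms of topoi. -/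
@[simps pushforward pullback]
def comp (f : GeometricMorphism X Y) (g : GeometricMorphism Y Z) : GeometricMorphism X Z where
  pushforward := f.pushforward ⋙ g.pushforward
  pullback := g.pullback ⋙ f.pullback
  adj := g.adj.comp f.adj
  exact := by
    have := f.exact
    have := g.exact
    exact comp_preservesFiniteLimits _ _

/-- A morphism of topoi is an equivalence of topoi if its inverse image functor is an
equivalence of categories. -/
def IsEquivalence (f : GeometricMorphism X Y) : Prop := f.pullback.IsEquivalence

end

end GeometricMorphism

/-! ### Oriented products of topoi -/

section OrientedProduct

variable {X₁ : Type w₁} [Category.{v₁} X₁] {X₂ : Type w₂} [Category.{v₂} X₂]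
  {S : Type w₃} [Category.{v₃} S]

/-- For morphisms of topoi `f₁ : X₁ → S` and `f₂ : X₂ → S`, a triple consisting of
`p₁ : T → X₁`, `p₂ : T → X₂` and a 2-morphism `f₂ p₂ → f₁ p₁`. -/
structure OrientedCone (f₁ : GeometricMorphism X₁ S) (f₂ : GeometricMorphism X₂ S)
    (T : Type w₄) [Category.{v₄} T] where
  fst : GeometricMorphism T X₁
  snd : GeometricMorphism T X₂
  cell : snd.comp f₂ ⟶ fst.comp f₁

namespace OrientedCone

variable {f₁ : GeometricMorphism X₁ S} {f₂ : GeometricMorphism X₂ S}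

section

variable {T : Type w₄} [Category.{v₄} T]

/-- The transformation `p₁^* f₁^* ⟶ p₂^* f₂^*` underlying the 2-morphism of `c`. -/
def nat (c : OrientedCone f₁ f₂ T) :
    f₁.pullback ⋙ c.fst.pullback ⟶ f₂.pullback ⋙ c.snd.pullback :=
  c.cell.app

/-- A morphism of triples: 2-morphisms `p₁ → p₁'` and `p₂ → p₂'` such that the square formed by
`f₂ p₂ → f₁ p₁ → f₁ p₁'` and `f₂ p₂ → f₂ p₂' → f₁ p₁'` commutes (spelled out on inverse images). -/
@[ext]
structure Hom (c c' : OrientedCone f₁ f₂ T) where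
  fst : c.fst ⟶ c'.fst
  snd : c.snd ⟶ c'.snd
  w : Functor.whiskerLeft f₁.pullback fst.app ≫ c.nat =
    c'.nat ≫ Functor.whiskerLeft f₂.pullback snd.app

instance : Category (OrientedCone f₁ f₂ T) where
  Hom c c' := Hom c c'
  id c := ⟨𝟙 _, 𝟙 _, by simp⟩
  comp α β := ⟨α.fst ≫ β.fst, α.snd ≫ β.snd, by
    simp only [GeometricMorphism.comp_app, Functor.whiskerLeft_comp, Category.assoc]
    rw [α.w, ← Category.assoc, β.w, Category.assoc]⟩

@[ext]
lemma hom_ext {c c' : OrientedCone f₁ f₂ T} {α β : c ⟶ c'} (h₁ : α.fst = β.fst)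
    (h₂ : α.snd = β.snd) : α = β :=
  Hom.ext h₁ h₂

@[simp] lemma id_fst (c : OrientedCone f₁ f₂ T) : Hom.fst (𝟙 c) = 𝟙 c.fst := rfl
@[simp] lemma id_snd (c : OrientedCone f₁ f₂ T) : Hom.snd (𝟙 c) = 𝟙 c.snd := rfl
@[simp] lemma comp_fst {c c' c'' : OrientedCone f₁ f₂ T} (α : c ⟶ c') (β : c' ⟶ c'') :
    (α ≫ β).fst = α.fst ≫ β.fst := rfl
@[simp] lemma comp_snd {c c' c'' : OrientedCone f₁ f₂ T} (α : c ⟶ c') (β : c' ⟶ c'') :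
    (α ≫ β).snd = α.snd ≫ β.snd := rfl

end

variable {P : Type w₄} [Category.{v₄} P]

/-- The triple `(p₁ h, p₂ h, f₂ p₂ h → f₁ p₁ h)` obtained from a triple on `P` and `h : T → P`. -/
@[simps fst snd]
def precomp (c : OrientedCone f₁ f₂ P) {T : Type*} [Category* T] (h : GeometricMorphism T P) :
    OrientedCone f₁ f₂ T where
  fst := h.comp c.fst
  snd := h.comp c.snd
  cell := ⟨Functor.whiskerRight c.nat h.pullback⟩

lemma precomp_nat_app (c : OrientedCone f₁ f₂ P) {T : Type*} [Category* T]
    (h : GeometricMorphism T P) (F : S) :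
    (c.precomp h).nat.app F = h.pullback.map (c.nat.app F) := rfl

/-- The functor `h ↦ (p₁ h, p₂ h, f₂ p₂ h → f₁ p₁ h)` from morphisms of topoi `T → P` to triples
on `T`. -/
def precompFunctor (c : OrientedCone f₁ f₂ P) (T : Type*) [Category* T] :
    GeometricMorphism T P ⥤ OrientedCone f₁ f₂ T where
  obj h := c.precomp h
  map {h h'} α :=
    { fst := ⟨Functor.whiskerLeft c.fst.pullback α.app⟩
      snd := ⟨Functor.whiskerLeft c.snd.pullback α.app⟩
      w := by
        ext F
        exact (α.app.naturality (c.nat.app F)).symm }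
  map_id h := by
    apply hom_ext
    · apply GeometricMorphism.hom_ext; rfl
    · apply GeometricMorphism.hom_ext; rfl
  map_comp α β := by
    apply hom_ext
    · apply GeometricMorphism.hom_ext; rfl
    · apply GeometricMorphism.hom_ext; rfl

/-- The topos `P` with the triple `c` is the oriented product of `f₁ : X₁ → S` and `f₂ : X₂ → S`:
for every topos `T`, composition with `c` is an equivalence from the category of morphisms
`T → P` to the category of triples `(T → X₁, T → X₂, 2-morphism)`. -/
def IsOrientedProduct {P : Type (u + 1)} [LargeCategory.{u} P] (c : OrientedCone f₁ f₂ P) : Prop :=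
  ∀ (T : Type (u + 1)) [LargeCategory.{u} T], IsGrothendieckTopos.{u} T →
    (c.precompFunctor T).IsEquivalence

end OrientedCone

end OrientedProduct

/-! ### Morphisms of topoi from functors between sites -/

section Sites

variable {A B : Type u} [SmallCategory A] [SmallCategory B]

/-- The functor `F : (A, J) ⥤ (B, K)` induces a morphism of sites `(B, K) → (A, J)`: it is
continuous and the functor `F_s` it induces on sheaves is (left) exact. -/
class InducesMorphismOfSites (F : A ⥤ B) (J : GrothendieckTopology A)
    (K : GrothendieckTopology B) : Prop extends F.IsContinuous J K where
  exact : PreservesFiniteLimits (F.sheafPullback (Type u) J K)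

/-- The morphism of topoi `B~ → A~` of a morphism of sites, `(F_s, F^s)`. -/
def siteGeometricMorphism (F : A ⥤ B) (J : GrothendieckTopology A) (K : GrothendieckTopology B)
    [InducesMorphismOfSites F J K] : GeometricMorphism (Sheaf K (Type u)) (Sheaf J (Type u)) where
  pushforward := F.sheafPushforwardContinuous (Type u) J K
  pullback := F.sheafPullback (Type u) J K
  adj := F.sheafAdjunctionContinuous (Type u) J K
  exact := InducesMorphismOfSites.exact

/-- If `F^s : B~ ⥤ A~` is an equivalence, the morphism of topoi `A~ → B~` with inverse image
`F^s` and direct image its quasi-inverse (hence its adjoint `F_s`). -/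
def equivGeometricMorphism (F : A ⥤ B) (J : GrothendieckTopology A) (K : GrothendieckTopology B)
    [F.IsContinuous J K] [(F.sheafPushforwardContinuous (Type u) J K).IsEquivalence] :
    GeometricMorphism (Sheaf J (Type u)) (Sheaf K (Type u)) where
  pushforward := (F.sheafPushforwardContinuous (Type u) J K).inv
  pullback := F.sheafPushforwardContinuous (Type u) J K
  adj := (F.sheafPushforwardContinuous (Type u) J K).asEquivalence.toAdjunction
  exact := inferInstance

/-- The morphism of topoi `A~ → B~` of a cocontinuous functor: its inverse image is the sheaf
associated to the restriction along `F`, its direct image is right Kan extension. -/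
def cocontinuousGeometricMorphism (F : A ⥤ B) (J : GrothendieckTopology A)
    (K : GrothendieckTopology B) [F.IsCocontinuous J K] :
    GeometricMorphism (Sheaf J (Type u)) (Sheaf K (Type u)) where
  pushforward := F.sheafPushforwardCocontinuous (Type u) J K
  pullback := sheafToPresheaf K (Type u) ⋙ (Functor.whiskeringLeft _ _ (Type u)).obj F.op ⋙
    presheafToSheaf J (Type u)
  adj := ((F.op.ranAdjunction (Type u)).comp
      (sheafificationAdjunction J (Type u))).restrictFullyFaithful
    (fullyFaithfulSheafToPresheaf K (Type u)) (Functor.FullyFaithful.id _)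
    (Iso.refl _) (Iso.refl _)
  exact := by
    have : PreservesFiniteLimits
        ((Functor.whiskeringLeft _ _ (Type u)).obj F.op ⋙ presheafToSheaf J (Type u)) :=
      comp_preservesFiniteLimits _ _
    exact comp_preservesFiniteLimits _ _

/-- If the cocontinuous functor `F` is also continuous, the restriction along `F` of a sheaf is
a sheaf, and the morphism of topoi `A~ → B~` has inverse image `F^s`. -/
def bicontinuousGeometricMorphism (F : A ⥤ B) (J : GrothendieckTopology A)
    (K : GrothendieckTopology B) [F.IsContinuous J K] [F.IsCocontinuous J K] :
    GeometricMorphism (Sheaf J (Type u)) (Sheaf K (Type u)) where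
  pushforward := F.sheafPushforwardCocontinuous (Type u) J K
  pullback := F.sheafPushforwardContinuous (Type u) J K
  adj := F.sheafAdjunctionCocontinuous (Type u) J K
  exact :=
    have : PreservesFiniteLimits
        ((presheafToSheaf K (Type u) ⋙ F.sheafPushforwardContinuous (Type u) J K)) :=
      have : PreservesFiniteLimits
        ((Functor.whiskeringLeft _ _ (Type u)).obj F.op ⋙ presheafToSheaf J (Type u)) :=
        comp_preservesFiniteLimits _ _
      preservesFiniteLimits_of_natIso
        (F.pushforwardContinuousSheafificationCompatibility (Type u) J K)
    have : PreservesFiniteLimits (sheafToPresheaf K (Type u) ⋙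
        presheafToSheaf K (Type u) ⋙ F.sheafPushforwardContinuous (Type u) J K) :=
      comp_preservesFiniteLimits _ _
    preservesFiniteLimits_of_natIso
      (Functor.isoWhiskerRight (sheafificationNatIso K (Type u)).symm
        (F.sheafPushforwardContinuous (Type u) J K))

end Sites

/-! ### The site of 5-tuples -/

section FiveTuples

variable {C₁ C₂ E D : Type u} [SmallCategory C₁] [SmallCategory C₂] [SmallCategory E]
  [SmallCategory D]

/-- The 5-tuples `(U, V, W, f₁(U) → g(W), V → f₂(W))`, written `(U → W ← V)`. -/
structure FiveTuple (f₁ : C₁ ⥤ E) (g : D ⥤ E) (f₂ : D ⥤ C₂) where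
  U : C₁
  V : C₂
  W : D
  left : f₁.obj U ⟶ g.obj W
  right : V ⟶ f₂.obj W

namespace FiveTuple

variable {f₁ : C₁ ⥤ E} {g : D ⥤ E} {f₂ : D ⥤ C₂}

/-- A morphism of 5-tuples. -/
@[ext]
structure Hom (X Y : FiveTuple f₁ g f₂) where
  onU : X.U ⟶ Y.U
  onV : X.V ⟶ Y.V
  onW : X.W ⟶ Y.W
  comm_left : X.left ≫ g.map onW = f₁.map onU ≫ Y.left := by cat_disch
  comm_right : X.right ≫ f₂.map onW = onV ≫ Y.right := by cat_disch

instance : SmallCategory (FiveTuple f₁ g f₂) where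
  Hom X Y := Hom X Y
  id X := { onU := 𝟙 _, onV := 𝟙 _, onW := 𝟙 _ }
  comp α β :=
    { onU := α.onU ≫ β.onU
      onV := α.onV ≫ β.onV
      onW := α.onW ≫ β.onW
      comm_left := by
        rw [Functor.map_comp, Functor.map_comp, Category.assoc, ← Category.assoc, α.comm_left,
          Category.assoc, β.comm_left]
      comm_right := by
        rw [Functor.map_comp, Category.assoc, ← Category.assoc, α.comm_right,
          Category.assoc, β.comm_right] }

@[ext]
lemma hom_ext {X Y : FiveTuple f₁ g f₂} {α β : X ⟶ Y} (hU : α.onU = β.onU)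
    (hV : α.onV = β.onV) (hW : α.onW = β.onW) : α = β :=
  Hom.ext hU hV hW

@[simp] lemma id_onU (X : FiveTuple f₁ g f₂) : Hom.onU (𝟙 X) = 𝟙 X.U := rfl
@[simp] lemma id_onV (X : FiveTuple f₁ g f₂) : Hom.onV (𝟙 X) = 𝟙 X.V := rfl
@[simp] lemma id_onW (X : FiveTuple f₁ g f₂) : Hom.onW (𝟙 X) = 𝟙 X.W := rfl
@[simp] lemma comp_onU {X Y Z : FiveTuple f₁ g f₂} (α : X ⟶ Y) (β : Y ⟶ Z) :
    (α ≫ β).onU = α.onU ≫ β.onU := rfl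
@[simp] lemma comp_onV {X Y Z : FiveTuple f₁ g f₂} (α : X ⟶ Y) (β : Y ⟶ Z) :
    (α ≫ β).onV = α.onV ≫ β.onV := rfl
@[simp] lemma comp_onW {X Y Z : FiveTuple f₁ g f₂} (α : X ⟶ Y) (β : Y ⟶ Z) :
    (α ≫ β).onW = α.onW ≫ β.onW := rfl

/-- The projection `(U → W ← V) ↦ U`. -/
@[simps]
def projU (f₁ : C₁ ⥤ E) (g : D ⥤ E) (f₂ : D ⥤ C₂) : FiveTuple f₁ g f₂ ⥤ C₁ where
  obj X := X.U
  map α := α.onU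

/-- The projection `(U → W ← V) ↦ V`. -/
@[simps]
def projV (f₁ : C₁ ⥤ E) (g : D ⥤ E) (f₂ : D ⥤ C₂) : FiveTuple f₁ g f₂ ⥤ C₂ where
  obj X := X.V
  map α := α.onV

/-- `(U' → W ← V)`, for `φ : U' ⟶ U`. -/
@[simps]
def restrictU (X : FiveTuple f₁ g f₂) {U' : C₁} (φ : U' ⟶ X.U) : FiveTuple f₁ g f₂ where
  U := U'
  V := X.V
  W := X.W
  left := f₁.map φ ≫ X.left
  right := X.right

/-- The morphism `(U' → W ← V) → (U → W ← V)`. -/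
@[simps]
def restrictUHom (X : FiveTuple f₁ g f₂) {U' : C₁} (φ : U' ⟶ X.U) : X.restrictU φ ⟶ X where
  onU := φ
  onV := 𝟙 X.V
  onW := 𝟙 X.W
  comm_left := show (f₁.map φ ≫ X.left) ≫ g.map (𝟙 X.W) = f₁.map φ ≫ X.left by simp
  comm_right := show X.right ≫ f₂.map (𝟙 X.W) = 𝟙 X.V ≫ X.right by simp

/-- `(U → W ← V')`, for `φ : V' ⟶ V`. -/
@[simps]
def restrictV (X : FiveTuple f₁ g f₂) {V' : C₂} (φ : V' ⟶ X.V) : FiveTuple f₁ g f₂ where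
  U := X.U
  V := V'
  W := X.W
  left := X.left
  right := φ ≫ X.right

/-- The morphism `(U → W ← V') → (U → W ← V)`. -/
@[simps]
def restrictVHom (X : FiveTuple f₁ g f₂) {V' : C₂} (φ : V' ⟶ X.V) : X.restrictV φ ⟶ X where
  onU := 𝟙 X.U
  onV := φ
  onW := 𝟙 X.W
  comm_left := show X.left ≫ g.map (𝟙 X.W) = f₁.map (𝟙 X.U) ≫ X.left by simp
  comm_right := show (φ ≫ X.right) ≫ f₂.map (𝟙 X.W) = φ ≫ X.right by simp

/-- The three types of generating coverings. -/
inductive IsGeneratingCover (f₁ : C₁ ⥤ E) (g : D ⥤ E) (f₂ : D ⥤ C₂)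
    (J₁ : GrothendieckTopology C₁) (J₂ : GrothendieckTopology C₂) :
    ∀ X : FiveTuple f₁ g f₂, Presieve X → Prop
  /-- (a): `(Uᵢ → W ← V) → (U → W ← V)` for a covering `(Uᵢ → U)`. -/
  | coverU (X : FiveTuple f₁ g f₂) {ι : Type u} (U' : ι → C₁) (φ : ∀ i, U' i ⟶ X.U)
      (hφ : Sieve.ofArrows U' φ ∈ J₁ X.U) :
      IsGeneratingCover f₁ g f₂ J₁ J₂ X
        (Presieve.ofArrows (fun i => X.restrictU (φ i)) (fun i => X.restrictUHom (φ i)))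
  /-- (b): `(U → W ← Vᵢ) → (U → W ← V)` for a covering `(Vᵢ → V)`. -/
  | coverV (X : FiveTuple f₁ g f₂) {ι : Type u} (V' : ι → C₂) (φ : ∀ i, V' i ⟶ X.V)
      (hφ : Sieve.ofArrows V' φ ∈ J₂ X.V) :
      IsGeneratingCover f₁ g f₂ J₁ J₂ X
        (Presieve.ofArrows (fun i => X.restrictV (φ i)) (fun i => X.restrictVHom (φ i)))
  /-- (c): a single `(U → W ← V) → (U → W' ← V')` that is the identity on `U` and for which
  `V` is the base change of `V'` along `W → W'`. -/
  | baseChange {U : C₁} {V V' : C₂} {W W' : D} (left : f₁.obj U ⟶ g.obj W)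
      (right : V ⟶ f₂.obj W) (left' : f₁.obj U ⟶ g.obj W') (right' : V' ⟶ f₂.obj W')
      (ψ : V ⟶ V') (ω : W ⟶ W') (hl : left ≫ g.map ω = left')
      (h : IsPullback right ψ (f₂.map ω) right') :
      IsGeneratingCover f₁ g f₂ J₁ J₂ ⟨U, V', W', left', right'⟩
        (Presieve.singleton
          (show (⟨U, V, W, left, right⟩ : FiveTuple f₁ g f₂) ⟶ ⟨U, V', W', left', right'⟩ from
            { onU := 𝟙 U
              onV := ψ
              onW := ω
              comm_left := by simpa using hl
              comm_right := h.w }))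

/-- The topology generated by the coverings of types (a), (b) and (c). -/
def topology (f₁ : C₁ ⥤ E) (g : D ⥤ E) (f₂ : D ⥤ C₂) (J₁ : GrothendieckTopology C₁)
    (J₂ : GrothendieckTopology C₂) : GrothendieckTopology (FiveTuple f₁ g f₂) :=
  Precoverage.toGrothendieck
    { coverings := fun X => {R | IsGeneratingCover f₁ g f₂ J₁ J₂ X R} }

variable (f₁ g f₂) (J₁ : GrothendieckTopology C₁) (J₂ : GrothendieckTopology C₂)

instance : (projU f₁ g f₂).IsCocontinuous (topology f₁ g f₂ J₁ J₂) J₁ where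
  cover_lift {X S} hS := by
    have hS' : Sieve.ofArrows (fun i : (Σ Y : C₁, {h : Y ⟶ X.U // S h}) => i.1)
        (fun i => i.2.1) ∈ J₁ X.U := by
      refine J₁.superset_covering ?_ hS
      intro Y h hh
      exact ⟨Y, 𝟙 _, h, ⟨(⟨Y, h, hh⟩ : Σ Y : C₁, {h : Y ⟶ X.U // S h})⟩, by simp⟩
    refine GrothendieckTopology.superset_covering _ ?_
      (Precoverage.generate_mem_toGrothendieck (IsGeneratingCover.coverU X _ _ hS'))
    rw [Sieve.generate_le_iff]
    rintro Y _ ⟨i⟩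
    exact i.2.2

instance : (projV f₁ g f₂).IsCocontinuous (topology f₁ g f₂ J₁ J₂) J₂ where
  cover_lift {X S} hS := by
    have hS' : Sieve.ofArrows (fun i : (Σ Y : C₂, {h : Y ⟶ X.V // S h}) => i.1)
        (fun i => i.2.1) ∈ J₂ X.V := by
      refine J₂.superset_covering ?_ hS
      intro Y h hh
      exact ⟨Y, 𝟙 _, h, ⟨(⟨Y, h, hh⟩ : Σ Y : C₂, {h : Y ⟶ X.V // S h})⟩, by simp⟩
    refine GrothendieckTopology.superset_covering _ ?_
      (Precoverage.generate_mem_toGrothendieck (IsGeneratingCover.coverV X _ _ hS'))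
    rw [Sieve.generate_le_iff]
    rintro Y _ ⟨i⟩
    exact i.2.2

/-- The projection `p₁` from the topos of sheaves on 5-tuples, induced by the cocontinuous
functor `(U → W ← V) ↦ U`. -/
def toposFst : GeometricMorphism (Sheaf (topology f₁ g f₂ J₁ J₂) (Type u)) (Sheaf J₁ (Type u)) :=
  cocontinuousGeometricMorphism (projU f₁ g f₂) (topology f₁ g f₂ J₁ J₂) J₁

/-- The projection `p₂` from the topos of sheaves on 5-tuples, induced by the cocontinuous
functor `(U → W ← V) ↦ V`. -/
def toposSnd : GeometricMorphism (Sheaf (topology f₁ g f₂ J₁ J₂) (Type u)) (Sheaf J₂ (Type u)) :=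
  cocontinuousGeometricMorphism (projV f₁ g f₂) (topology f₁ g f₂ J₁ J₂) J₂

end FiveTuple

end FiveTuples

/-! ### The morphisms of topoi to `D~` and the canonical 2-morphism -/

section Legs

variable {C₁ C₂ E E' D : Type u} [SmallCategory C₁] [SmallCategory C₂] [SmallCategory E]
  [SmallCategory E'] [SmallCategory D]
  (J₁ : GrothendieckTopology C₁) (J₂ : GrothendieckTopology C₂)
  (JE : GrothendieckTopology E) (JE' : GrothendieckTopology E') (JD : GrothendieckTopology D)
  (g₁ : C₁ ⥤ E') (a : E' ⥤ E) (g : D ⥤ E) (f₂ : D ⥤ C₂)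
  [g₁.IsContinuous J₁ JE'] [g₁.IsCocontinuous J₁ JE']
  [InducesMorphismOfSites a JE' JE]
  [(a.sheafPushforwardContinuous (Type u) JE' JE).IsEquivalence]
  [InducesMorphismOfSites g JD JE] [InducesMorphismOfSites f₂ JD J₂]

/-- The morphism of topoi `C₁~ → E'~ → E~ → D~`; its inverse image is `g₁^s a^s g_s`. -/
def leftLeg : GeometricMorphism (Sheaf J₁ (Type u)) (Sheaf JD (Type u)) :=
  (bicontinuousGeometricMorphism g₁ J₁ JE').comp
    ((equivGeometricMorphism a JE' JE).comp (siteGeometricMorphism g JD JE))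

/-- The morphism of topoi `C₂~ → D~`. -/
def rightLeg : GeometricMorphism (Sheaf J₂ (Type u)) (Sheaf JD (Type u)) :=
  siteGeometricMorphism f₂ JD J₂

variable {JD}

/-- The identification `(g_s F)(f₁(U)) = (f₁^* F)(U)`, where `f₁^*` is the inverse image `g₁^s a^s g_s`
of the morphism of topoi `C₁~ → D~`. -/
def leftLegSection (F : Sheaf JD (Type u)) (U : C₁)
    (x : ((g.sheafPullback (Type u) JD JE).obj F).obj.obj (op ((g₁ ⋙ a).obj U))) :
    ((leftLeg J₁ JE JE' JD g₁ a g).pullback.obj F).obj.obj (op U) :=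
  x

/-- For `X = (U → W ← V)` and `s ∈ F(W)`, the section over `X` of the inverse image of `F` under
`C~ → C₁~ → D~` obtained by pulling back `s` along `f₁(U) → g(W)`. -/
def leftSection (F : Sheaf JD (Type u)) (X : FiveTuple (g₁ ⋙ a) g f₂) (s : F.obj.obj (op X.W)) :
    ((FiveTuple.toposFst (g₁ ⋙ a) g f₂ J₁ J₂).pullback.obj
      ((leftLeg J₁ JE JE' JD g₁ a g).pullback.obj F)).obj.obj (op X) :=
  (toSheafify (FiveTuple.topology (g₁ ⋙ a) g f₂ J₁ J₂)
    ((FiveTuple.projU (g₁ ⋙ a) g f₂).op ⋙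
      ((leftLeg J₁ JE JE' JD g₁ a g).pullback.obj F).obj)).app (op X)
    (leftLegSection J₁ JE JE' g₁ a g F X.U
      (((g.sheafPullback (Type u) JD JE).obj F).obj.map X.left.op
        (((g.sheafAdjunctionContinuous (Type u) JD JE).unit.app F).hom.app (op X.W) s)))

/-- For `X = (U → W ← V)` and `s ∈ F(W)`, the section over `X` of the inverse image of `F` under
`C~ → C₂~ → D~` obtained by pulling back `s` along `V → f₂(W)`. -/
def rightSection (F : Sheaf JD (Type u)) (X : FiveTuple (g₁ ⋙ a) g f₂) (s : F.obj.obj (op X.W)) :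
    ((FiveTuple.toposSnd (g₁ ⋙ a) g f₂ J₁ J₂).pullback.obj
      ((rightLeg J₂ JD f₂).pullback.obj F)).obj.obj (op X) :=
  (toSheafify (FiveTuple.topology (g₁ ⋙ a) g f₂ J₁ J₂)
    ((FiveTuple.projV (g₁ ⋙ a) g f₂).op ⋙ ((rightLeg J₂ JD f₂).pullback.obj F).obj)).app (op X)
    (((f₂.sheafPullback (Type u) JD J₂).obj F).obj.map X.right.op
      (((f₂.sheafAdjunctionContinuous (Type u) JD J₂).unit.app F).hom.app (op X.W) s))

variable (JD)

/-- A triple `(p₁, p₂, τ)` on the topos `C~` of sheaves on 5-tuples, where `p₁` and `p₂` are the two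
projections. -/
abbrev siteCone
    (τ : (FiveTuple.toposSnd (g₁ ⋙ a) g f₂ J₁ J₂).comp (rightLeg J₂ JD f₂) ⟶
      (FiveTuple.toposFst (g₁ ⋙ a) g f₂ J₁ J₂).comp (leftLeg J₁ JE JE' JD g₁ a g)) :
    OrientedCone (leftLeg J₁ JE JE' JD g₁ a g) (rightLeg J₂ JD f₂)
      (Sheaf (FiveTuple.topology (g₁ ⋙ a) g f₂ J₁ J₂) (Type u)) where
  fst := FiveTuple.toposFst (g₁ ⋙ a) g f₂ J₁ J₂
  snd := FiveTuple.toposSnd (g₁ ⋙ a) g f₂ J₁ J₂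
  cell := τ

/-- The 2-morphism `τ` on `C~` is the canonical one: over each `(U → W ← V)` its transformation on
inverse images sends the pullback of `s ∈ F(W)` along `U → W` to the pullback of `s` along
`V → W`. -/
def IsCanonicalCell
    (τ : (FiveTuple.toposSnd (g₁ ⋙ a) g f₂ J₁ J₂).comp (rightLeg J₂ JD f₂) ⟶
      (FiveTuple.toposFst (g₁ ⋙ a) g f₂ J₁ J₂).comp (leftLeg J₁ JE JE' JD g₁ a g)) : Prop :=
  ∀ (F : Sheaf JD (Type u)) (X : FiveTuple (g₁ ⋙ a) g f₂) (s : F.obj.obj (op X.W)),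
    ((siteCone J₁ J₂ JE JE' JD g₁ a g f₂ τ).nat.app F).hom.app (op X)
      (leftSection J₁ J₂ JE JE' g₁ a g f₂ F X s) = rightSection J₁ J₂ g₁ a g f₂ F X s

end Legs

end

/-!
The topos `C~` of sheaves on 5-tuples is a classifying topos: a triple `(x, y, t)` on a topos `T` is
the same as a morphism of topoi `T → C~`. Sections of sheaves and the properties that they have
locally (`Locally`) are used throughout.

The two legs enter only through a description of the inverse images of a representable sheaf `W` on
`D`: locally, sections over `U` are morphisms `f₁(U) → g(W)` in `E`, which uses that `E` is
subcanonical and that `E'~ ≃ E~`, and sections over `V` are morphisms `V → f₂(W)`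
(`LegPresentation`, `leftPresentation`, `sitePresentation`). Since `E` is subcanonical, `g` also
preserves finite limits (`preservesFiniteLimits_of_inducesMorphismOfSites`).

*The 2-morphism.* The coverings by base change let a morphism `f₁(U) → g(W')` factor locally on
`(U → W ← V)` through a morphism `W → W'`, which is locally unique. Hence the inverse image of `W'`
under `C~ → C₁~ → D~` is the sheaf associated to `X ↦ Hom(X.W, W')` (`isIso_leftSheafMap`), and this
presheaf maps to the inverse image of `W'` under `C~ → C₂~ → D~`. That defines `τ` on representable
sheaves, and so on all sheaves (`exists_cellIsCanonical`, `CellIsCanonical.isCanonicalCell`).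

*Full faithfulness.* The sheaf associated to `(U → W ← V)` is the pullback of the inverse images of
`U` and `V` over the inverse image of `W` (`CellIsCanonical.representablesArePullbacks`). Inverse
image functors preserve this pullback and are determined by their values on representable sheaves,
so 2-morphisms between morphisms `T → C~` are morphisms of triples
(`RepresentablesArePullbacks.faithful`, `RepresentablesArePullbacks.full`).

*Essential surjectivity.* One may take `T` to be the topos of sheaves on a site. A triple `c` gives
a functor from 5-tuples to `T`, sending `(U → W ← V)` to the pullback of `x^* U` and `y^* V` over the
inverse image of `W` (`OrientedCone.functor`). It is locally flat
(`OrientedCone.locallyFlat_functor`) and sends the generating coverings to jointly epimorphic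
families (`OrientedCone.coversLocally_functor`), so by a form of Diaconescu's theorem it is the
restriction of the inverse image functor of a morphism of topoi
(`LocallyFlat.preservesFiniteLimits`, `LocallyFlat.isSheaf`, `LocallyFlat.geometricMorphism`). The inverse images of sheaves on `C₁` and
`C₂` under the composites with `p₁` and `p₂` are computed by generators `z ⊗ γ` and compared with
those under `x` and `y` (`isIso_comparison_app`, `CellIsCanonical.nonempty_iso`).

The universal property determines the oriented product up to equivalence
(`OrientedCone.IsOrientedProduct.exists_equivalence`).
-/

noncomputable section

/-! ### Properties that hold locally -/

section Locally

variable {S : Type u} [SmallCategory S] (K : GrothendieckTopology S)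

/-- A property of morphisms `i : s' ⟶ s` holds locally on `s` if it holds for all the members of
some covering sieve of `s`. -/
def Locally (s : S) (p : ∀ ⦃s' : S⦄, (s' ⟶ s) → Prop) : Prop :=
  ∃ R ∈ K s, ∀ ⦃s' : S⦄ (i : s' ⟶ s), R i → p i

variable {K} {s : S} {p q : ∀ ⦃s' : S⦄, (s' ⟶ s) → Prop}

lemma Locally.of_forall (h : ∀ ⦃s' : S⦄ (i : s' ⟶ s), p i) : Locally K s p :=
  ⟨⊤, K.top_mem s, fun _ i _ => h i⟩

lemma Locally.mono (hp : Locally K s p) (h : ∀ ⦃s' : S⦄ (i : s' ⟶ s), p i → q i) :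
    Locally K s q := by
  obtain ⟨R, hR, hp⟩ := hp
  exact ⟨R, hR, fun _ i hi => h i (hp i hi)⟩

lemma Locally.bind (hp : Locally K s p)
    (h : ∀ ⦃s' : S⦄ (i : s' ⟶ s), p i → Locally K s' (fun _ j => q (j ≫ i))) :
    Locally K s q := by
  obtain ⟨R, hR, hp⟩ := hp
  choose T hT hq using fun (s' : S) (i : s' ⟶ s) (hi : R i) => h i (hp i hi)
  refine ⟨Sieve.bind R.arrows (fun s' i hi => T s' i hi), K.bind_covering hR
    (fun s' i hi => hT s' i hi), ?_⟩
  rintro s' _ ⟨s'', j, i, hi, hj, rfl⟩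
  exact hq _ i hi j hj

lemma Locally.pullback (hp : Locally K s p) {s' : S} (i : s' ⟶ s) :
    Locally K s' (fun _ j => p (j ≫ i)) := by
  obtain ⟨R, hR, hp⟩ := hp
  exact ⟨R.pullback i, K.pullback_stable i hR, fun _ j hj => hp _ hj⟩

lemma Locally.sieve_mem {R : Sieve s} (h : Locally K s (fun _ i => R i)) : R ∈ K s := by
  obtain ⟨T, hT, hR⟩ := h
  exact K.superset_covering hR hT

lemma locally_of_mem {R : Sieve s} (hR : R ∈ K s) : Locally K s (fun _ i => R i) :=
  ⟨R, hR, fun _ _ hi => hi⟩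

variable {P Q : Sᵒᵖ ⥤ Type u}

lemma section_map_comp (P : Sᵒᵖ ⥤ Type u) {s s' s'' : S} (i : s' ⟶ s) (j : s'' ⟶ s')
    (w : P.obj (op s)) : P.map (j ≫ i).op w = P.map j.op (P.map i.op w) := by
  rw [op_comp, Functor.map_comp]
  rfl

lemma sheafHom_app_map {G G' : Sheaf K (Type u)} (f : G ⟶ G') {s s' : S} (i : s' ⟶ s)
    (w : G.obj.obj (op s)) :
    f.hom.app _ (G.obj.map i.op w) = G'.obj.map i.op (f.hom.app _ w) :=
  NatTrans.naturality_apply f.hom i.op w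

lemma map_comp_hom_app {A : Type w₁} [Category.{v₁} A] (Φ : A ⥤ Sheaf K (Type u)) {X Y Z : A}
    (f : X ⟶ Y) (g : Y ⟶ Z) {s : Sᵒᵖ} (w : (Φ.obj X).obj.obj s) :
    (Φ.map (f ≫ g)).hom.app s w = (Φ.map g).hom.app s ((Φ.map f).hom.app s w) := by
  rw [Φ.map_comp]
  rfl

lemma isLocallySurjective_of_locally (φ : P ⟶ Q)
    (h : ∀ (s : S) (w : Q.obj (op s)), Locally K s
      (fun s' i => ∃ z : P.obj (op s'), φ.app _ z = Q.map i.op w)) :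
    Presheaf.IsLocallySurjective K φ :=
  ⟨fun w => Locally.sieve_mem (h _ w)⟩

lemma isLocallyInjective_of_locally (φ : P ⟶ Q)
    (h : ∀ (s : S) (x y : P.obj (op s)), φ.app _ x = φ.app _ y → Locally K s
      (fun _ i => P.map i.op x = P.map i.op y)) :
    Presheaf.IsLocallyInjective K φ :=
  ⟨fun x y hxy => Locally.sieve_mem (h _ x y hxy)⟩

lemma locally_of_isLocallySurjective (φ : P ⟶ Q) [Presheaf.IsLocallySurjective K φ] {s : S}
    (w : Q.obj (op s)) :
    Locally K s (fun s' i => ∃ z : P.obj (op s'), φ.app _ z = Q.map i.op w) :=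
  locally_of_mem (R := Presheaf.imageSieve φ w) (Presheaf.imageSieve_mem K φ w)

lemma locally_of_isLocallyInjective (φ : P ⟶ Q) [Presheaf.IsLocallyInjective K φ] {s : S}
    {x y : P.obj (op s)} (h : φ.app _ x = φ.app _ y) :
    Locally K s (fun _ i => P.map i.op x = P.map i.op y) :=
  ⟨Presheaf.equalizerSieve (F := P) (X := op s) x y, Presheaf.equalizerSieve_mem K φ x y h,
    fun _ _ hi => hi⟩

/-- Two sections of a sheaf that agree locally are equal. -/
lemma Sheaf.section_ext_of_locally (G : Sheaf K (Type u)) {s : S} {x y : G.obj.obj (op s)}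
    (h : Locally K s (fun _ i => G.obj.map i.op x = G.obj.map i.op y)) : x = y := by
  obtain ⟨R, hR, h⟩ := h
  exact (((isSheaf_iff_isSheaf_of_type _ _).1 G.property).isSeparated _ hR).ext
    (fun _ i hi => h i hi)

lemma isIso_presheafToSheaf_map (φ : P ⟶ Q) [Presheaf.IsLocallyInjective K φ]
    [Presheaf.IsLocallySurjective K φ] : IsIso ((presheafToSheaf K (Type u)).map φ) :=
  (K.W_iff φ).1 (K.W_of_isLocallyBijective φ)

/-- A family of morphisms of sheaves of sets that is jointly epimorphic is locally jointly
surjective. -/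
lemma locally_exists_of_jointly_epi {ι : Type u} {A : ι → Sheaf K (Type u)} {B : Sheaf K (Type u)}
    (f : ∀ i, A i ⟶ B) (hf : ∀ (Z : Sheaf K (Type u)) (a b : B ⟶ Z),
      (∀ i, f i ≫ a = f i ≫ b) → a = b) {s : S} (w : B.obj.obj (op s)) :
    Locally K s (fun s' j => ∃ (i : ι) (z : (A i).obj.obj (op s')),
      (f i).hom.app _ z = B.obj.map j.op w) := by
  let P : Sᵒᵖ ⥤ Type u :=
    { obj := fun s => Σ i, (A i).obj.obj s
      map := fun j => TypeCat.ofHom (fun z => ⟨z.1, (A z.1).obj.map j z.2⟩)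
      map_id := fun _ => by ext ⟨i, z⟩ <;> simp
      map_comp := fun _ _ => by ext ⟨i, z⟩ <;> simp }
  let inc : ∀ i, (A i).obj ⟶ P := fun i => { app := fun s => TypeCat.ofHom (fun z => ⟨i, z⟩) }
  let φ : P ⟶ B.obj :=
    { app := fun s => TypeCat.ofHom (fun z => (f z.1).hom.app s z.2)
      naturality := fun _ _ j => by
        ext ⟨i, z⟩
        exact (NatTrans.naturality_apply (f i).hom j z) }
  let ψ : (presheafToSheaf K (Type u)).obj P ⟶ B :=
    ((sheafificationAdjunction K (Type u)).homEquiv P B).symm φ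
  have hψ : toSheafify K P ≫ ψ.hom = φ := by
    have := ((sheafificationAdjunction K (Type u)).homEquiv P B).apply_symm_apply φ
    rw [Adjunction.homEquiv_unit] at this
    exact this
  have : Epi ψ := ⟨fun {Z} a b hab => hf Z a b (fun i => by
    apply Sheaf.hom_ext
    have h1 : ∀ c : B ⟶ Z, (f i ≫ c).hom = inc i ≫ toSheafify K P ≫ (ψ ≫ c).hom := by
      intro c
      change _ = inc i ≫ toSheafify K P ≫ ψ.hom ≫ c.hom
      rw [reassoc_of% hψ]
      rfl
    rw [h1 a, h1 b, hab])⟩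
  have : Sheaf.IsLocallySurjective ψ := (Sheaf.isLocallySurjective_iff_epi ψ).2 this
  have : Presheaf.IsLocallySurjective K φ := by
    rw [← hψ]
    infer_instance
  refine (locally_of_isLocallySurjective φ w).mono ?_
  rintro s' j ⟨⟨i, z⟩, hz⟩
  exact ⟨i, z, hz⟩

end Locally

/-! ### Sheaves associated to representable presheaves -/

section Representable

variable {C : Type u} [SmallCategory C] (J : GrothendieckTopology C)

/-- The sheaf associated to the presheaf represented by an object. -/
def repSheaf : C ⥤ Sheaf J (Type u) := yoneda ⋙ presheafToSheaf J (Type u)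

instance [HasFiniteLimits C] : PreservesFiniteLimits (repSheaf J) :=
  comp_preservesFiniteLimits _ _

variable {J}

/-- Morphisms from the sheaf associated to `V` to a sheaf `G` are sections of `G` over `V`. -/
def repSheafEquiv {V : C} {G : Sheaf J (Type u)} : ((repSheaf J).obj V ⟶ G) ≃ G.obj.obj (op V) :=
  ((sheafificationAdjunction J (Type u)).homEquiv _ _).trans yonedaEquiv

/-- The tautological section of the sheaf associated to `V` over `V`. -/
def repSheafOne (J : GrothendieckTopology C) (V : C) : ((repSheaf J).obj V).obj.obj (op V) :=
  repSheafEquiv (𝟙 _)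

/-- The morphism `V → G` in the topos of sheaves given by a section `γ ∈ G(V)`. -/
def secHom {V : C} {G : Sheaf J (Type u)} (γ : G.obj.obj (op V)) : (repSheaf J).obj V ⟶ G :=
  repSheafEquiv.symm γ

lemma repSheafEquiv_comp {V : C} {G G' : Sheaf J (Type u)} (a : (repSheaf J).obj V ⟶ G)
    (b : G ⟶ G') : repSheafEquiv (a ≫ b) = b.hom.app _ (repSheafEquiv a) :=
  (congrArg yonedaEquiv
    ((sheafificationAdjunction J (Type u)).homEquiv_naturality_right a b)).trans
    (yonedaEquiv_comp _ _)

lemma repSheafEquiv_map_comp {V V' : C} {G : Sheaf J (Type u)} (f : V' ⟶ V)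
    (a : (repSheaf J).obj V ⟶ G) :
    repSheafEquiv ((repSheaf J).map f ≫ a) = G.obj.map f.op (repSheafEquiv a) :=
  (congrArg yonedaEquiv
    ((sheafificationAdjunction J (Type u)).homEquiv_naturality_left (yoneda.map f) a)).trans
    (yonedaEquiv_naturality _ _).symm

lemma repSheafEquiv_eq {V : C} {G : Sheaf J (Type u)} (a : (repSheaf J).obj V ⟶ G) :
    repSheafEquiv a = a.hom.app _ (repSheafOne J V) := by
  rw [repSheafOne, ← repSheafEquiv_comp, Category.id_comp]

@[simp]
lemma secHom_app_one {V : C} {G : Sheaf J (Type u)} (γ : G.obj.obj (op V)) :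
    (secHom γ).hom.app _ (repSheafOne J V) = γ := by
  rw [← repSheafEquiv_eq, secHom, Equiv.apply_symm_apply]

lemma repSheaf_hom_ext {V : C} {G : Sheaf J (Type u)} {a b : (repSheaf J).obj V ⟶ G}
    (h : a.hom.app _ (repSheafOne J V) = b.hom.app _ (repSheafOne J V)) : a = b := by
  apply repSheafEquiv.injective
  rwa [repSheafEquiv_eq, repSheafEquiv_eq]

lemma repSheaf_map_app_one {V V' : C} (f : V' ⟶ V) :
    ((repSheaf J).map f).hom.app _ (repSheafOne J V') =
      ((repSheaf J).obj V).obj.map f.op (repSheafOne J V) := by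
  rw [← repSheafEquiv_eq, ← Category.comp_id ((repSheaf J).map f), repSheafEquiv_map_comp]
  rfl

lemma secHom_comp {V : C} {G G' : Sheaf J (Type u)} (γ : G.obj.obj (op V)) (b : G ⟶ G') :
    secHom γ ≫ b = secHom (b.hom.app _ γ) := by
  apply repSheaf_hom_ext
  rw [secHom_app_one]
  exact congrArg (b.hom.app _) (secHom_app_one γ)

lemma map_secHom {V V' : C} {G : Sheaf J (Type u)} (f : V' ⟶ V) (γ : G.obj.obj (op V)) :
    (repSheaf J).map f ≫ secHom γ = secHom (G.obj.map f.op γ) := by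
  apply repSheafEquiv.injective
  rw [repSheafEquiv_map_comp, secHom, secHom, Equiv.apply_symm_apply, Equiv.apply_symm_apply]

lemma secHom_one (V : C) : secHom (repSheafOne J V) = 𝟙 ((repSheaf J).obj V) := by
  rw [secHom, repSheafOne, Equiv.symm_apply_apply]

/-- Morphisms of sheaves are equal if they agree after composition with all sections. -/
lemma Sheaf.hom_ext_secHom {G G' : Sheaf J (Type u)} {a b : G ⟶ G'}
    (h : ∀ (V : C) (γ : G.obj.obj (op V)), secHom γ ≫ a = secHom γ ≫ b) : a = b := by
  apply Sheaf.hom_ext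
  ext ⟨V⟩ γ
  have := congrArg repSheafEquiv (h V γ)
  rwa [repSheafEquiv_eq, repSheafEquiv_eq, secHom_comp, secHom_comp, secHom_app_one,
    secHom_app_one] at this

end Representable

/-! ### Elements of finite limits -/

section Elements

variable {A : Type w₁} [Category.{v₁} A] (N : A ⥤ Type u)

lemma exists_elem_terminal [HasTerminal A] [PreservesLimit (Functor.empty.{0} A) N] :
    Nonempty (N.obj (⊤_ A)) := by
  let e : N.obj (⊤_ A) ≅ PUnit.{u + 1} :=
    (PreservesTerminal.iso N).trans Types.terminalIso
  exact ⟨e.inv PUnit.unit⟩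

lemma subsingleton_elem_terminal [HasTerminal A] [PreservesLimit (Functor.empty.{0} A) N] :
    Subsingleton (N.obj (⊤_ A)) := by
  let e : N.obj (⊤_ A) ≅ PUnit.{u + 1} :=
    (PreservesTerminal.iso N).trans Types.terminalIso
  exact e.toEquiv.subsingleton

lemma exists_elem_prod {X Y : A} [HasBinaryProduct X Y] [PreservesLimit (pair X Y) N]
    (x : N.obj X) (y : N.obj Y) :
    ∃ z : N.obj (X ⨯ Y), N.map prod.fst z = x ∧ N.map prod.snd z = y := by
  let c := BinaryFan.mk (N.map (prod.fst : X ⨯ Y ⟶ X)) (N.map (prod.snd : X ⨯ Y ⟶ Y))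
  have hc : IsLimit c := mapIsLimitOfPreservesOfIsLimit N _ _ (prodIsProd X Y)
  obtain ⟨l, h₁, h₂⟩ := BinaryFan.IsLimit.lift' hc (TypeCat.ofHom (fun _ : PUnit.{u + 1} => x))
    (TypeCat.ofHom (fun _ : PUnit.{u + 1} => y))
  exact ⟨l PUnit.unit, ConcreteCategory.congr_hom h₁ PUnit.unit,
    ConcreteCategory.congr_hom h₂ PUnit.unit⟩

lemma elem_prod_ext {X Y : A} [HasBinaryProduct X Y] [PreservesLimit (pair X Y) N]
    {z z' : N.obj (X ⨯ Y)} (h₁ : N.map prod.fst z = N.map prod.fst z')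
    (h₂ : N.map prod.snd z = N.map prod.snd z') : z = z' := by
  let c := BinaryFan.mk (N.map (prod.fst : X ⨯ Y ⟶ X)) (N.map (prod.snd : X ⨯ Y ⟶ Y))
  have hc : IsLimit c := mapIsLimitOfPreservesOfIsLimit N _ _ (prodIsProd X Y)
  have : TypeCat.ofHom (fun _ : PUnit.{u + 1} => z) = TypeCat.ofHom (fun _ => z') := by
    apply BinaryFan.IsLimit.hom_ext hc
    · ext; exact h₁
    · ext; exact h₂
  exact ConcreteCategory.congr_hom this PUnit.unit

lemma exists_elem_equalizer {X Y : A} (f g : X ⟶ Y) [HasEqualizer f g]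
    [PreservesLimit (parallelPair f g) N] {x : N.obj X} (h : N.map f x = N.map g x) :
    ∃ z : N.obj (equalizer f g), N.map (equalizer.ι f g) z = x := by
  have hc := isLimitForkMapOfIsLimit N _ (equalizerIsEqualizer f g)
  obtain ⟨z, hz, -⟩ := Types.unique_of_type_equalizer _ _ hc x h
  exact ⟨z, hz⟩

end Elements

/-! ### Left exact left adjoints on presheaves, and flat functors -/

section Flat

variable {C : Type u} [SmallCategory C] {S : Type u} [SmallCategory S]
  {K : GrothendieckTopology S}

/-- A functor from a small category to a topos of sheaves is locally flat if, locally on `S`, its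
categories of elements are cofiltered. -/
structure LocallyFlat (Φ : C ⥤ Sheaf K (Type u)) : Prop where
  nonempty (s : S) : Locally K s (fun s' _ => ∃ X : C, Nonempty ((Φ.obj X).obj.obj (op s')))
  span {s : S} {X₁ X₂ : C} (z₁ : (Φ.obj X₁).obj.obj (op s)) (z₂ : (Φ.obj X₂).obj.obj (op s)) :
    Locally K s (fun s' i => ∃ (X : C) (f₁ : X ⟶ X₁) (f₂ : X ⟶ X₂) (z : (Φ.obj X).obj.obj (op s')),
      (Φ.map f₁).hom.app _ z = (Φ.obj X₁).obj.map i.op z₁ ∧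
        (Φ.map f₂).hom.app _ z = (Φ.obj X₂).obj.map i.op z₂)
  fork {s : S} {X Y : C} (a b : X ⟶ Y) (z : (Φ.obj X).obj.obj (op s))
    (h : (Φ.map a).hom.app _ z = (Φ.map b).hom.app _ z) :
    Locally K s (fun s' i => ∃ (X' : C) (f : X' ⟶ X) (z' : (Φ.obj X').obj.obj (op s')),
      f ≫ a = f ≫ b ∧ (Φ.map f).hom.app _ z' = (Φ.obj X).obj.map i.op z)

variable (L : (Cᵒᵖ ⥤ Type u) ⥤ Sheaf K (Type u))

/-- The functor of sections over `s`. -/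
abbrev sectionsFunctor (K : GrothendieckTopology S) (s : S) : Sheaf K (Type u) ⥤ Type u :=
  sheafToPresheaf K (Type u) ⋙ (evaluation _ _).obj (op s)

/-- If `L` is a left adjoint, the sections of `L(P)` locally come from the sections of the values
of `L` on representable presheaves. -/
lemma locally_exists_elem [L.IsLeftAdjoint] (P : Cᵒᵖ ⥤ Type u) {s : S}
    (w : (L.obj P).obj.obj (op s)) :
    Locally K s (fun s' i => ∃ (V : C) (γ : P.obj (op V))
      (z : (L.obj (yoneda.obj V)).obj.obj (op s')),
      (L.map (yonedaEquiv.symm γ)).hom.app _ z = (L.obj P).obj.map i.op w) := by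
  refine (locally_exists_of_jointly_epi
    (fun (i : Σ V : C, P.obj (op V)) => L.map (yonedaEquiv.symm i.2)) ?_ w).mono ?_
  · intro Z a b h
    apply ((Adjunction.ofIsLeftAdjoint L).homEquiv _ _).injective
    ext ⟨V⟩ γ
    have := h ⟨V, γ⟩
    have h2 := congrArg ((Adjunction.ofIsLeftAdjoint L).homEquiv _ _) this
    rw [Adjunction.homEquiv_naturality_left, Adjunction.homEquiv_naturality_left] at h2
    have h3 := congrArg yonedaEquiv h2
    rw [yonedaEquiv_comp, yonedaEquiv_comp] at h3
    simpa using h3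
  · rintro s' i ⟨⟨V, γ⟩, z, hz⟩
    exact ⟨V, γ, z, hz⟩

/-- If `L` is a left exact left adjoint and two sections `γ, γ'` of a presheaf become equal at a
section `z` of `L(V)`, then locally `z` comes from some `V' ⟶ V` on which `γ` and `γ'` agree. -/
lemma locally_exists_elem_of_eq [L.IsLeftAdjoint] [PreservesFiniteLimits L] {P : Cᵒᵖ ⥤ Type u}
    {V : C} (γ γ' : P.obj (op V)) {s : S} (z : (L.obj (yoneda.obj V)).obj.obj (op s))
    (h : (L.map (yonedaEquiv.symm γ)).hom.app _ z = (L.map (yonedaEquiv.symm γ')).hom.app _ z) :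
    Locally K s (fun s' i => ∃ (V' : C) (f : V' ⟶ V)
      (z' : (L.obj (yoneda.obj V')).obj.obj (op s')),
      P.map f.op γ = P.map f.op γ' ∧
        (L.map (yoneda.map f)).hom.app _ z' = (L.obj (yoneda.obj V)).obj.map i.op z) := by
  let c := yonedaEquiv.symm γ
  let c' := yonedaEquiv.symm γ'
  obtain ⟨w, hw⟩ := exists_elem_equalizer (L ⋙ sectionsFunctor K s) c c' h
  refine (locally_exists_elem L (equalizer c c') w).mono ?_
  rintro s' i ⟨V', δ, z', hz'⟩
  let f : V' ⟶ V := (equalizer.ι c c').app _ δ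
  have hf : yoneda.map f = yonedaEquiv.symm δ ≫ equalizer.ι c c' := by
    apply yonedaEquiv.injective
    rw [yonedaEquiv_comp, Equiv.apply_symm_apply, yonedaEquiv_yoneda_map]
  refine ⟨V', f, z', ?_, ?_⟩
  · have := congrArg yonedaEquiv (congrArg (yonedaEquiv.symm δ ≫ ·) (equalizer.condition c c'))
    rw [← Category.assoc, ← Category.assoc, ← hf, yonedaEquiv_comp, yonedaEquiv_comp,
      yonedaEquiv_yoneda_map] at this
    exact this
  · rw [hf, L.map_comp]
    change (L.map (equalizer.ι c c')).hom.app _ ((L.map (yonedaEquiv.symm δ)).hom.app _ z') = _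
    rw [hz', ← hw]
    exact NatTrans.naturality_apply (L.map (equalizer.ι c c')).hom i.op w

/-- A left exact left adjoint on presheaves is locally flat on representables. -/
lemma locallyFlat_yoneda_comp [L.IsLeftAdjoint] [PreservesFiniteLimits L] :
    LocallyFlat (yoneda ⋙ L) where
  nonempty s := by
    obtain ⟨w⟩ := exists_elem_terminal (L ⋙ sectionsFunctor K s)
    refine (locally_exists_elem L _ w).mono ?_
    rintro s' i ⟨V, -, z, -⟩
    exact ⟨V, ⟨z⟩⟩
  span {s X₁ X₂} z₁ z₂ := by
    obtain ⟨w, h₁, h₂⟩ := exists_elem_prod (X := yoneda.obj X₁) (Y := yoneda.obj X₂)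
      (L ⋙ sectionsFunctor K s) z₁ z₂
    refine (locally_exists_elem L _ w).mono ?_
    rintro s' i ⟨V, γ, z, hz⟩
    have key : ∀ {X : C} (a : yoneda.obj X₁ ⨯ yoneda.obj X₂ ⟶ yoneda.obj X),
        ((yoneda ⋙ L).map (show V ⟶ X from a.app _ γ)).hom.app _ z =
          (L.obj (yoneda.obj X)).obj.map i.op ((L.map a).hom.app _ w) := by
      intro X a
      have ha : yoneda.map (show V ⟶ X from a.app _ γ) = yonedaEquiv.symm γ ≫ a := by
        apply yonedaEquiv.injective
        rw [yonedaEquiv_comp, Equiv.apply_symm_apply, yonedaEquiv_yoneda_map]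
      rw [Functor.comp_map, ha, L.map_comp]
      change (L.map a).hom.app _ ((L.map (yonedaEquiv.symm γ)).hom.app _ z) = _
      rw [hz]
      exact NatTrans.naturality_apply (L.map a).hom i.op w
    refine ⟨V, (prod.fst : yoneda.obj X₁ ⨯ yoneda.obj X₂ ⟶ _).app _ γ,
      (prod.snd : yoneda.obj X₁ ⨯ yoneda.obj X₂ ⟶ _).app _ γ, z, ?_, ?_⟩
    · exact (key _).trans (congrArg _ h₁)
    · exact (key _).trans (congrArg _ h₂)
  fork {s X Y} a b z h := by
    refine (locally_exists_elem_of_eq L (P := yoneda.obj Y) a b z ?_).mono ?_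
    · have : ∀ c : X ⟶ Y, yonedaEquiv.symm (show (yoneda.obj Y).obj (op X) from c) =
          yoneda.map c := fun c => by
        apply yonedaEquiv.injective
        rw [Equiv.apply_symm_apply, yonedaEquiv_yoneda_map]
      rw [this, this]
      exact h
    · rintro s' i ⟨V', f, z', hf, hz'⟩
      exact ⟨V', f, z', hf, hz'⟩

end Flat

/-! ### Pullback squares after sheafification -/

section LocalPullback

variable {S : Type u} [SmallCategory S] {K : GrothendieckTopology S}

/-- A commutative square of presheaves becomes a pullback square of sheaves if the map to the
pullback is locally bijective. -/
lemma isPullback_presheafToSheaf_of_locally {Q A B Z : Sᵒᵖ ⥤ Type u} {a : Q ⟶ A} {b : Q ⟶ B}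
    {f : A ⟶ Z} {g : B ⟶ Z} (w : a ≫ f = b ≫ g)
    (hinj : ∀ (s : S) (q q' : Q.obj (op s)), a.app _ q = a.app _ q' → b.app _ q = b.app _ q' →
      Locally K s (fun _ i => Q.map i.op q = Q.map i.op q'))
    (hsurj : ∀ (s : S) (x : A.obj (op s)) (y : B.obj (op s)), f.app _ x = g.app _ y →
      Locally K s (fun s' i => ∃ q : Q.obj (op s'),
        a.app _ q = A.map i.op x ∧ b.app _ q = B.map i.op y)) :
    IsPullback ((presheafToSheaf K (Type u)).map a) ((presheafToSheaf K (Type u)).map b)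
      ((presheafToSheaf K (Type u)).map f) ((presheafToSheaf K (Type u)).map g) := by
  have hev (s : S) := (IsPullback.of_hasPullback f g).map ((evaluation _ (Type u)).obj (op s))
  let φ : Q ⟶ pullback f g := pullback.lift a b w
  have h₁ : φ ≫ pullback.fst f g = a := pullback.lift_fst _ _ _
  have h₂ : φ ≫ pullback.snd f g = b := pullback.lift_snd _ _ _
  have h₁' (s : S) (q : Q.obj (op s)) : (pullback.fst f g).app _ (φ.app _ q) = a.app _ q := by
    rw [← h₁]; rfl
  have h₂' (s : S) (q : Q.obj (op s)) : (pullback.snd f g).app _ (φ.app _ q) = b.app _ q := by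
    rw [← h₂]; rfl
  have : Presheaf.IsLocallyInjective K φ := isLocallyInjective_of_locally φ (fun s q q' h =>
    hinj s q q' (by rw [← h₁', ← h₁', h]) (by rw [← h₂', ← h₂', h]))
  have : Presheaf.IsLocallySurjective K φ := isLocallySurjective_of_locally φ (fun s x => by
    refine (hsurj s ((pullback.fst f g).app _ x) ((pullback.snd f g).app _ x)
      (ConcreteCategory.congr_hom (hev s).w x)).mono ?_
    rintro s' i ⟨q, hq₁, hq₂⟩
    refine ⟨q, Types.ext_of_isPullback (hev s') ?_ ?_⟩
    · exact (h₁' _ _).trans (hq₁.trans (NatTrans.naturality_apply (pullback.fst f g) i.op x).symm)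
    · exact (h₂' _ _).trans (hq₂.trans (NatTrans.naturality_apply (pullback.snd f g) i.op x).symm))
  have : IsIso ((presheafToSheaf K (Type u)).map φ) := isIso_presheafToSheaf_map φ
  refine IsPullback.of_iso ((IsPullback.of_hasPullback f g).map (presheafToSheaf K (Type u)))
    (asIso ((presheafToSheaf K (Type u)).map φ)).symm (Iso.refl _) (Iso.refl _) (Iso.refl _)
    ?_ ?_ (by simp) (by simp)
  · rw [← h₁]; simp
  · rw [← h₂]; simp

end LocalPullback

/-! ### The tensor product of a presheaf with a functor -/

section Tensor

variable {C : Type u} [SmallCategory C] {S : Type u} [SmallCategory S] (Φ : C ⥤ Sᵒᵖ ⥤ Type u)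

/-- The generators of the tensor product of a presheaf `P` on `C` and a covariant functor `Φ` with
values in presheaves, over the object `s`: the triples `(X, z ∈ Φ(X)(s), γ ∈ P(X))`. -/
structure TensorGen (P : Cᵒᵖ ⥤ Type u) (s : Sᵒᵖ) where
  X : C
  z : (Φ.obj X).obj s
  γ : P.obj (op X)

variable {Φ}

/-- The generating relation `(X, z, f^* γ) ∼ (Y, f_* z, γ)`, for `f : X ⟶ Y`. -/
def TensorRel {P : Cᵒᵖ ⥤ Type u} {s : Sᵒᵖ} (a b : TensorGen Φ P s) : Prop :=
  ∃ f : a.X ⟶ b.X, (Φ.map f).app s a.z = b.z ∧ P.map f.op b.γ = a.γ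

variable (Φ)

/-- The tensor product over `C` of presheaves on `C` with `Φ`: the left Kan extension of `Φ` along
the Yoneda embedding, as an explicit quotient. -/
def tensor : (Cᵒᵖ ⥤ Type u) ⥤ Sᵒᵖ ⥤ Type u where
  obj P :=
    { obj := fun s => Quot (TensorRel (Φ := Φ) (P := P) (s := s))
      map := fun {s s'} i => TypeCat.ofHom (Quot.map
        (fun a => ⟨a.X, (Φ.obj a.X).map i a.z, a.γ⟩) (by
          rintro a b ⟨f, h₁, h₂⟩
          exact ⟨f, (NatTrans.naturality_apply (Φ.map f) i a.z).trans (congrArg _ h₁), h₂⟩))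
      map_id := fun s => by
        ext ⟨a⟩
        simp [Quot.map]
      map_comp := fun i j => by
        ext ⟨a⟩
        simp [Quot.map] }
  map {P Q} φ :=
    { app := fun s => TypeCat.ofHom (Quot.map (fun a => ⟨a.X, a.z, φ.app _ a.γ⟩) (by
        rintro a b ⟨f, h₁, h₂⟩
        exact ⟨f, h₁, (NatTrans.naturality_apply φ f.op b.γ).symm.trans (congrArg _ h₂)⟩))
      naturality := fun s s' i => by
        ext ⟨a⟩
        rfl }
  map_id P := by
    ext s ⟨a⟩
    rfl
  map_comp φ ψ := by
    ext s ⟨a⟩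
    rfl

variable {Φ}

/-- The class of a generator in the tensor product. -/
def tensorMk {P : Cᵒᵖ ⥤ Type u} {s : Sᵒᵖ} (X : C) (z : (Φ.obj X).obj s) (γ : P.obj (op X)) :
    ((tensor Φ).obj P).obj s :=
  Quot.mk _ ⟨X, z, γ⟩

lemma tensorMk_surj {P : Cᵒᵖ ⥤ Type u} {s : Sᵒᵖ} (w : ((tensor Φ).obj P).obj s) :
    ∃ X z γ, w = tensorMk (Φ := Φ) (P := P) X z γ := by
  obtain ⟨a⟩ := w
  exact ⟨a.X, a.z, a.γ, rfl⟩

lemma tensorMk_map {P : Cᵒᵖ ⥤ Type u} {s : Sᵒᵖ} {X Y : C} (f : X ⟶ Y)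
    (z : (Φ.obj X).obj s) (γ : P.obj (op Y)) :
    tensorMk X z (P.map f.op γ) = tensorMk Y ((Φ.map f).app s z) γ :=
  Quot.sound ⟨f, rfl, rfl⟩

variable (Φ)

/-- The right adjoint of `tensor Φ`, sending a presheaf `t` on `S` to `X ↦ Hom(Φ(X), t)`. -/
def tensorRight : (Sᵒᵖ ⥤ Type u) ⥤ Cᵒᵖ ⥤ Type u :=
  yoneda ⋙ (Functor.whiskeringLeft _ _ _).obj Φ.op

/-- The adjunction between the tensor product with `Φ` and `t ↦ (X ↦ Hom(Φ(X), t))`. -/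
def tensorAdj : tensor Φ ⊣ tensorRight Φ :=
  Adjunction.mkOfHomEquiv
    { homEquiv := fun P t =>
        { toFun := fun φ =>
            { app := fun X => TypeCat.ofHom (fun γ =>
                { app := fun s => TypeCat.ofHom (fun z => φ.app s (tensorMk X.unop z γ))
                  naturality := fun s s' i => by
                    ext z
                    exact NatTrans.naturality_apply φ i (tensorMk X.unop z γ) })
              naturality := fun X Y f => by
                ext γ
                apply NatTrans.ext
                ext s z
                exact congrArg (φ.app s) (tensorMk_map f.unop z γ) }
          invFun := fun ψ =>
            { app := fun s => TypeCat.ofHom (Quot.lift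
                (fun a => NatTrans.app (F := Φ.obj a.X) (G := t) (ψ.app (op a.X) a.γ) s a.z) (by
                  rintro a b ⟨f, h₁, h₂⟩
                  have := NatTrans.naturality_apply ψ f.op b.γ
                  dsimp only
                  rw [← h₁, ← h₂, this]
                  rfl))
              naturality := fun s s' i => by
                ext ⟨a⟩
                exact NatTrans.naturality_apply (F := Φ.obj a.X) (G := t)
                  (ψ.app (op a.X) a.γ) i a.z }
          left_inv := fun φ => by
            ext s ⟨a⟩
            rfl
          right_inv := fun ψ => by
            ext X γ
            rfl }
      homEquiv_naturality_left_symm := fun f g => by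
        ext s ⟨a⟩
        rfl
      homEquiv_naturality_right := fun f g => by
        ext X γ
        rfl }

end Tensor

/-! ### Locally flat functors give left exact functors -/

section Flatness

variable {C : Type u} [SmallCategory C] {S : Type u} [SmallCategory S]
  {K : GrothendieckTopology S} {Φ : C ⥤ Sheaf K (Type u)}

/-- The cospan form of local flatness. -/
lemma LocallyFlat.cospan (hΦ : LocallyFlat Φ) {s : S} {X₁ X₂ Y : C} (a₁ : X₁ ⟶ Y) (a₂ : X₂ ⟶ Y)
    (z₁ : (Φ.obj X₁).obj.obj (op s)) (z₂ : (Φ.obj X₂).obj.obj (op s))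
    (h : (Φ.map a₁).hom.app _ z₁ = (Φ.map a₂).hom.app _ z₂) :
    Locally K s (fun s' i => ∃ (X : C) (f₁ : X ⟶ X₁) (f₂ : X ⟶ X₂) (z : (Φ.obj X).obj.obj (op s')),
      f₁ ≫ a₁ = f₂ ≫ a₂ ∧ (Φ.map f₁).hom.app _ z = (Φ.obj X₁).obj.map i.op z₁ ∧
        (Φ.map f₂).hom.app _ z = (Φ.obj X₂).obj.map i.op z₂) := by
  refine (hΦ.span z₁ z₂).bind ?_
  rintro s' i ⟨X, f₁, f₂, z, h₁, h₂⟩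
  refine (hΦ.fork (f₁ ≫ a₁) (f₂ ≫ a₂) z ?_).mono ?_
  · rw [map_comp_hom_app, map_comp_hom_app, h₁, h₂, sheafHom_app_map, sheafHom_app_map, h]
  · rintro s'' j ⟨X', f, z', hf, hz'⟩
    refine ⟨X', f ≫ f₁, f ≫ f₂, z', by simpa using hf, ?_, ?_⟩
    · rw [map_comp_hom_app, hz', section_map_comp, ← h₁, sheafHom_app_map]
    · rw [map_comp_hom_app, hz', section_map_comp, ← h₂, sheafHom_app_map]

variable (Φ) in
/-- The class of a generator in the tensor product with a functor with values in sheaves. -/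
abbrev sheafTensorMk {P : Cᵒᵖ ⥤ Type u} {s : Sᵒᵖ} (X : C) (z : (Φ.obj X).obj.obj s)
    (γ : P.obj (op X)) : ((tensor (Φ ⋙ sheafToPresheaf K (Type u))).obj P).obj s :=
  tensorMk (Φ := Φ ⋙ sheafToPresheaf K (Type u)) X z γ

lemma sheafTensorMk_map {P : Cᵒᵖ ⥤ Type u} {s : Sᵒᵖ} {X Y : C} (f : X ⟶ Y)
    (z : (Φ.obj X).obj.obj s) (γ : P.obj (op Y)) :
    sheafTensorMk Φ X z (P.map f.op γ) = sheafTensorMk Φ Y ((Φ.map f).hom.app s z) γ :=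
  tensorMk_map (Φ := Φ ⋙ sheafToPresheaf K (Type u)) f z γ

/-- Two generators dominated by a common third one have the same class. -/
lemma sheafTensorMk_eq {P : Cᵒᵖ ⥤ Type u} {s : Sᵒᵖ} {X X₁ X₂ : C} (f₁ : X ⟶ X₁) (f₂ : X ⟶ X₂)
    {z : (Φ.obj X).obj.obj s} {z₁ : (Φ.obj X₁).obj.obj s} {z₂ : (Φ.obj X₂).obj.obj s}
    {γ₁ : P.obj (op X₁)} {γ₂ : P.obj (op X₂)} (hγ : P.map f₁.op γ₁ = P.map f₂.op γ₂)
    (h₁ : (Φ.map f₁).hom.app s z = z₁) (h₂ : (Φ.map f₂).hom.app s z = z₂) :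
    sheafTensorMk Φ X₁ z₁ γ₁ = sheafTensorMk Φ X₂ z₂ γ₂ := by
  rw [← h₁, ← h₂, ← sheafTensorMk_map, ← sheafTensorMk_map, hγ]

/-- For a locally flat functor, two generators of a tensor product with the same class are locally
dominated by a third one. -/
lemma LocallyFlat.locally_of_tensorMk_eq (hΦ : LocallyFlat Φ) {P : Cᵒᵖ ⥤ Type u} {s : S}
    {X₁ X₂ : C} {z₁ : (Φ.obj X₁).obj.obj (op s)} {z₂ : (Φ.obj X₂).obj.obj (op s)}
    {γ₁ : P.obj (op X₁)} {γ₂ : P.obj (op X₂)}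
    (h : sheafTensorMk Φ X₁ z₁ γ₁ = sheafTensorMk Φ X₂ z₂ γ₂) :
    Locally K s (fun s' i => ∃ (X : C) (f₁ : X ⟶ X₁) (f₂ : X ⟶ X₂) (z : (Φ.obj X).obj.obj (op s')),
      P.map f₁.op γ₁ = P.map f₂.op γ₂ ∧ (Φ.map f₁).hom.app _ z = (Φ.obj X₁).obj.map i.op z₁ ∧
        (Φ.map f₂).hom.app _ z = (Φ.obj X₂).obj.map i.op z₂) := by
  have key : ∀ (a b : TensorGen (Φ ⋙ sheafToPresheaf K (Type u)) P (op s)),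
      Relation.EqvGen TensorRel a b → Locally K s (fun s' i =>
        ∃ (X : C) (f₁ : X ⟶ a.X) (f₂ : X ⟶ b.X) (z : (Φ.obj X).obj.obj (op s')),
          P.map f₁.op a.γ = P.map f₂.op b.γ ∧
            (Φ.map f₁).hom.app _ z = (Φ.obj a.X).obj.map i.op a.z ∧
            (Φ.map f₂).hom.app _ z = (Φ.obj b.X).obj.map i.op b.z) := by
    intro a b hab
    induction hab with
    | rel a b h =>
      obtain ⟨f, h₁, h₂⟩ := h
      refine Locally.of_forall (fun s' i => ⟨a.X, 𝟙 _, f, (Φ.obj a.X).obj.map i.op a.z, ?_, ?_, ?_⟩)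
      · simpa using h₂.symm
      · simp
      · rw [sheafHom_app_map]
        exact congrArg _ h₁
    | refl a =>
      refine Locally.of_forall (fun s' i => ⟨a.X, 𝟙 _, 𝟙 _, (Φ.obj a.X).obj.map i.op a.z, rfl,
        ?_, ?_⟩) <;> simp
    | symm a b _ ih =>
      refine ih.mono ?_
      rintro s' i ⟨X, f₁, f₂, z, h₁, h₂, h₃⟩
      exact ⟨X, f₂, f₁, z, h₁.symm, h₃, h₂⟩
    | trans a b c _ _ ih₁ ih₂ =>
      refine ih₁.bind ?_
      rintro s' i ⟨X, f₁, f₂, z, h₁, h₂, h₃⟩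
      refine (ih₂.pullback i).bind ?_
      rintro s'' j ⟨Y, g₁, g₂, y, h₄, h₅, h₆⟩
      refine (hΦ.cospan f₂ g₁ ((Φ.obj X).obj.map j.op z) y ?_).mono ?_
      · rw [sheafHom_app_map, h₃, h₅]
        exact (section_map_comp _ _ _ _).symm
      · rintro s₃ k ⟨T, p, q, t, hpq, hp, hq⟩
        refine ⟨T, p ≫ f₁, q ≫ g₂, t, ?_, ?_, ?_⟩
        · rw [section_map_comp, section_map_comp, h₁, ← h₄, ← section_map_comp, hpq,
            section_map_comp]
        · rw [map_comp_hom_app, hp, sheafHom_app_map, sheafHom_app_map, h₂, Category.assoc]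
          exact ((section_map_comp _ _ _ _).trans (congrArg _ (section_map_comp _ _ _ _))).symm
        · rw [map_comp_hom_app, hq, sheafHom_app_map, h₆, Category.assoc]
          exact (section_map_comp _ _ _ _).symm
  exact key _ _ (Quot.eqvGen_exact h)

variable (Φ)

/-- The colimit-preserving extension to presheaves of a functor with values in sheaves. -/
def sheafTensor : (Cᵒᵖ ⥤ Type u) ⥤ Sheaf K (Type u) :=
  tensor (Φ ⋙ sheafToPresheaf K (Type u)) ⋙ presheafToSheaf K (Type u)

/-- The right adjoint of `sheafTensor Φ`, sending `t` to `X ↦ Hom(Φ(X), t)`. -/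
def sheafTensorRight : Sheaf K (Type u) ⥤ Cᵒᵖ ⥤ Type u :=
  sheafToPresheaf K (Type u) ⋙ tensorRight (Φ ⋙ sheafToPresheaf K (Type u))

/-- The adjunction between `sheafTensor Φ` and `sheafTensorRight Φ`. -/
def sheafTensorAdj : sheafTensor Φ ⊣ sheafTensorRight Φ :=
  (tensorAdj _).comp (sheafificationAdjunction K (Type u))

variable {Φ}

lemma LocallyFlat.preservesTerminal (hΦ : LocallyFlat Φ) :
    PreservesLimit (Functor.empty.{0} _) (sheafTensor Φ) := by
  let φ : (tensor (Φ ⋙ sheafToPresheaf K (Type u))).obj (⊤_ _) ⟶ ⊤_ _ := terminal.from _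
  have hsub (X : C) : Subsingleton ((⊤_ (Cᵒᵖ ⥤ Type u)).obj (op X)) :=
    subsingleton_elem_terminal ((evaluation _ _).obj (op X))
  have hsub' (s : S) : Subsingleton ((⊤_ (Sᵒᵖ ⥤ Type u)).obj (op s)) :=
    subsingleton_elem_terminal ((evaluation _ _).obj (op s))
  have : Presheaf.IsLocallyInjective K φ := isLocallyInjective_of_locally φ (fun s x y _ => by
    obtain ⟨X₁, z₁, γ₁, rfl⟩ := tensorMk_surj x
    obtain ⟨X₂, z₂, γ₂, rfl⟩ := tensorMk_surj y
    refine (hΦ.span z₁ z₂).mono ?_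
    rintro s' i ⟨X, f₁, f₂, z, hz₁, hz₂⟩
    exact sheafTensorMk_eq f₁ f₂ (Subsingleton.elim _ _) hz₁ hz₂)
  have : Presheaf.IsLocallySurjective K φ := isLocallySurjective_of_locally φ (fun s w => by
    refine (hΦ.nonempty s).mono ?_
    rintro s' i ⟨X, ⟨z⟩⟩
    obtain ⟨γ⟩ := exists_elem_terminal ((evaluation Cᵒᵖ (Type u)).obj (op X))
    exact ⟨sheafTensorMk Φ X z γ, Subsingleton.elim _ _⟩)
  have : IsIso ((presheafToSheaf K (Type u)).map φ) := isIso_presheafToSheaf_map φ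
  exact preservesTerminal_of_iso _ ((asIso ((presheafToSheaf K (Type u)).map φ)).trans
    (PreservesTerminal.iso (presheafToSheaf K (Type u))))

lemma LocallyFlat.map_isPullback (hΦ : LocallyFlat Φ) {P Q Z : Cᵒᵖ ⥤ Type u} (f : P ⟶ Z)
    (g : Q ⟶ Z) :
    IsPullback ((sheafTensor Φ).map (pullback.fst f g)) ((sheafTensor Φ).map (pullback.snd f g))
      ((sheafTensor Φ).map f) ((sheafTensor Φ).map g) := by
  have hev (X : C) := (IsPullback.of_hasPullback f g).map ((evaluation _ (Type u)).obj (op X))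
  apply isPullback_presheafToSheaf_of_locally
  · rw [← Functor.map_comp, ← Functor.map_comp, pullback.condition]
  · intro s q q' ha hb
    obtain ⟨X₁, z₁, γ₁, rfl⟩ := tensorMk_surj q
    obtain ⟨X₂, z₂, γ₂, rfl⟩ := tensorMk_surj q'
    refine (hΦ.locally_of_tensorMk_eq ha).bind ?_
    rintro s' i ⟨X, f₁, f₂, z, hγ, hz₁, hz₂⟩
    refine ((hΦ.locally_of_tensorMk_eq hb).pullback i).bind ?_
    rintro s'' j ⟨Y, g₁, g₂, y, hγ', hy₁, hy₂⟩
    -- `X` and `Y` are both over `X₁` and `X₂`; the common refinement is taken first over `X₁`,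
    -- then over `X₂`.
    refine (hΦ.cospan f₁ g₁ ((Φ.obj X).obj.map j.op z) y ?_).bind ?_
    · rw [sheafHom_app_map, hz₁, hy₁]
      exact (section_map_comp _ _ _ _).symm
    rintro s₃ k ⟨T, p, r, t, hpr, hp, hr⟩
    refine (hΦ.fork (p ≫ f₂) (r ≫ g₂) t ?_).mono ?_
    · rw [map_comp_hom_app, map_comp_hom_app, hp, hr, sheafHom_app_map, sheafHom_app_map,
        sheafHom_app_map, hz₂, hy₂]
      exact congrArg _ (section_map_comp _ _ _ _).symm
    · rintro s₄ l ⟨T', e, t', he, ht'⟩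
      refine sheafTensorMk_eq (e ≫ p ≫ f₁) (e ≫ r ≫ g₂) (z := t') ?_ ?_ ?_
      · apply Types.ext_of_isPullback (hev T')
        · refine (NatTrans.naturality_apply (pullback.fst f g) _ _).trans (Eq.trans ?_
            (NatTrans.naturality_apply (pullback.fst f g) _ _).symm)
          rw [← he, section_map_comp, section_map_comp, hγ, ← section_map_comp,
            ← section_map_comp, Category.assoc]
        · refine (NatTrans.naturality_apply (pullback.snd f g) _ _).trans (Eq.trans ?_
            (NatTrans.naturality_apply (pullback.snd f g) _ _).symm)
          rw [hpr, section_map_comp, section_map_comp, hγ', ← section_map_comp,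
            ← section_map_comp, Category.assoc]
      · rw [map_comp_hom_app, map_comp_hom_app, ht', sheafHom_app_map, hp, sheafHom_app_map,
          sheafHom_app_map, sheafHom_app_map, hz₁, ← section_map_comp, ← section_map_comp,
          ← section_map_comp]
        simp only [Category.assoc]
        rfl
      · rw [map_comp_hom_app, map_comp_hom_app, ht', sheafHom_app_map, hr, sheafHom_app_map,
          sheafHom_app_map, hy₂, ← section_map_comp, ← section_map_comp]
        simp only [Category.assoc]
        rfl
  · intro s x y hxy
    obtain ⟨X₁, z₁, γ₁, rfl⟩ := tensorMk_surj x
    obtain ⟨X₂, z₂, γ₂, rfl⟩ := tensorMk_surj y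
    refine (hΦ.locally_of_tensorMk_eq hxy).mono ?_
    rintro s' i ⟨X, f₁, f₂, z, hγ, hz₁, hz₂⟩
    obtain ⟨γ, h₁, h₂⟩ := Types.exists_of_isPullback (hev X) (P.map f₁.op γ₁) (Q.map f₂.op γ₂)
      ((NatTrans.naturality_apply f f₁.op γ₁).trans (hγ.trans
        (NatTrans.naturality_apply g f₂.op γ₂).symm))
    refine ⟨sheafTensorMk Φ X z γ, ?_, ?_⟩
    · exact sheafTensorMk_eq (𝟙 X) f₁ (z := z) (by simpa using h₁) (by simp) hz₁
    · exact sheafTensorMk_eq (𝟙 X) f₂ (z := z) (by simpa using h₂) (by simp) hz₂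

/-- The colimit-preserving extension of a locally flat functor is left exact. -/
lemma LocallyFlat.preservesFiniteLimits (hΦ : LocallyFlat Φ) :
    PreservesFiniteLimits (sheafTensor Φ) := by
  have := hΦ.preservesTerminal
  have : PreservesLimitsOfShape WalkingCospan (sheafTensor Φ) :=
    preservesLimitsOfShape_walkingCospan_of_forall_isPullback (fun P Q Z f g _ =>
      ⟨_, _, _, IsPullback.of_hasPullback f g, hΦ.map_isPullback f g⟩)
  have := preservesLimitsOfShape_pempty_of_preservesTerminal (sheafTensor Φ)
  exact preservesFiniteLimits_of_preservesTerminal_and_pullbacks _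

end Flatness

/-! ### Locally flat functors give morphisms of topoi -/

section Diaconescu

variable {C : Type u} [SmallCategory C] {S : Type u} [SmallCategory S]
  {K : GrothendieckTopology S}

/-- A presieve on `X` is sent by `Φ` to a locally jointly surjective family. -/
def CoversLocally (Φ : C ⥤ Sheaf K (Type u)) {X : C} (R : Presieve X) : Prop :=
  ∀ (s : S) (z : (Φ.obj X).obj.obj (op s)), Locally K s (fun s' i =>
    ∃ (Y : C) (f : Y ⟶ X) (_ : R f) (z' : (Φ.obj Y).obj.obj (op s')),
      (Φ.map f).hom.app _ z' = (Φ.obj X).obj.map i.op z)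

variable {Φ : C ⥤ Sheaf K (Type u)}

lemma LocallyFlat.coversLocally_pullback (hΦ : LocallyFlat Φ) {X Y : C} (f : Y ⟶ X)
    {R : Presieve X} (hR : CoversLocally Φ R) :
    CoversLocally Φ ((Sieve.generate R).pullback f).arrows := by
  intro s z
  refine (hR s ((Φ.map f).hom.app _ z)).bind ?_
  rintro s' i ⟨X', r, hr, x, hx⟩
  refine (hΦ.cospan r f x ((Φ.obj Y).obj.map i.op z) ?_).mono ?_
  · rw [hx, sheafHom_app_map]
  · rintro s'' j ⟨Z, p, q, w, hpq, -, hq⟩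
    exact ⟨Z, q, ⟨X', p, r, hr, hpq⟩, w, by rw [hq, section_map_comp]⟩

/-- If `Φ` is locally flat and sends a sieve to a jointly epimorphic family, the presheaves
`X ↦ Hom(Φ(X), t)` satisfy the sheaf condition for this sieve. -/
lemma LocallyFlat.isSheafFor (hΦ : LocallyFlat Φ) {X : C} {T : Sieve X}
    (hT : CoversLocally Φ T.arrows) (t : Sheaf K (Type u)) :
    Presieve.IsSheafFor ((sheafTensorRight Φ).obj t) T.arrows := by
  let φ := (tensor (Φ ⋙ sheafToPresheaf K (Type u))).map T.functorInclusion
  have : Presheaf.IsLocallyInjective K φ := isLocallyInjective_of_locally φ (fun s q q' h => by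
    obtain ⟨X₁, z₁, ⟨γ₁, h₁⟩, rfl⟩ := tensorMk_surj q
    obtain ⟨X₂, z₂, ⟨γ₂, h₂⟩, rfl⟩ := tensorMk_surj q'
    refine (hΦ.locally_of_tensorMk_eq h).mono ?_
    rintro s' i ⟨Y, f₁, f₂, z, hγ, hz₁, hz₂⟩
    exact sheafTensorMk_eq f₁ f₂ (Subtype.ext hγ) hz₁ hz₂)
  have : Presheaf.IsLocallySurjective K φ := isLocallySurjective_of_locally φ (fun s w => by
    obtain ⟨X₁, z, γ, rfl⟩ := tensorMk_surj w
    refine (hT s ((Φ.map γ).hom.app _ z)).mono ?_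
    rintro s' i ⟨Y, f, hf, z', hz'⟩
    refine ⟨sheafTensorMk Φ Y z' (⟨f, hf⟩ : T.functor.obj (op Y)), ?_⟩
    have h₁ : sheafTensorMk Φ Y z' (P := yoneda.obj X) f =
        sheafTensorMk Φ X ((Φ.map f).hom.app _ z') (P := yoneda.obj X) (𝟙 X) := by
      refine Eq.trans ?_ (sheafTensorMk_map (P := yoneda.obj X) f z' (𝟙 X))
      exact congrArg _ (Category.comp_id f).symm
    have h₂ : sheafTensorMk Φ X₁ ((Φ.obj X₁).obj.map i.op z) (P := yoneda.obj X) γ =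
        sheafTensorMk Φ X ((Φ.map γ).hom.app _ ((Φ.obj X₁).obj.map i.op z))
          (P := yoneda.obj X) (𝟙 X) := by
      refine Eq.trans ?_ (sheafTensorMk_map (P := yoneda.obj X) γ _ (𝟙 X))
      exact congrArg _ (Category.comp_id (show X₁ ⟶ X from γ)).symm
    refine h₁.trans (Eq.trans ?_ h₂.symm)
    rw [hz']
    exact congrArg (fun v => sheafTensorMk Φ X v (P := yoneda.obj X) (𝟙 X))
      (sheafHom_app_map (Φ.map γ) i z).symm)
  have hiso : IsIso ((sheafTensor Φ).map T.functorInclusion) := isIso_presheafToSheaf_map φ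
  rw [Presieve.isSheafFor_iff_yonedaSheafCondition]
  intro f
  let e := (sheafTensorAdj Φ).homEquiv T.functor t
  let e' := (sheafTensorAdj Φ).homEquiv (yoneda.obj X) t
  refine ⟨e' (inv ((sheafTensor Φ).map T.functorInclusion) ≫ e.symm f), ?_, ?_⟩
  · dsimp only
    rw [← Adjunction.homEquiv_naturality_left, IsIso.hom_inv_id_assoc]
    exact e.apply_symm_apply f
  · intro g hg
    apply e'.symm.injective
    rw [Equiv.symm_apply_apply, IsIso.eq_inv_comp, ← Adjunction.homEquiv_naturality_left_symm, hg]

/-- If `Φ` is locally flat and sends the generating coverings to jointly epimorphic families,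
the presheaves `X ↦ Hom(Φ(X), t)` are sheaves. -/
lemma LocallyFlat.isSheaf (hΦ : LocallyFlat Φ) (J : Precoverage C)
    (hJ : ∀ (X : C) (R : Presieve X), R ∈ J X → CoversLocally Φ R) (t : Sheaf K (Type u)) :
    Presheaf.IsSheaf J.toGrothendieck ((sheafTensorRight Φ).obj t) := by
  rw [isSheaf_iff_isSheaf_of_type, Precoverage.isSheaf_toGrothendieck_iff]
  intro X Y f R hR
  exact hΦ.isSheafFor (hΦ.coversLocally_pullback f (hJ X R hR)) t

variable (Φ) in
/-- The morphism of topoi given by a locally flat functor `Φ` for which the presheaves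
`X ↦ Hom(Φ(X), t)` are sheaves. Its direct image sends `t` to `X ↦ Hom(Φ(X), t)`. -/
def LocallyFlat.geometricMorphism (hΦ : LocallyFlat Φ) (J : GrothendieckTopology C)
    (hJ : ∀ t : Sheaf K (Type u), Presheaf.IsSheaf J ((sheafTensorRight Φ).obj t)) :
    GeometricMorphism (Sheaf K (Type u)) (Sheaf J (Type u)) where
  pushforward := ObjectProperty.lift _ (sheafTensorRight Φ) hJ
  pullback := sheafToPresheaf J (Type u) ⋙ sheafTensor Φ
  adj := (sheafTensorAdj Φ).restrictFullyFaithful (fullyFaithfulSheafToPresheaf J (Type u))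
    (Functor.FullyFaithful.id _) (Iso.refl _) (Iso.refl _)
  exact := by
    have := hΦ.preservesFiniteLimits
    exact comp_preservesFiniteLimits _ _

end Diaconescu

/-! ### Testing morphisms of topoi on representable sheaves -/

section Density

variable {C : Type u} [SmallCategory C] {J : GrothendieckTopology C}

/-- The morphism from the sheaf associated to `X` to the sheaf associated to `P` given by a
section of the presheaf `P` over `X`. -/
def presheafSec (J : GrothendieckTopology C) {P : Cᵒᵖ ⥤ Type u} {X : C} (γ : P.obj (op X)) :
    (repSheaf J).obj X ⟶ (presheafToSheaf J (Type u)).obj P :=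
  (presheafToSheaf J (Type u)).map (yonedaEquiv.symm γ)

lemma presheafSec_eq_secHom {P : Cᵒᵖ ⥤ Type u} {X : C} (γ : P.obj (op X)) :
    presheafSec J γ = secHom ((toSheafify J P).app _ γ) := by
  apply repSheafEquiv.injective
  rw [secHom, Equiv.apply_symm_apply, presheafSec]
  dsimp [repSheafEquiv]
  have h := (sheafificationAdjunction J (Type u)).unit.naturality (yonedaEquiv.symm γ)
  have h' := (sheafificationAdjunction J (Type u)).homEquiv_unit
    (f := (presheafToSheaf J (Type u)).map (yonedaEquiv.symm γ))
  refine (congrArg yonedaEquiv (h'.trans h.symm)).trans ?_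
  refine (yonedaEquiv_comp _ _).trans ?_
  exact congrArg _ (Equiv.apply_symm_apply yonedaEquiv γ)

lemma presheafToSheaf_hom_ext {P : Cᵒᵖ ⥤ Type u} {G : Sheaf J (Type u)}
    {a b : (presheafToSheaf J (Type u)).obj P ⟶ G}
    (h : ∀ (X : C) (γ : P.obj (op X)), presheafSec J γ ≫ a = presheafSec J γ ≫ b) : a = b := by
  apply ((sheafificationAdjunction J (Type u)).homEquiv _ _).injective
  ext ⟨X⟩ γ
  have h₁ : ∀ c : (presheafToSheaf J (Type u)).obj P ⟶ G,
      repSheafEquiv (presheafSec J γ ≫ c) =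
        ((sheafificationAdjunction J (Type u)).homEquiv _ _ c).app (op X) γ := by
    intro c
    rw [repSheafEquiv_comp, presheafSec_eq_secHom, secHom, Equiv.apply_symm_apply,
      Adjunction.homEquiv_unit]
    rfl
  exact ((h₁ a).symm.trans (congrArg _ (h X γ))).trans (h₁ b)

variable {T : Type w₁} [Category.{v₁} T]

lemma GeometricMorphism.hom_ext_presheafSec (h : GeometricMorphism T (Sheaf J (Type u)))
    {P : Cᵒᵖ ⥤ Type u} {t : T} {a b : h.pullback.obj ((presheafToSheaf J (Type u)).obj P) ⟶ t}
    (hab : ∀ (X : C) (γ : P.obj (op X)),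
      h.pullback.map (presheafSec J γ) ≫ a = h.pullback.map (presheafSec J γ) ≫ b) : a = b := by
  apply (h.adj.homEquiv _ _).injective
  apply presheafToSheaf_hom_ext
  intro X γ
  rw [← Adjunction.homEquiv_naturality_left, ← Adjunction.homEquiv_naturality_left, hab]

lemma GeometricMorphism.hom_ext_secHom (h : GeometricMorphism T (Sheaf J (Type u)))
    {G : Sheaf J (Type u)} {t : T} {a b : h.pullback.obj G ⟶ t}
    (hab : ∀ (X : C) (γ : G.obj.obj (op X)),
      h.pullback.map (secHom γ) ≫ a = h.pullback.map (secHom γ) ≫ b) : a = b := by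
  apply (h.adj.homEquiv _ _).injective
  apply Sheaf.hom_ext_secHom
  intro X γ
  rw [← Adjunction.homEquiv_naturality_left, ← Adjunction.homEquiv_naturality_left, hab]

/-- An inverse image functor is a left adjoint on sheaves, hence determined by its restriction to
representable sheaves. -/
lemma GeometricMorphism.natTrans_ext (h : GeometricMorphism T (Sheaf J (Type u)))
    {H : Sheaf J (Type u) ⥤ T} {α α' : h.pullback ⟶ H}
    (hα : ∀ X : C, α.app ((repSheaf J).obj X) = α'.app ((repSheaf J).obj X)) : α = α' := by
  ext G
  apply h.hom_ext_secHom
  intro X γ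
  rw [α.naturality, α'.naturality, hα]

/-- A transformation between the restrictions to representable sheaves of an inverse image functor
and of another functor extends to all sheaves. -/
lemma GeometricMorphism.exists_natTrans (h : GeometricMorphism T (Sheaf J (Type u)))
    (H : Sheaf J (Type u) ⥤ T) (β : repSheaf J ⋙ h.pullback ⟶ repSheaf J ⋙ H) :
    ∃ α : h.pullback ⟶ H, ∀ X : C, α.app ((repSheaf J).obj X) = β.app X := by
  let φ (G : Sheaf J (Type u)) : G ⟶ h.pushforward.obj (H.obj G) :=
    ⟨{ app := fun X => TypeCat.ofHom (fun γ =>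
        repSheafEquiv (h.adj.homEquiv _ _ (β.app X.unop ≫ H.map (secHom γ))))
       naturality := fun X Y f => by
        ext γ
        dsimp
        rw [← f.op_unop, ← repSheafEquiv_map_comp, ← Adjunction.homEquiv_naturality_left]
        have := β.naturality f.unop
        dsimp at this
        rw [reassoc_of% this, ← H.map_comp, map_secHom] }⟩
  have hφ (G : Sheaf J (Type u)) (X : C) (γ : G.obj.obj (op X)) :
      secHom γ ≫ φ G = h.adj.homEquiv _ _ (β.app X ≫ H.map (secHom γ)) := by
    apply repSheafEquiv.injective
    rw [repSheafEquiv_comp, secHom, Equiv.apply_symm_apply]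
    rfl
  have hφ' (G : Sheaf J (Type u)) (X : C) (γ : G.obj.obj (op X)) :
      h.pullback.map (secHom γ) ≫ (h.adj.homEquiv _ _).symm (φ G) =
        β.app X ≫ H.map (secHom γ) := by
    rw [← Adjunction.homEquiv_naturality_left_symm, hφ, Equiv.symm_apply_apply]
  refine ⟨{ app := fun G => (h.adj.homEquiv _ _).symm (φ G), naturality := ?_ }, ?_⟩
  · intro G G' b
    apply h.hom_ext_secHom
    intro X γ
    rw [← Functor.map_comp_assoc, secHom_comp, hφ', reassoc_of% (hφ' G X γ), ← H.map_comp,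
      secHom_comp]
  · intro X
    have := hφ' _ X (repSheafOne J X)
    rw [secHom_one, h.pullback.map_id, Category.id_comp, H.map_id] at this
    exact this.trans (Category.comp_id _)

end Density

/-! ### Sections of the inverse image under a cocontinuous functor -/

section Cocontinuous

variable {A B : Type u} [SmallCategory A] [SmallCategory B] (F : A ⥤ B)
  (J : GrothendieckTopology A) (K : GrothendieckTopology B) [F.IsCocontinuous J K]

/-- The morphism `X → p^* G` given by a section `γ ∈ G(F(X))`, where `p` is the morphism of topoi
induced by the cocontinuous functor `F`. -/
def cocontinuousSec {G : Sheaf K (Type u)} {X : A} (γ : G.obj.obj (op (F.obj X))) :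
    (repSheaf J).obj X ⟶ (cocontinuousGeometricMorphism F J K).pullback.obj G :=
  presheafSec J (P := F.op ⋙ G.obj) γ

lemma cocontinuousSec_comp {G G' : Sheaf K (Type u)} {X : A} (γ : G.obj.obj (op (F.obj X)))
    (b : G ⟶ G') :
    cocontinuousSec F J K γ ≫ (cocontinuousGeometricMorphism F J K).pullback.map b =
      cocontinuousSec F J K (b.hom.app _ γ) := by
  refine ((presheafToSheaf J (Type u)).map_comp _ _).symm.trans (congrArg _ ?_)
  apply yonedaEquiv.injective
  rw [yonedaEquiv_comp, Equiv.apply_symm_apply, Equiv.apply_symm_apply]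
  rfl

lemma map_cocontinuousSec {G : Sheaf K (Type u)} {X X' : A} (f : X' ⟶ X)
    (γ : G.obj.obj (op (F.obj X))) :
    (repSheaf J).map f ≫ cocontinuousSec F J K γ =
      cocontinuousSec F J K (G.obj.map (F.map f).op γ) := by
  refine ((presheafToSheaf J (Type u)).map_comp _ _).symm.trans (congrArg _ ?_)
  apply yonedaEquiv.injective
  rw [← yonedaEquiv_naturality, Equiv.apply_symm_apply, Equiv.apply_symm_apply]
  rfl

/-- The canonical morphism `X → p^* F(X)`. -/
def cocontinuousOne (X : A) :
    (repSheaf J).obj X ⟶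
      (cocontinuousGeometricMorphism F J K).pullback.obj ((repSheaf K).obj (F.obj X)) :=
  cocontinuousSec F J K (repSheafOne K (F.obj X))

lemma cocontinuousOne_comp {G : Sheaf K (Type u)} {X : A} (γ : G.obj.obj (op (F.obj X))) :
    cocontinuousOne F J K X ≫ (cocontinuousGeometricMorphism F J K).pullback.map (secHom γ) =
      cocontinuousSec F J K γ := by
  rw [cocontinuousOne, cocontinuousSec_comp, secHom_app_one]

lemma map_cocontinuousOne {X X' : A} (f : X' ⟶ X) :
    (repSheaf J).map f ≫ cocontinuousOne F J K X = cocontinuousOne F J K X' ≫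
      (cocontinuousGeometricMorphism F J K).pullback.map ((repSheaf K).map (F.map f)) := by
  rw [cocontinuousOne, map_cocontinuousSec, cocontinuousOne, cocontinuousSec_comp,
    repSheaf_map_app_one]

lemma GeometricMorphism.hom_ext_cocontinuousSec {T : Type w₁} [Category.{v₁} T]
    (h : GeometricMorphism T (Sheaf J (Type u)))
    {G : Sheaf K (Type u)} {t : T}
    {a b : h.pullback.obj ((cocontinuousGeometricMorphism F J K).pullback.obj G) ⟶ t}
    (hab : ∀ (X : A) (γ : G.obj.obj (op (F.obj X))),
      h.pullback.map (cocontinuousSec F J K γ) ≫ a =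
        h.pullback.map (cocontinuousSec F J K γ) ≫ b) : a = b :=
  h.hom_ext_presheafSec hab

end Cocontinuous

/-! ### Full faithfulness -/

section FullyFaithful

variable {C C₁ C₂ : Type u} [SmallCategory C] [SmallCategory C₁] [SmallCategory C₂]
  (F₁ : C ⥤ C₁) (F₂ : C ⥤ C₂) (J : GrothendieckTopology C) (J₁ : GrothendieckTopology C₁)
  (J₂ : GrothendieckTopology C₂) [F₁.IsCocontinuous J J₁] [F₂.IsCocontinuous J J₂]
  {S : Type w₁} [Category.{v₁} S] {f₁ : GeometricMorphism (Sheaf J₁ (Type u)) S}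
  {f₂ : GeometricMorphism (Sheaf J₂ (Type u)) S}
  (τ : (cocontinuousGeometricMorphism F₂ J J₂).comp f₂ ⟶
    (cocontinuousGeometricMorphism F₁ J J₁).comp f₁)

/-- The triple given by two cocontinuous functors and a 2-morphism. -/
abbrev cocontinuousCone : OrientedCone f₁ f₂ (Sheaf J (Type u)) where
  fst := cocontinuousGeometricMorphism F₁ J J₁
  snd := cocontinuousGeometricMorphism F₂ J J₂
  cell := τ

/-- Every representable sheaf on `C` is the pullback of `λ : F₁(X) → f₁^* W` and
`μ : F₂(X) → f₂^* W`, for some object `W` of the base and some morphisms `λ` and `μ`. -/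
def RepresentablesArePullbacks : Prop :=
  ∀ X : C, ∃ (W : S) (l : (repSheaf J₁).obj (F₁.obj X) ⟶ f₁.pullback.obj W)
    (r : (repSheaf J₂).obj (F₂.obj X) ⟶ f₂.pullback.obj W),
    IsPullback (cocontinuousOne F₁ J J₁ X) (cocontinuousOne F₂ J J₂ X)
      ((cocontinuousGeometricMorphism F₁ J J₁).pullback.map l ≫
        (cocontinuousCone F₁ F₂ J J₁ J₂ τ).nat.app W)
      ((cocontinuousGeometricMorphism F₂ J J₂).pullback.map r)

variable {F₁ F₂ J J₁ J₂ τ}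

/-- A morphism of topoi `T → C~` is recovered from its triple, because its inverse image functor
preserves the pullbacks describing the representable sheaves. -/
lemma RepresentablesArePullbacks.faithful
    (hτ : RepresentablesArePullbacks F₁ F₂ J J₁ J₂ τ) (T : Type w₂) [Category.{v₂} T] :
    ((cocontinuousCone F₁ F₂ J J₁ J₂ τ).precompFunctor T).Faithful where
  map_injective {h h'} α α' hα := by
    apply GeometricMorphism.hom_ext
    apply h'.natTrans_ext
    intro X
    obtain ⟨W, l, r, hX⟩ := hτ X
    have := h.exact
    have hX' := hX.map h.pullback
    have h₁ := congrArg (fun a => NatTrans.app (GeometricMorphism.Hom.app (OrientedCone.Hom.fst a))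
      ((repSheaf J₁).obj (F₁.obj X))) hα
    have h₂ := congrArg (fun a => NatTrans.app (GeometricMorphism.Hom.app (OrientedCone.Hom.snd a))
      ((repSheaf J₂).obj (F₂.obj X))) hα
    apply hX'.hom_ext
    · rw [← NatTrans.naturality, ← NatTrans.naturality]
      exact congrArg _ h₁
    · rw [← NatTrans.naturality, ← NatTrans.naturality]
      exact congrArg _ h₂

/-- A morphism of triples induces morphisms between the inverse images of representable sheaves, by
the universal property of the pullbacks describing them, and these extend to all sheaves. -/
lemma RepresentablesArePullbacks.full
    (hτ : RepresentablesArePullbacks F₁ F₂ J J₁ J₂ τ) (T : Type w₂) [Category.{v₂} T] :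
    ((cocontinuousCone F₁ F₂ J J₁ J₂ τ).precompFunctor T).Full where
  map_surjective {h h'} θ := by
    have := h.exact
    let p₁ := cocontinuousGeometricMorphism F₁ J J₁
    let p₂ := cocontinuousGeometricMorphism F₂ J J₂
    let c := cocontinuousCone F₁ F₂ J J₁ J₂ τ
    choose W l r hX using hτ
    let θ₁ : p₁.pullback ⋙ h'.pullback ⟶ p₁.pullback ⋙ h.pullback := θ.fst.app
    let θ₂ : p₂.pullback ⋙ h'.pullback ⟶ p₂.pullback ⋙ h.pullback := θ.snd.app
    have hθ (W : S) : θ₁.app (f₁.pullback.obj W) ≫ h.pullback.map (c.nat.app W) =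
        h'.pullback.map (c.nat.app W) ≫ θ₂.app (f₂.pullback.obj W) :=
      congrArg (fun a => NatTrans.app a W) θ.w
    have hw (X : C) : (h'.pullback.map (cocontinuousOne F₁ J J₁ X) ≫ θ₁.app _) ≫
        h.pullback.map (p₁.pullback.map (l X) ≫ c.nat.app (W X)) =
        (h'.pullback.map (cocontinuousOne F₂ J J₂ X) ≫ θ₂.app _) ≫
          h.pullback.map (p₂.pullback.map (r X)) := by
      have e₁ : h'.pullback.map (p₁.pullback.map (l X)) ≫ θ₁.app _ =
        θ₁.app _ ≫ h.pullback.map (p₁.pullback.map (l X)) := θ₁.naturality (l X)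
      have e₂ : h'.pullback.map (p₂.pullback.map (r X)) ≫ θ₂.app _ =
        θ₂.app _ ≫ h.pullback.map (p₂.pullback.map (r X)) := θ₂.naturality (r X)
      have e₃ : cocontinuousOne F₁ J J₁ X ≫ p₁.pullback.map (l X) ≫ c.nat.app (W X) =
        cocontinuousOne F₂ J J₂ X ≫ p₂.pullback.map (r X) := (hX X).w
      have e₄ := congrArg h'.pullback.map e₃
      rw [h'.pullback.map_comp, h'.pullback.map_comp, h'.pullback.map_comp] at e₄
      rw [h.pullback.map_comp, Category.assoc, Category.assoc, ← e₂, ← reassoc_of% e₁, hθ,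
        reassoc_of% e₄]
    let β (X : C) : h'.pullback.obj ((repSheaf J).obj X) ⟶ h.pullback.obj ((repSheaf J).obj X) :=
      ((hX X).map h.pullback).lift _ _ (hw X)
    have hβ₁ (X : C) : β X ≫ h.pullback.map (cocontinuousOne F₁ J J₁ X) =
        h'.pullback.map (cocontinuousOne F₁ J J₁ X) ≫ θ₁.app _ :=
      ((hX X).map h.pullback).lift_fst _ _ (hw X)
    have hβ₂ (X : C) : β X ≫ h.pullback.map (cocontinuousOne F₂ J J₂ X) =
        h'.pullback.map (cocontinuousOne F₂ J J₂ X) ≫ θ₂.app _ :=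
      ((hX X).map h.pullback).lift_snd _ _ (hw X)
    obtain ⟨α, hα⟩ := h'.exists_natTrans h.pullback
      { app := β
        naturality := fun X Y f => by
          apply ((hX Y).map h.pullback).hom_ext
          · dsimp
            rw [Category.assoc, Category.assoc, hβ₁, ← h.pullback.map_comp, map_cocontinuousOne,
              h.pullback.map_comp, reassoc_of% hβ₁ X, ← h'.pullback.map_comp_assoc,
              map_cocontinuousOne, h'.pullback.map_comp, Category.assoc]
            exact congrArg _ (θ₁.naturality _)
          · dsimp
            rw [Category.assoc, Category.assoc, hβ₂, ← h.pullback.map_comp, map_cocontinuousOne,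
              h.pullback.map_comp, reassoc_of% hβ₂ X, ← h'.pullback.map_comp_assoc,
              map_cocontinuousOne, h'.pullback.map_comp, Category.assoc]
            exact congrArg _ (θ₂.naturality _) }
    have hα' (X : C) : α.app ((repSheaf J).obj X) = β X := hα X
    refine ⟨⟨α⟩, ?_⟩
    apply OrientedCone.hom_ext
    · apply GeometricMorphism.hom_ext
      ext G
      apply h'.hom_ext_cocontinuousSec F₁ J J₁
      intro X γ
      refine (α.naturality _).trans ?_
      rw [hα', ← cocontinuousOne_comp, h.pullback.map_comp, h'.pullback.map_comp,
        reassoc_of% (hβ₁ X)]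
      refine Eq.trans ?_ (Category.assoc _ _ _).symm
      exact congrArg _ (θ₁.naturality (secHom γ)).symm
    · apply GeometricMorphism.hom_ext
      ext G
      apply h'.hom_ext_cocontinuousSec F₂ J J₂
      intro X γ
      refine (α.naturality _).trans ?_
      rw [hα', ← cocontinuousOne_comp, h.pullback.map_comp, h'.pullback.map_comp,
        reassoc_of% (hβ₂ X)]
      refine Eq.trans ?_ (Category.assoc _ _ _).symm
      exact congrArg _ (θ₂.naturality (secHom γ)).symm

end FullyFaithful

/-! ### Sections of inverse images under a morphism of topoi -/

section GeometricSections

variable {C : Type u} [SmallCategory C] {J : GrothendieckTopology C}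
  {S : Type u} [SmallCategory S] {K : GrothendieckTopology S}
  (y : GeometricMorphism (Sheaf K (Type u)) (Sheaf J (Type u)))

/-- Sections of an inverse image `y^* G` locally come from sections of `G`. -/
lemma GeometricMorphism.locally_exists_section (G : Sheaf J (Type u)) {s : S}
    (w : (y.pullback.obj G).obj.obj (op s)) :
    Locally K s (fun s' i => ∃ (V : C) (γ : G.obj.obj (op V))
      (z : (y.pullback.obj ((repSheaf J).obj V)).obj.obj (op s')),
      (y.pullback.map (secHom γ)).hom.app _ z = (y.pullback.obj G).obj.map i.op w) := by
  refine (locally_exists_of_jointly_epi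
    (fun (i : Σ V : C, G.obj.obj (op V)) => y.pullback.map (secHom i.2)) ?_ w).mono ?_
  · intro Z a b h
    exact y.hom_ext_secHom (fun X γ => h ⟨X, γ⟩)
  · rintro s' i ⟨⟨V, γ⟩, z, hz⟩
    exact ⟨V, γ, z, hz⟩

instance : (presheafToSheaf J (Type u) ⋙ y.pullback).IsLeftAdjoint :=
  ((sheafificationAdjunction J (Type u)).comp y.adj).isLeftAdjoint

instance : PreservesFiniteLimits (presheafToSheaf J (Type u) ⋙ y.pullback) :=
  have := y.exact
  comp_preservesFiniteLimits _ _

lemma presheafSec_sheaf {G : Sheaf J (Type u)} {V : C} (γ : G.obj.obj (op V)) :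
    presheafSec J (P := G.obj) γ = secHom γ ≫ (sheafificationIso G).hom := by
  rw [presheafSec_eq_secHom, secHom_comp]
  rfl

/-- If two sections of `G` over `V` agree at a section `z` of the inverse image of `V`, then `z`
locally comes from some `V' ⟶ V` on which they agree. -/
lemma GeometricMorphism.locally_exists_of_section_eq {G : Sheaf J (Type u)} {V : C}
    (γ γ' : G.obj.obj (op V)) {s : S} (z : (y.pullback.obj ((repSheaf J).obj V)).obj.obj (op s))
    (h : (y.pullback.map (secHom γ)).hom.app _ z = (y.pullback.map (secHom γ')).hom.app _ z) :
    Locally K s (fun s' i => ∃ (V' : C) (f : V' ⟶ V)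
      (z' : (y.pullback.obj ((repSheaf J).obj V')).obj.obj (op s')),
      G.obj.map f.op γ = G.obj.map f.op γ' ∧
        (y.pullback.map ((repSheaf J).map f)).hom.app _ z' =
          (y.pullback.obj ((repSheaf J).obj V)).obj.map i.op z) := by
  refine locally_exists_elem_of_eq (presheafToSheaf J (Type u) ⋙ y.pullback) (P := G.obj) γ γ' z ?_
  change (y.pullback.map (presheafSec J (P := G.obj) γ)).hom.app _ z =
    (y.pullback.map (presheafSec J (P := G.obj) γ')).hom.app _ z
  rw [presheafSec_sheaf, presheafSec_sheaf, map_comp_hom_app, map_comp_hom_app, h]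

/-- The inverse image functor of a morphism of topoi is locally flat on the site. -/
lemma GeometricMorphism.locallyFlat : LocallyFlat (repSheaf J ⋙ y.pullback) :=
  locallyFlat_yoneda_comp (presheafToSheaf J (Type u) ⋙ y.pullback)

/-- The inverse image functor of a morphism of topoi sends covering sieves to locally jointly
surjective families. -/
lemma GeometricMorphism.coversLocally {V : C} {R : Sieve V} (hR : R ∈ J V) :
    CoversLocally (repSheaf J ⋙ y.pullback) R.arrows := by
  intro s z
  refine (locally_exists_of_jointly_epi (fun (i : Σ V' : C, {f : V' ⟶ V // R f}) =>
    y.pullback.map ((repSheaf J).map i.2.1)) ?_ z).mono ?_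
  · intro Z a b h
    apply (y.adj.homEquiv _ _).injective
    apply repSheafEquiv.injective
    refine Sheaf.section_ext_of_locally _ ⟨R, hR, fun V' f hf => ?_⟩
    beta_reduce
    rw [← repSheafEquiv_map_comp, ← repSheafEquiv_map_comp, ← Adjunction.homEquiv_naturality_left,
      ← Adjunction.homEquiv_naturality_left, h ⟨V', f, hf⟩]
  · rintro s' i ⟨⟨V', f, hf⟩, z', hz'⟩
    exact ⟨V', f, hf, z', hz'⟩

end GeometricSections

/-! ### Elements of pullbacks of sheaves -/

section SheafPullback

variable {S : Type u} [SmallCategory S] {K : GrothendieckTopology S}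

lemma CategoryTheory.IsPullback.section_ext {P A B Z : Sheaf K (Type u)} {a : P ⟶ A}
    {b : P ⟶ B} {f : A ⟶ Z} {g : B ⟶ Z} (h : IsPullback a b f g) {s : Sᵒᵖ} {x y : P.obj.obj s}
    (h₁ : a.hom.app _ x = a.hom.app _ y) (h₂ : b.hom.app _ x = b.hom.app _ y) : x = y :=
  Types.ext_of_isPullback (h.map (sectionsFunctor K s.unop)) h₁ h₂

lemma CategoryTheory.IsPullback.exists_section {P A B Z : Sheaf K (Type u)} {a : P ⟶ A}
    {b : P ⟶ B} {f : A ⟶ Z} {g : B ⟶ Z} (h : IsPullback a b f g) {s : Sᵒᵖ}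
    (x : A.obj.obj s) (y : B.obj.obj s)
    (hxy : f.hom.app _ x = g.hom.app _ y) :
    ∃ z : P.obj.obj s, a.hom.app _ z = x ∧ b.hom.app _ z = y :=
  Types.exists_of_isPullback (h.map (sectionsFunctor K s.unop)) x y hxy

/-- A criterion for a square of sheaves to be a pullback square, in terms of a presheaf whose
associated sheaf is the upper left corner. -/
lemma isPullback_of_locally {Q : Sᵒᵖ ⥤ Type u} {A B Z : Sheaf K (Type u)}
    {a : (presheafToSheaf K (Type u)).obj Q ⟶ A} {b : (presheafToSheaf K (Type u)).obj Q ⟶ B}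
    {f : A ⟶ Z} {g : B ⟶ Z} (w : a ≫ f = b ≫ g)
    (hinj : ∀ (s : S) (q q' : Q.obj (op s)),
      a.hom.app _ ((toSheafify K Q).app _ q) = a.hom.app _ ((toSheafify K Q).app _ q') →
      b.hom.app _ ((toSheafify K Q).app _ q) = b.hom.app _ ((toSheafify K Q).app _ q') →
      Locally K s (fun _ i => Q.map i.op q = Q.map i.op q'))
    (hsurj : ∀ (s : S) (x : A.obj.obj (op s)) (y : B.obj.obj (op s)),
      f.hom.app _ x = g.hom.app _ y → Locally K s (fun s' i => ∃ q : Q.obj (op s'),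
        a.hom.app _ ((toSheafify K Q).app _ q) = A.obj.map i.op x ∧
          b.hom.app _ ((toSheafify K Q).app _ q) = B.obj.map i.op y)) :
    IsPullback a b f g := by
  have hP := IsPullback.of_hasPullback f g
  let φ := pullback.lift a b w
  have h₁ {s : Sᵒᵖ} (q : ((presheafToSheaf K (Type u)).obj Q).obj.obj s) :
      (pullback.fst f g).hom.app _ (φ.hom.app _ q) = a.hom.app _ q := by
    rw [← show φ ≫ pullback.fst f g = a from pullback.lift_fst _ _ _]; rfl
  have h₂ {s : Sᵒᵖ} (q : ((presheafToSheaf K (Type u)).obj Q).obj.obj s) :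
      (pullback.snd f g).hom.app _ (φ.hom.app _ q) = b.hom.app _ q := by
    rw [← show φ ≫ pullback.snd f g = b from pullback.lift_snd _ _ _]; rfl
  let ψ : Q ⟶ (pullback f g).obj := toSheafify K Q ≫ φ.hom
  have hψ₁ {s : Sᵒᵖ} (q : Q.obj s) : (pullback.fst f g).hom.app _ (ψ.app _ q) =
    a.hom.app _ ((toSheafify K Q).app _ q) := h₁ _
  have hψ₂ {s : Sᵒᵖ} (q : Q.obj s) : (pullback.snd f g).hom.app _ (ψ.app _ q) =
    b.hom.app _ ((toSheafify K Q).app _ q) := h₂ _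
  have i₁ : Presheaf.IsLocallyInjective K ψ := isLocallyInjective_of_locally ψ (fun s q q' h =>
    hinj s q q' (by rw [← hψ₁, ← hψ₁, h]) (by rw [← hψ₂, ← hψ₂, h]))
  have i₂ : Presheaf.IsLocallySurjective K ψ := isLocallySurjective_of_locally ψ (fun s x => by
    refine (hsurj s ((pullback.fst f g).hom.app _ x) ((pullback.snd f g).hom.app _ x) ?_).mono ?_
    · exact congrArg (fun k : pullback f g ⟶ Z => k.hom.app _ x) pullback.condition
    rintro s' i ⟨q, hq₁, hq₂⟩
    refine ⟨q, hP.section_ext ?_ ?_⟩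
    · rw [hψ₁, hq₁, sheafHom_app_map]
    · rw [hψ₂, hq₂, sheafHom_app_map])
  have j₁ : Sheaf.IsLocallyInjective φ :=
    (Presheaf.comp_isLocallyInjective_iff K (toSheafify K Q) φ.hom).1 i₁
  have j₂ : Sheaf.IsLocallySurjective φ :=
    (Presheaf.comp_isLocallySurjective_iff K (toSheafify K Q) φ.hom).1 i₂
  have : IsIso φ := (Sheaf.isLocallyBijective_iff_isIso φ).1 ⟨j₁, j₂⟩
  have e₁ : φ ≫ pullback.fst f g = a := pullback.lift_fst _ _ _
  have e₂ : φ ≫ pullback.snd f g = b := pullback.lift_snd _ _ _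
  exact IsPullback.of_iso hP (asIso φ).symm (Iso.refl _) (Iso.refl _) (Iso.refl _)
    (by simp [← e₁]) (by simp [← e₂]) (by simp) (by simp)

end SheafPullback

/-! ### Representable sheaves and functors between sites -/

section Sites

variable {A B : Type u} [SmallCategory A] [SmallCategory B]

/-- The section of the sheaf associated to `V` over `U` given by a morphism `U ⟶ V`. -/
def repElt (J : GrothendieckTopology A) {U V : A} (f : U ⟶ V) :
    ((repSheaf J).obj V).obj.obj (op U) :=
  ((repSheaf J).obj V).obj.map f.op (repSheafOne J V)

lemma toSheafify_app_yoneda (J : GrothendieckTopology A) {U V : A} (f : U ⟶ V) :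
    (toSheafify J (yoneda.obj V)).app (op U) f = repElt J f := by
  have h : (toSheafify J (yoneda.obj V)).app (op V) (𝟙 V) = repSheafOne J V := by
    have := presheafSec_eq_secHom (J := J) (P := yoneda.obj V) (X := V) (𝟙 V)
    have h' : presheafSec J (P := yoneda.obj V) (X := V) (𝟙 V) = 𝟙 _ := by
      have : yonedaEquiv.symm (show (yoneda.obj V).obj (op V) from 𝟙 V) = 𝟙 _ := by
        apply yonedaEquiv.injective
        rw [Equiv.apply_symm_apply]
        rfl
      rw [presheafSec, this]
      exact (presheafToSheaf J (Type u)).map_id _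
    have e := congrArg repSheafEquiv (h'.symm.trans this)
    exact (e.trans (Equiv.apply_symm_apply repSheafEquiv _)).symm
  rw [repElt, ← h]
  refine Eq.trans ?_ (NatTrans.naturality_apply (toSheafify J (yoneda.obj V)) f.op (𝟙 V))
  exact congrArg _ (Category.comp_id f).symm

lemma map_repElt (J : GrothendieckTopology A) {U U' V : A} (i : U' ⟶ U) (f : U ⟶ V) :
    ((repSheaf J).obj V).obj.map i.op (repElt J f) = repElt J (i ≫ f) :=
  (section_map_comp _ _ _ _).symm

lemma secHom_repElt {J : GrothendieckTopology A} {U V : A} (f : U ⟶ V) {G : Sheaf J (Type u)}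
    (γ : G.obj.obj (op V)) : (secHom γ).hom.app _ (repElt J f) = G.obj.map f.op γ := by
  rw [repElt, sheafHom_app_map, secHom_app_one]

lemma locally_exists_repElt {J : GrothendieckTopology A} {U V : A}
    (w : ((repSheaf J).obj V).obj.obj (op U)) :
    Locally J U (fun U' i => ∃ f : U' ⟶ V,
      repElt J f = ((repSheaf J).obj V).obj.map i.op w) := by
  refine (locally_of_isLocallySurjective (K := J) (toSheafify J (yoneda.obj V)) w).mono ?_
  rintro U' i ⟨f, hf⟩
  exact ⟨f, (toSheafify_app_yoneda J f).symm.trans hf⟩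

lemma locally_eq_of_repElt_eq {J : GrothendieckTopology A} {U V : A} {f f' : U ⟶ V}
    (h : repElt J f = repElt J f') : Locally J U (fun _ i => i ≫ f = i ≫ f') :=
  locally_of_isLocallyInjective (K := J) (toSheafify J (yoneda.obj V)) (x := f) (y := f')
    (by rw [toSheafify_app_yoneda, toSheafify_app_yoneda, h])

/-- For a subcanonical topology, sections of the sheaf associated to `V` are morphisms. -/
lemma repElt_bijective (J : GrothendieckTopology A) [J.Subcanonical] (U V : A) :
    Function.Bijective (fun f : U ⟶ V => repElt J f) := by
  have : IsIso (toSheafify J (yoneda.obj V)) :=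
    isIso_toSheafify J (GrothendieckTopology.Subcanonical.isSheaf_of_isRepresentable
      (J := J) (yoneda.obj V) |> (isSheaf_iff_isSheaf_of_type J _).2)
  have h := (bijective_iff_isIso_ofHom ((toSheafify J (yoneda.obj V)).app (op U))).2 inferInstance
  have e : (fun f : U ⟶ V => repElt J f) = fun f => (toSheafify J (yoneda.obj V)).app (op U) f :=
    funext fun f => (toSheafify_app_yoneda J f).symm
  rw [e]
  exact h

end Sites

/-! ### Inverse images of representable sheaves under a morphism of sites -/

section SiteFunctors

variable {A B : Type u} [SmallCategory A] [SmallCategory B] (F : A ⥤ B)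
  (J : GrothendieckTopology A) (K : GrothendieckTopology B) [F.IsContinuous J K]

/-- The section over `F(W)` of the inverse image of a sheaf `G` given by a section of `G` over
`W`. -/
def pullbackSec {G : Sheaf J (Type u)} {W : A} (s : G.obj.obj (op W)) :
    ((F.sheafPullback (Type u) J K).obj G).obj.obj (op (F.obj W)) :=
  ((F.sheafAdjunctionContinuous (Type u) J K).unit.app G).hom.app (op W) s

lemma map_pullbackSec {G : Sheaf J (Type u)} {W W' : A} (i : W' ⟶ W) (s : G.obj.obj (op W)) :
    ((F.sheafPullback (Type u) J K).obj G).obj.map (F.map i).op (pullbackSec F J K s) =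
      pullbackSec F J K (G.obj.map i.op s) :=
  (NatTrans.naturality_apply
    ((F.sheafAdjunctionContinuous (Type u) J K).unit.app G).hom i.op s).symm

lemma sheafPullback_map_pullbackSec {G G' : Sheaf J (Type u)} (b : G ⟶ G') {W : A}
    (s : G.obj.obj (op W)) :
    ((F.sheafPullback (Type u) J K).map b).hom.app _ (pullbackSec F J K s) =
      pullbackSec F J K (b.hom.app _ s) :=
  congrArg (fun k : G ⟶ (F.sheafPullback (Type u) J K ⋙
      F.sheafPushforwardContinuous (Type u) J K).obj G' => k.hom.app (op W) s)
    ((F.sheafAdjunctionContinuous (Type u) J K).unit.naturality b).symm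

/-- Both the sheaf associated to `F(W)` and the inverse image of the sheaf associated to `W`
represent `G ↦ G(F(W))`. -/
instance isIso_secHom_pullbackSec (W : A) :
    IsIso (secHom (pullbackSec F J K (repSheafOne J W))) := by
  apply isIso_of_coyoneda_map_bijective
  intro G
  let e₁ := (F.sheafAdjunctionContinuous (Type u) J K).homEquiv ((repSheaf J).obj W) G
  let e₂ := repSheafEquiv (J := J) (V := W)
    (G := (F.sheafPushforwardContinuous (Type u) J K).obj G)
  let e₃ := repSheafEquiv (J := K) (V := F.obj W) (G := G)
  have h : (fun x => secHom (pullbackSec F J K (repSheafOne J W)) ≫ x) =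
      (fun x => e₃.symm (e₂ (e₁ x))) := by
    funext x
    apply e₃.injective
    refine Eq.trans ?_ (Equiv.apply_symm_apply e₃ _).symm
    refine (repSheafEquiv_comp _ _).trans ?_
    refine Eq.trans ?_ (repSheafEquiv_eq (e₁ x)).symm
    refine (congrArg _ (Equiv.apply_symm_apply repSheafEquiv _)).trans ?_
    have h := (F.sheafAdjunctionContinuous (Type u) J K).homEquiv_unit (f := x)
    exact (congrArg (fun k : (repSheaf J).obj W ⟶
      (F.sheafPushforwardContinuous (Type u) J K).obj G => k.hom.app (op W) (repSheafOne J W))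
      h).symm
  rw [h]
  exact (e₁.trans (e₂.trans e₃.symm)).bijective

/-- The inverse image under a morphism of sites of the sheaf associated to `W` is the sheaf
associated to `F(W)`. -/
def repSheafSheafPullbackIso :
    F ⋙ repSheaf K ≅ repSheaf J ⋙ F.sheafPullback (Type u) J K :=
  NatIso.ofComponents (fun W => asIso (secHom (pullbackSec F J K (repSheafOne J W)))) (by
    intro W W' i
    refine (map_secHom _ _).trans ?_
    refine Eq.trans ?_ (secHom_comp _ _).symm
    refine congrArg secHom ?_
    refine (map_pullbackSec F J K _ _).trans ?_
    refine Eq.trans ?_ (sheafPullback_map_pullbackSec F J K _ _).symm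
    rw [repSheaf_map_app_one])

/-- The sheaf associated to an object is the represented presheaf if the topology is
subcanonical. -/
def yonedaRepSheafIso [K.Subcanonical] : K.yoneda ≅ repSheaf K :=
  (Functor.rightUnitor _).symm ≪≫ Functor.isoWhiskerLeft K.yoneda (sheafificationNatIso K (Type u))

/-- A functor that induces a morphism of sites to a subcanonical site preserves finite limits. -/
lemma preservesFiniteLimits_of_inducesMorphismOfSites [HasFiniteLimits A] [K.Subcanonical]
    (hF : PreservesFiniteLimits (F.sheafPullback (Type u) J K)) : PreservesFiniteLimits F where
  preservesFiniteLimits I _ _ := by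
    have : PreservesFiniteLimits (F ⋙ repSheaf K) :=
      have := comp_preservesFiniteLimits (repSheaf J) (F.sheafPullback (Type u) J K)
      preservesFiniteLimits_of_natIso (repSheafSheafPullbackIso F J K).symm
    have : PreservesFiniteLimits (F ⋙ K.yoneda) :=
      preservesFiniteLimits_of_natIso (Functor.isoWhiskerLeft F (yonedaRepSheafIso K).symm)
    exact preservesLimitsOfShape_of_reflects_of_preserves F K.yoneda

end SiteFunctors

/-! ### Elements of inverse images under a cocontinuous functor -/

section CocontinuousElements

variable {A B : Type u} [SmallCategory A] [SmallCategory B] (F : A ⥤ B)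
  (J : GrothendieckTopology A) (K : GrothendieckTopology B) [F.IsCocontinuous J K]

/-- The section over `X` of the inverse image of `G` given by a section of `G` over `F(X)`. -/
def cocontinuousElt {G : Sheaf K (Type u)} {X : A} (γ : G.obj.obj (op (F.obj X))) :
    ((cocontinuousGeometricMorphism F J K).pullback.obj G).obj.obj (op X) :=
  (toSheafify J (F.op ⋙ G.obj)).app (op X) γ

lemma cocontinuousSec_eq {G : Sheaf K (Type u)} {X : A} (γ : G.obj.obj (op (F.obj X))) :
    cocontinuousSec F J K γ = secHom (cocontinuousElt F J K γ) :=
  presheafSec_eq_secHom _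

lemma map_cocontinuousElt {G : Sheaf K (Type u)} {X X' : A} (i : X' ⟶ X)
    (γ : G.obj.obj (op (F.obj X))) :
    ((cocontinuousGeometricMorphism F J K).pullback.obj G).obj.map i.op
      (cocontinuousElt F J K γ) = cocontinuousElt F J K (G.obj.map (F.map i).op γ) :=
  (NatTrans.naturality_apply (toSheafify J (F.op ⋙ G.obj)) i.op γ).symm

lemma pullback_map_cocontinuousElt {G G' : Sheaf K (Type u)} (b : G ⟶ G') {X : A}
    (γ : G.obj.obj (op (F.obj X))) :
    ((cocontinuousGeometricMorphism F J K).pullback.map b).hom.app _ (cocontinuousElt F J K γ) =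
      cocontinuousElt F J K (b.hom.app _ γ) := by
  have h := cocontinuousSec_comp F J K γ b
  rw [cocontinuousSec_eq, cocontinuousSec_eq, secHom_comp] at h
  exact repSheafEquiv.symm.injective h

lemma Locally.of_cocontinuous {X : A} {p : ∀ ⦃Y : B⦄, (Y ⟶ F.obj X) → Prop}
    (h : Locally K (F.obj X) p) : Locally J X (fun _ i => p (F.map i)) := by
  obtain ⟨R, hR, hp⟩ := h
  exact ⟨R.functorPullback F, F.cover_lift J K hR, fun _ i hi => hp _ hi⟩

lemma locally_eq_of_cocontinuousElt_eq {G : Sheaf K (Type u)} {X : A}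
    {γ γ' : G.obj.obj (op (F.obj X))}
    (h : cocontinuousElt F J K γ = cocontinuousElt F J K γ') :
    Locally J X (fun _ i => G.obj.map (F.map i).op γ = G.obj.map (F.map i).op γ') :=
  locally_of_isLocallyInjective (K := J) (toSheafify J (F.op ⋙ G.obj)) h

lemma locally_exists_cocontinuousElt {G : Sheaf K (Type u)} {X : A}
    (w : ((cocontinuousGeometricMorphism F J K).pullback.obj G).obj.obj (op X)) :
    Locally J X (fun X' i => ∃ γ : G.obj.obj (op (F.obj X')), cocontinuousElt F J K γ =
      ((cocontinuousGeometricMorphism F J K).pullback.obj G).obj.map i.op w) :=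
  locally_of_isLocallySurjective (K := J) (toSheafify J (F.op ⋙ G.obj)) w

lemma cocontinuousOne_repElt {X X' : A} (i : X' ⟶ X) :
    (cocontinuousOne F J K X).hom.app _ (repElt J i) =
      cocontinuousElt F J K (repElt K (F.map i)) := by
  rw [cocontinuousOne, cocontinuousSec_eq, secHom_repElt, map_cocontinuousElt]
  rfl

lemma locally_eq_of_cocontinuousElt_repElt_eq {X : A} {V : B} {f f' : F.obj X ⟶ V}
    (h : cocontinuousElt F J K (repElt K f) = cocontinuousElt F J K (repElt K f')) :
    Locally J X (fun _ i => F.map i ≫ f = F.map i ≫ f') := by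
  refine (locally_eq_of_cocontinuousElt_eq F J K h).bind ?_
  intro X' i hi
  rw [map_repElt, map_repElt] at hi
  refine ((locally_eq_of_repElt_eq hi).of_cocontinuous F J K).mono ?_
  intro X'' j hj
  simpa using hj

lemma locally_exists_cocontinuousElt_repElt {X : A} {V : B}
    (w : ((cocontinuousGeometricMorphism F J K).pullback.obj ((repSheaf K).obj V)).obj.obj
      (op X)) :
    Locally J X (fun X' i => ∃ f : F.obj X' ⟶ V, cocontinuousElt F J K (repElt K f) =
      ((cocontinuousGeometricMorphism F J K).pullback.obj
        ((repSheaf K).obj V)).obj.map i.op w) := by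
  refine (locally_exists_cocontinuousElt F J K w).bind ?_
  rintro X' i ⟨γ, hγ⟩
  refine ((locally_exists_repElt γ).of_cocontinuous F J K).mono ?_
  rintro X'' j ⟨f, hf⟩
  exact ⟨f, by rw [hf, ← map_cocontinuousElt, hγ, ← section_map_comp]⟩

end CocontinuousElements

/-! ### Sections of inverse images of representable sheaves as morphisms -/

section LegPresentation

variable {C E D : Type u} [SmallCategory C] [SmallCategory E] [SmallCategory D]

/-- For a morphism of topoi `q : C~ → D~`, a description, local on `C`, of the sections over `U` of
the inverse image of the sheaf associated to `W` as the morphisms `f(U) → g(W)`, for functors `f`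
and `g` from `C` and `D` to a third category. -/
structure LegPresentation (f : C ⥤ E) (g : D ⥤ E) {J : GrothendieckTopology C}
    {JD : GrothendieckTopology D}
    (q : GeometricMorphism (Sheaf J (Type u)) (Sheaf JD (Type u))) where
  sec {U : C} {W : D} (l : f.obj U ⟶ g.obj W) :
    (q.pullback.obj ((repSheaf JD).obj W)).obj.obj (op U)
  map_sec {U U' : C} {W : D} (i : U' ⟶ U) (l : f.obj U ⟶ g.obj W) :
    (q.pullback.obj ((repSheaf JD).obj W)).obj.map i.op (sec l) = sec (f.map i ≫ l)
  sec_comp {U : C} {W W' : D} (l : f.obj U ⟶ g.obj W) (ω : W ⟶ W') :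
    (q.pullback.map ((repSheaf JD).map ω)).hom.app _ (sec l) = sec (l ≫ g.map ω)
  locally_eq {U : C} {W : D} {l l' : f.obj U ⟶ g.obj W} (h : sec l = sec l') :
    Locally J U (fun _ i => f.map i ≫ l = f.map i ≫ l')
  locally_exists {U : C} {W : D} (z : (q.pullback.obj ((repSheaf JD).obj W)).obj.obj (op U)) :
    Locally J U (fun U' i => ∃ l : f.obj U' ⟶ g.obj W,
      sec l = (q.pullback.obj ((repSheaf JD).obj W)).obj.map i.op z)

/-- For a morphism of sites given by `F`, sections of the inverse image of `W` are locally
morphisms to `F(W)`. -/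
def sitePresentation (F : D ⥤ C) (JD : GrothendieckTopology D) (J : GrothendieckTopology C)
    [InducesMorphismOfSites F JD J] :
    LegPresentation (𝟭 C) F (siteGeometricMorphism F JD J) where
  sec {U W} l := ((F.sheafPullback (Type u) JD J).obj ((repSheaf JD).obj W)).obj.map
    (Quiver.Hom.op (show U ⟶ F.obj W from l)) (pullbackSec F JD J (repSheafOne JD W))
  map_sec i l := (section_map_comp _ _ _ _).symm
  sec_comp {U W W'} l ω := by
    refine (sheafHom_app_map _ _ _).trans ?_
    refine Eq.trans ?_ (section_map_comp _ _ _ _).symm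
    refine congrArg _ ?_
    refine (sheafPullback_map_pullbackSec F JD J _ _).trans ?_
    refine Eq.trans ?_ (map_pullbackSec F JD J _ _).symm
    rw [repSheaf_map_app_one]
  locally_eq {U W l l'} h := by
    let k := secHom (pullbackSec F JD J (repSheafOne JD W))
    have hk (l : U ⟶ F.obj W) : k.hom.app _ (repElt J l) =
        ((F.sheafPullback (Type u) JD J).obj ((repSheaf JD).obj W)).obj.map l.op
          (pullbackSec F JD J (repSheafOne JD W)) := secHom_repElt _ _
    have hk' : k.hom.app _ (repElt J (show U ⟶ F.obj W from l)) =
        k.hom.app _ (repElt J (show U ⟶ F.obj W from l')) := by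
      rw [hk, hk]; exact h
    have h₂ : k ≫ inv k = 𝟙 _ := IsIso.hom_inv_id k
    have h₃ (z) : (inv k).hom.app (op U) (k.hom.app (op U) z) = z :=
      congrArg (fun m : (repSheaf J).obj (F.obj W) ⟶ _ => m.hom.app (op U) z) h₂
    exact locally_eq_of_repElt_eq ((h₃ _).symm.trans ((congrArg _ hk').trans (h₃ _)))
  locally_exists {U W} z := by
    let k := secHom (pullbackSec F JD J (repSheafOne JD W))
    have h₂ : inv k ≫ k = 𝟙 _ := IsIso.inv_hom_id k
    have h₃ (z) : k.hom.app (op U) ((inv k).hom.app (op U) z) = z :=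
      congrArg (fun m : (F.sheafPullback (Type u) JD J).obj ((repSheaf JD).obj W) ⟶ _ =>
        m.hom.app (op U) z) h₂
    refine (locally_exists_repElt ((inv k).hom.app (op U) z)).mono ?_
    rintro U' i ⟨l, hl⟩
    refine ⟨l, (secHom_repElt _ _).symm.trans ((congrArg _ hl).trans ?_)⟩
    exact (sheafHom_app_map _ _ _).trans (congrArg _ (h₃ z))

end LegPresentation

section LeftLeg

variable {C₁ E E' D : Type u} [SmallCategory C₁] [SmallCategory E]
  [SmallCategory E'] [SmallCategory D]
  (J₁ : GrothendieckTopology C₁)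
  (JE : GrothendieckTopology E) (JE' : GrothendieckTopology E') (JD : GrothendieckTopology D)
  (g₁ : C₁ ⥤ E') (a : E' ⥤ E) (g : D ⥤ E)
  [g₁.IsContinuous J₁ JE'] [g₁.IsCocontinuous J₁ JE']
  [InducesMorphismOfSites a JE' JE]
  [(a.sheafPushforwardContinuous (Type u) JE' JE).IsEquivalence]
  [InducesMorphismOfSites g JD JE]

lemma map_leftLegSection (F : Sheaf JD (Type u)) {U U' : C₁} (i : U' ⟶ U)
    (x : ((g.sheafPullback (Type u) JD JE).obj F).obj.obj (op ((g₁ ⋙ a).obj U))) :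
    ((leftLeg J₁ JE JE' JD g₁ a g).pullback.obj F).obj.map i.op
      (leftLegSection J₁ JE JE' g₁ a g F U x) = leftLegSection J₁ JE JE' g₁ a g F U'
        (((g.sheafPullback (Type u) JD JE).obj F).obj.map ((g₁ ⋙ a).map i).op x) := rfl

lemma leftLeg_map_leftLegSection {F F' : Sheaf JD (Type u)} (b : F ⟶ F') {U : C₁}
    (x : ((g.sheafPullback (Type u) JD JE).obj F).obj.obj (op ((g₁ ⋙ a).obj U))) :
    ((leftLeg J₁ JE JE' JD g₁ a g).pullback.map b).hom.app (op U)
      (leftLegSection J₁ JE JE' g₁ a g F U x) = leftLegSection J₁ JE JE' g₁ a g F' U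
        (((g.sheafPullback (Type u) JD JE).map b).hom.app _ x) := rfl

/-- As `E` is subcanonical and `a^s` does not change sections, sections over `U` of the inverse
image of `W` under `C₁~ → E'~ ≃ E~ → D~` are exactly the morphisms from `a(g₁(U))` to `g(W)`. -/
lemma leftLeg_bijective [JE.Subcanonical] (U : C₁) (W : D) :
    Function.Bijective (fun l : (g₁ ⋙ a).obj U ⟶ g.obj W =>
      leftLegSection J₁ JE JE' g₁ a g ((repSheaf JD).obj W) U
        (((g.sheafPullback (Type u) JD JE).obj ((repSheaf JD).obj W)).obj.map l.op
          (pullbackSec g JD JE (repSheafOne JD W)))) := by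
  let k := secHom (pullbackSec g JD JE (repSheafOne JD W))
  have hk : Function.Bijective (k.hom.app (op ((g₁ ⋙ a).obj U))) := by
    have : IsIso k := isIso_secHom_pullbackSec g JD JE W
    exact (isIso_iff_bijective (k.hom.app (op ((g₁ ⋙ a).obj U)))).1
      (inferInstanceAs (IsIso ((sectionsFunctor JE _).map k)))
  -- `leftLegSection` is the identity, so the map is the composite of two bijections.
  have h := hk.comp (repElt_bijective JE ((g₁ ⋙ a).obj U) (g.obj W))
  refine (congrArg Function.Bijective (funext fun l => ?_)).mp h
  exact secHom_repElt _ _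

/-- Sections of the inverse image of `W` under the morphism of topoi `C₁~ → E'~ ≃ E~ → D~` are
morphisms to `g(W)` in `E`. -/
def leftPresentation [JE.Subcanonical] :
    LegPresentation (g₁ ⋙ a) g (leftLeg J₁ JE JE' JD g₁ a g) where
  sec {U W} l := leftLegSection J₁ JE JE' g₁ a g ((repSheaf JD).obj W) U
    (((g.sheafPullback (Type u) JD JE).obj ((repSheaf JD).obj W)).obj.map l.op
      (pullbackSec g JD JE (repSheafOne JD W)))
  map_sec i l := by
    rw [map_leftLegSection, ← section_map_comp]
  sec_comp {U W W'} l ω := by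
    rw [leftLeg_map_leftLegSection, sheafHom_app_map, sheafPullback_map_pullbackSec,
      repSheaf_map_app_one, ← map_pullbackSec, ← section_map_comp]
  locally_eq h := Locally.of_forall fun _ i =>
    congrArg _ ((leftLeg_bijective J₁ JE JE' JD g₁ a g _ _).1 h)
  locally_exists z := Locally.of_forall fun _ _ =>
    (leftLeg_bijective J₁ JE JE' JD g₁ a g _ _).2 _

end LeftLeg

lemma presheafToSheaf_map_toSheafify {S : Type u} [SmallCategory S] (K : GrothendieckTopology S)
    {P Q : Sᵒᵖ ⥤ Type u} (φ : P ⟶ Q) {s : Sᵒᵖ} (x : P.obj s) :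
    ((presheafToSheaf K (Type u)).map φ).hom.app s ((toSheafify K P).app s x) =
      (toSheafify K Q).app s (φ.app s x) :=
  ConcreteCategory.congr_hom
    (congrArg (fun k => NatTrans.app k s) (toSheafify_naturality (J := K) φ).symm) x

/-! ### The topology on 5-tuples -/

namespace FiveTuple

variable {C₁ C₂ E D : Type u} [SmallCategory C₁] [SmallCategory C₂] [SmallCategory E]
  [SmallCategory D] {f₁ : C₁ ⥤ E} {g : D ⥤ E} {f₂ : D ⥤ C₂}
  (J₁ : GrothendieckTopology C₁) (J₂ : GrothendieckTopology C₂)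

lemma left_comp_map {X Y : FiveTuple f₁ g f₂} (i : Y ⟶ X) {W : D} (w : X.W ⟶ W) :
    Y.left ≫ g.map (i.onW ≫ w) = f₁.map i.onU ≫ X.left ≫ g.map w := by
  rw [g.map_comp, ← Category.assoc, i.comm_left, Category.assoc]

lemma right_comp_map {X Y : FiveTuple f₁ g f₂} (i : Y ⟶ X) {W : D} (w : X.W ⟶ W) :
    Y.right ≫ f₂.map (i.onW ≫ w) = i.onV ≫ X.right ≫ f₂.map w := by
  rw [f₂.map_comp, ← Category.assoc, i.comm_right, Category.assoc]

/-- A lifting of `f₁(U) → g(W)` along some `W' → W` exists locally on `(U → W ← V)` if it exists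
for the given component `f₁(U) → g(W)`: this is what the coverings by base change provide. -/
lemma locally_exists_lift [HasPullbacks C₂] (X : FiveTuple f₁ g f₂) {W : D} (ω : W ⟶ X.W)
    (l : f₁.obj X.U ⟶ g.obj W) (hl : l ≫ g.map ω = X.left) :
    Locally (topology f₁ g f₂ J₁ J₂) X (fun Y i => ∃ w : Y.W ⟶ W,
      w ≫ ω = i.onW ∧ Y.left ≫ g.map w = f₁.map i.onU ≫ l) := by
  refine ⟨_, Precoverage.generate_mem_toGrothendieck (IsGeneratingCover.baseChange l
    (pullback.fst (f₂.map ω) X.right) X.left X.right (pullback.snd _ _) ω hl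
    (IsPullback.of_hasPullback _ _)), ?_⟩
  rintro Y _ ⟨Z, h, _, ⟨⟩, rfl⟩
  refine ⟨h.onW, rfl, ?_⟩
  rw [h.comm_left]
  exact congrArg (· ≫ l) (congrArg f₁.map (Category.comp_id h.onU).symm)

variable [HasFiniteLimits C₂] [HasFiniteLimits D] [PreservesFiniteLimits g]

/-- Two morphisms `X.W ⟶ W` that agree after composition with `X.left` agree locally: base change
along their equalizer. -/
lemma locally_onW_comp_eq (X : FiveTuple f₁ g f₂) {W : D} {w w' : X.W ⟶ W}
    (h : X.left ≫ g.map w = X.left ≫ g.map w') :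
    Locally (topology f₁ g f₂ J₁ J₂) X (fun _ i => i.onW ≫ w = i.onW ≫ w') := by
  obtain ⟨l, hl⟩ := Fork.IsLimit.lift' (isLimitOfHasEqualizerOfPreservesLimit g w w') X.left h
  refine (locally_exists_lift J₁ J₂ X (equalizer.ι w w') l hl).mono ?_
  rintro Y i ⟨v, hv, -⟩
  rw [← hv, Category.assoc, Category.assoc, equalizer.condition]

/-- Every morphism `f₁(X.U) → g(W)` locally factors through a morphism `X.W ⟶ W`: base change along
the projection `X.W ⨯ W ⟶ X.W`. -/
lemma locally_exists_left_comp_eq (X : FiveTuple f₁ g f₂) {W : D} (l : f₁.obj X.U ⟶ g.obj W) :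
    Locally (topology f₁ g f₂ J₁ J₂) X
      (fun Y i => ∃ w : Y.W ⟶ W, Y.left ≫ g.map w = f₁.map i.onU ≫ l) := by
  obtain ⟨m, hm₁, hm₂⟩ := BinaryFan.IsLimit.lift'
    (isLimitOfHasBinaryProductOfPreservesLimit g X.W W) X.left l
  refine (locally_exists_lift J₁ J₂ X prod.fst m hm₁).mono ?_
  rintro Y i ⟨v, -, hv⟩
  refine ⟨v ≫ prod.snd, ?_⟩
  rw [g.map_comp, reassoc_of% hv]
  exact congrArg _ hm₂

/-- The projection `(U → W ← V) ↦ W`. -/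
def projW (f₁ : C₁ ⥤ E) (g : D ⥤ E) (f₂ : D ⥤ C₂) : FiveTuple f₁ g f₂ ⥤ D where
  obj X := X.W
  map α := α.onW

end FiveTuple

/-! ### The canonical 2-morphism -/

section Cell

open FiveTuple

variable {C₁ C₂ E D : Type u} [SmallCategory C₁] [SmallCategory C₂] [SmallCategory E]
  [SmallCategory D] {f₁ : C₁ ⥤ E} {g : D ⥤ E} {f₂ : D ⥤ C₂}
  {J₁ : GrothendieckTopology C₁} {J₂ : GrothendieckTopology C₂} {JD : GrothendieckTopology D}
  {q₁ : GeometricMorphism (Sheaf J₁ (Type u)) (Sheaf JD (Type u))}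
  {q₂ : GeometricMorphism (Sheaf J₂ (Type u)) (Sheaf JD (Type u))}
  (L₁ : LegPresentation f₁ g q₁) (L₂ : LegPresentation (𝟭 C₂) f₂ q₂)

/-- The section of `q₂^* W` over `V` given by a morphism `V → f₂(W)`. -/
abbrev LegPresentation.rightSec {V : C₂} {W : D} (r : V ⟶ f₂.obj W) :
    (q₂.pullback.obj ((repSheaf JD).obj W)).obj.obj (op V) :=
  L₂.sec (U := V) r

lemma LegPresentation.map_rightSec {V V' : C₂} {W : D} (i : V' ⟶ V) (r : V ⟶ f₂.obj W) :
    (q₂.pullback.obj ((repSheaf JD).obj W)).obj.map i.op (L₂.rightSec r) = L₂.rightSec (i ≫ r) :=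
  L₂.map_sec i r

/-- The presheaf map sending `w : X.W ⟶ W` to the section over `X.U` of the inverse image of `W`
given by `f₁(X.U) → g(X.W) → g(W)`. -/
def leftPresheafMap (f₂ : D ⥤ C₂) (W : D) :
    (projW f₁ g f₂).op ⋙ yoneda.obj W ⟶
      (projU f₁ g f₂).op ⋙ (q₁.pullback.obj ((repSheaf JD).obj W)).obj where
  app X := TypeCat.ofHom (fun w => L₁.sec (X.unop.left ≫ g.map (show X.unop.W ⟶ W from w)))
  naturality X Y i := by
    ext w
    refine Eq.trans ?_ (L₁.map_sec i.unop.onU _).symm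
    exact congrArg L₁.sec (left_comp_map i.unop w)

/-- The presheaf map sending `w : X.W ⟶ W` to the section over `X.V` of the inverse image of `W`
given by `X.V → f₂(X.W) → f₂(W)`. -/
def rightPresheafMap (f₁ : C₁ ⥤ E) (g : D ⥤ E) (W : D) :
    (projW f₁ g f₂).op ⋙ yoneda.obj W ⟶
      (projV f₁ g f₂).op ⋙ (q₂.pullback.obj ((repSheaf JD).obj W)).obj where
  app X := TypeCat.ofHom (fun w =>
    L₂.rightSec (X.unop.right ≫ f₂.map (show X.unop.W ⟶ W from w)))
  naturality X Y i := by
    ext w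
    refine Eq.trans ?_ (L₂.map_rightSec i.unop.onV _).symm
    exact congrArg L₂.rightSec (right_comp_map i.unop w)

/-- The morphism of sheaves associated to `leftPresheafMap`. -/
def leftSheafMap (f₂ : D ⥤ C₂) (J₂ : GrothendieckTopology C₂) (W : D) :
    (presheafToSheaf (topology f₁ g f₂ J₁ J₂) (Type u)).obj
        ((projW f₁ g f₂).op ⋙ yoneda.obj W) ⟶
      (toposFst f₁ g f₂ J₁ J₂).pullback.obj (q₁.pullback.obj ((repSheaf JD).obj W)) :=
  (presheafToSheaf (topology f₁ g f₂ J₁ J₂) (Type u)).map (leftPresheafMap L₁ f₂ W)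

/-- The morphism of sheaves associated to `rightPresheafMap`. -/
def rightSheafMap (f₁ : C₁ ⥤ E) (g : D ⥤ E) (J₁ : GrothendieckTopology C₁) (W : D) :
    (presheafToSheaf (topology f₁ g f₂ J₁ J₂) (Type u)).obj
        ((projW f₁ g f₂).op ⋙ yoneda.obj W) ⟶
      (toposSnd f₁ g f₂ J₁ J₂).pullback.obj (q₂.pullback.obj ((repSheaf JD).obj W)) :=
  (presheafToSheaf (topology f₁ g f₂ J₁ J₂) (Type u)).map (rightPresheafMap L₂ f₁ g W)

/-- On `C~`, the inverse image of `W` under `C~ → C₁~ → D~` is the sheaf associated to the presheaf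
of morphisms from `X.W` to `W`. -/
lemma isIso_leftSheafMap [HasFiniteLimits C₂] [HasFiniteLimits D] [PreservesFiniteLimits g]
    (W : D) : IsIso (leftSheafMap L₁ f₂ J₂ W) := by
  have : Presheaf.IsLocallyInjective (topology f₁ g f₂ J₁ J₂) (leftPresheafMap L₁ f₂ W) := by
    refine isLocallyInjective_of_locally _ (fun X w w' h => ?_)
    refine ((L₁.locally_eq h).of_cocontinuous (projU f₁ g f₂) _ J₁).bind ?_
    intro Y i hi
    refine (locally_onW_comp_eq J₁ J₂ Y (w := i.onW ≫ w) (w' := i.onW ≫ w') ?_).mono ?_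
    · exact (left_comp_map i w).trans (hi.trans (left_comp_map i w').symm)
    · intro Z j hj
      exact (Category.assoc _ _ _).trans (hj.trans (Category.assoc _ _ _).symm)
  have : Presheaf.IsLocallySurjective (topology f₁ g f₂ J₁ J₂) (leftPresheafMap L₁ f₂ W) := by
    refine isLocallySurjective_of_locally _ (fun X z => ?_)
    refine ((L₁.locally_exists (U := X.U) z).of_cocontinuous (projU f₁ g f₂) _ J₁).bind ?_
    rintro Y i ⟨l, hl⟩
    refine (locally_exists_left_comp_eq J₁ J₂ Y l).mono ?_
    rintro Z j ⟨w, hw⟩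
    refine ⟨w, (congrArg L₁.sec hw).trans ?_⟩
    refine (L₁.map_sec _ _).symm.trans ?_
    refine (congrArg _ hl).trans ?_
    exact (section_map_comp _ _ _ _).symm
  exact isIso_presheafToSheaf_map _

/-- The 2-morphism `τ` turns the section given by `X.U → X.W → W` into the one given by
`X.V → X.W → W`. -/
def CellIsCanonical (τ : (toposSnd f₁ g f₂ J₁ J₂).comp q₂ ⟶ (toposFst f₁ g f₂ J₁ J₂).comp q₁) :
    Prop :=
  ∀ (X : FiveTuple f₁ g f₂) (W : D) (w : X.W ⟶ W),
    (τ.app.app ((repSheaf JD).obj W)).hom.app (op X)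
      (cocontinuousElt (projU f₁ g f₂) (topology f₁ g f₂ J₁ J₂) J₁ (L₁.sec (X.left ≫ g.map w))) =
    cocontinuousElt (projV f₁ g f₂) (topology f₁ g f₂ J₁ J₂) J₂ (L₂.rightSec (X.right ≫ f₂.map w))

/-- There is a 2-morphism that is canonical on representable sheaves. The inverse image of `W` from
the left is the sheaf associated to `X ↦ Hom(X.W, W)`, which also maps to the one from the right. -/
lemma exists_cellIsCanonical [HasFiniteLimits C₂] [HasFiniteLimits D] [PreservesFiniteLimits g] :
    ∃ τ : (toposSnd f₁ g f₂ J₁ J₂).comp q₂ ⟶ (toposFst f₁ g f₂ J₁ J₂).comp q₁,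
      CellIsCanonical L₁ L₂ τ := by
  let S (W : D) := (presheafToSheaf (topology f₁ g f₂ J₁ J₂) (Type u)).obj
    ((projW f₁ g f₂).op ⋙ yoneda.obj W)
  let lm (W : D) := leftSheafMap L₁ f₂ J₂ W
  let rm (W : D) := rightSheafMap L₂ f₁ g J₁ W
  let ym {W W' : D} (ω : W ⟶ W') : S W ⟶ S W' :=
    (presheafToSheaf (topology f₁ g f₂ J₁ J₂) (Type u)).map
      (Functor.whiskerLeft (projW f₁ g f₂).op (yoneda.map ω))
  have hl {W W' : D} (ω : W ⟶ W') :
      lm W ≫ (toposFst f₁ g f₂ J₁ J₂).pullback.map (q₁.pullback.map ((repSheaf JD).map ω)) =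
      ym ω ≫ lm W' := by
    refine ((presheafToSheaf (topology f₁ g f₂ J₁ J₂) (Type u)).map_comp _ _).symm.trans
      (Eq.trans (congrArg _ ?_) ((presheafToSheaf _ (Type u)).map_comp _ _))
    ext X w
    refine (L₁.sec_comp _ _).trans (congrArg L₁.sec ?_)
    exact (Category.assoc _ _ _).trans (congrArg _ (g.map_comp _ _).symm)
  have hr {W W' : D} (ω : W ⟶ W') :
      rm W ≫ (toposSnd f₁ g f₂ J₁ J₂).pullback.map (q₂.pullback.map ((repSheaf JD).map ω)) =
      ym ω ≫ rm W' := by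
    refine ((presheafToSheaf (topology f₁ g f₂ J₁ J₂) (Type u)).map_comp _ _).symm.trans
      (Eq.trans (congrArg _ ?_) ((presheafToSheaf _ (Type u)).map_comp _ _))
    ext X w
    refine (L₂.sec_comp _ _).trans (congrArg L₂.rightSec ?_)
    exact (Category.assoc _ _ _).trans (congrArg _ (f₂.map_comp _ _).symm)
  have hlm (W : D) : IsIso (lm W) := isIso_leftSheafMap L₁ W
  let il (W : D) := inv (lm W)
  have il₁ (W : D) : il W ≫ lm W = 𝟙 _ := IsIso.inv_hom_id (lm W)
  have il₂ (W : D) : lm W ≫ il W = 𝟙 _ := IsIso.hom_inv_id (lm W)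
  have il₃ (W : D) : lm W ≫ il W ≫ rm W = rm W := by rw [reassoc_of% (il₂ W)]
  obtain ⟨α, hα⟩ := ((toposFst f₁ g f₂ J₁ J₂).comp q₁).exists_natTrans
    (q₂.pullback ⋙ (toposSnd f₁ g f₂ J₁ J₂).pullback)
    { app := fun W => il W ≫ rm W
      naturality := fun W W' ω => by
        have h₁ : il W ≫ ym ω ≫ lm W' =
            (toposFst f₁ g f₂ J₁ J₂).pullback.map (q₁.pullback.map ((repSheaf JD).map ω)) := by
          rw [← hl, reassoc_of% (il₁ W)]
        refine (congrArg (· ≫ il W' ≫ rm W') h₁.symm).trans ?_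
        refine Eq.trans ?_ (Category.assoc _ _ _).symm
        refine Eq.trans ?_ (congrArg (il W ≫ ·) (hr ω).symm)
        refine (Category.assoc _ _ _).trans (congrArg (il W ≫ ·) ?_)
        refine (Category.assoc _ _ _).trans (congrArg (ym ω ≫ ·) ?_)
        rw [reassoc_of% (il₂ W')] }
  refine ⟨⟨α⟩, fun X W w => ?_⟩
  have h : lm W ≫ α.app ((repSheaf JD).obj W) = rm W :=
    (congrArg (lm W ≫ ·) (hα W)).trans (il₃ W)
  have e₁ := presheafToSheaf_map_toSheafify (topology f₁ g f₂ J₁ J₂)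
    (leftPresheafMap L₁ f₂ W) (s := op X) w
  have e₂ := presheafToSheaf_map_toSheafify (topology f₁ g f₂ J₁ J₂)
    (rightPresheafMap L₂ f₁ g W) (s := op X) w
  refine (congrArg _ e₁.symm).trans (Eq.trans ?_ e₂)
  exact congrArg (fun k : (presheafToSheaf (topology f₁ g f₂ J₁ J₂) (Type u)).obj
    ((projW f₁ g f₂).op ⋙ yoneda.obj W) ⟶ _ => k.hom.app (op X)
      ((toSheafify (topology f₁ g f₂ J₁ J₂)
        ((projW f₁ g f₂).op ⋙ yoneda.obj W)).app (op X) w)) h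

variable {L₁ L₂}

lemma LegPresentation.locally_eq_of_cocontinuousElt_rightSec_eq {X : FiveTuple f₁ g f₂} {W : D}
    {r r' : X.V ⟶ f₂.obj W}
    (h : cocontinuousElt (projV f₁ g f₂) (topology f₁ g f₂ J₁ J₂) J₂ (L₂.rightSec r) =
      cocontinuousElt (projV f₁ g f₂) (topology f₁ g f₂ J₁ J₂) J₂ (L₂.rightSec r')) :
    Locally (topology f₁ g f₂ J₁ J₂) X (fun _ i => i.onV ≫ r = i.onV ≫ r') := by
  refine (locally_eq_of_cocontinuousElt_eq _ _ J₂ h).bind ?_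
  intro Y i hi
  have hi' : L₂.rightSec (i.onV ≫ r) = L₂.rightSec (i.onV ≫ r') :=
    (L₂.map_rightSec _ _).symm.trans (hi.trans (L₂.map_rightSec _ _))
  refine ((L₂.locally_eq hi').of_cocontinuous (projV f₁ g f₂) _ J₂).mono ?_
  intro Z j hj
  exact (Category.assoc _ _ _).trans (Eq.trans hj (Category.assoc _ _ _).symm)

lemma CellIsCanonical.app_cocontinuousElt
    {τ : (toposSnd f₁ g f₂ J₁ J₂).comp q₂ ⟶ (toposFst f₁ g f₂ J₁ J₂).comp q₁}
    (hτ : CellIsCanonical L₁ L₂ τ) (X : FiveTuple f₁ g f₂) :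
    (τ.app.app ((repSheaf JD).obj X.W)).hom.app (op X)
      (cocontinuousElt (projU f₁ g f₂) (topology f₁ g f₂ J₁ J₂) J₁ (L₁.sec X.left)) =
    cocontinuousElt (projV f₁ g f₂) (topology f₁ g f₂ J₁ J₂) J₂ (L₂.rightSec X.right) := by
  have h := hτ X X.W (𝟙 _)
  have e₁ : X.left ≫ g.map (𝟙 X.W) = X.left := by rw [g.map_id, Category.comp_id]
  have e₂ : X.right ≫ f₂.map (𝟙 X.W) = X.right := by rw [f₂.map_id, Category.comp_id]
  exact (congrArg _ (congrArg _ (congrArg L₁.sec e₁.symm))).trans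
    (h.trans (congrArg _ (congrArg L₂.rightSec e₂)))

lemma CellIsCanonical.left_comp_eq
    {τ : (toposSnd f₁ g f₂ J₁ J₂).comp q₂ ⟶ (toposFst f₁ g f₂ J₁ J₂).comp q₁}
    (hτ : CellIsCanonical L₁ L₂ τ) (X : FiveTuple f₁ g f₂) :
    cocontinuousOne (projU f₁ g f₂) (topology f₁ g f₂ J₁ J₂) J₁ X ≫
        (toposFst f₁ g f₂ J₁ J₂).pullback.map (secHom (L₁.sec X.left)) ≫
          τ.app.app ((repSheaf JD).obj X.W) =
      cocontinuousOne (projV f₁ g f₂) (topology f₁ g f₂ J₁ J₂) J₂ X ≫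
        (toposSnd f₁ g f₂ J₁ J₂).pullback.map (secHom (L₂.rightSec X.right)) := by
  have h₁ := cocontinuousOne_comp (projU f₁ g f₂) (topology f₁ g f₂ J₁ J₂) J₁ (L₁.sec X.left)
  have h₂ := cocontinuousOne_comp (projV f₁ g f₂) (topology f₁ g f₂ J₁ J₂) J₂
    (L₂.rightSec X.right)
  rw [cocontinuousSec_eq] at h₁ h₂
  refine (Category.assoc _ _ _).symm.trans ?_
  refine (congrArg (· ≫ τ.app.app ((repSheaf JD).obj X.W)) h₁).trans ?_
  refine Eq.trans ?_ h₂.symm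
  refine (secHom_comp _ _).trans (congrArg secHom ?_)
  exact hτ.app_cocontinuousElt X

/-- With the canonical 2-morphism, the sheaf associated to `(U → W ← V)` is the pullback of the
inverse images of `U` and `V` over the inverse image of `W` from `C₂~`. A section over `Y` of this
pullback is locally given by `u : Y.U ⟶ X.U` and `v : Y.V ⟶ X.V`; the coverings by base change
provide the component `Y.W ⟶ X.W`, and `τ` compares the two squares. -/
lemma CellIsCanonical.representablesArePullbacks [HasFiniteLimits C₂] [HasFiniteLimits D]
    [PreservesFiniteLimits g]
    {τ : (toposSnd f₁ g f₂ J₁ J₂).comp q₂ ⟶ (toposFst f₁ g f₂ J₁ J₂).comp q₁}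
    (hτ : CellIsCanonical L₁ L₂ τ) :
    RepresentablesArePullbacks (projU f₁ g f₂) (projV f₁ g f₂) (topology f₁ g f₂ J₁ J₂)
      J₁ J₂ τ := by
  intro X
  refine ⟨(repSheaf JD).obj X.W, secHom (L₁.sec X.left), secHom (L₂.rightSec X.right), ?_⟩
  have ha {Y : FiveTuple f₁ g f₂} (q : Y ⟶ X) :
      (cocontinuousOne (projU f₁ g f₂) (topology f₁ g f₂ J₁ J₂) J₁ X).hom.app (op Y)
        ((toSheafify (topology f₁ g f₂ J₁ J₂) (yoneda.obj X)).app (op Y) q) =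
      cocontinuousElt (projU f₁ g f₂) (topology f₁ g f₂ J₁ J₂) J₁ (repElt J₁ q.onU) :=
    (congrArg _ (toSheafify_app_yoneda _ q)).trans (cocontinuousOne_repElt _ _ _ q)
  have hb {Y : FiveTuple f₁ g f₂} (q : Y ⟶ X) :
      (cocontinuousOne (projV f₁ g f₂) (topology f₁ g f₂ J₁ J₂) J₂ X).hom.app (op Y)
        ((toSheafify (topology f₁ g f₂ J₁ J₂) (yoneda.obj X)).app (op Y) q) =
      cocontinuousElt (projV f₁ g f₂) (topology f₁ g f₂ J₁ J₂) J₂ (repElt J₂ q.onV) :=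
    (congrArg _ (toSheafify_app_yoneda _ q)).trans (cocontinuousOne_repElt _ _ _ q)
  refine isPullback_of_locally (Q := yoneda.obj X) (hτ.left_comp_eq X) ?_ ?_
  · intro Y q q' hU hV
    change Y ⟶ X at q
    change Y ⟶ X at q'
    have hU' := (ha q).symm.trans (hU.trans (ha q'))
    have hV' := (hb q).symm.trans (hV.trans (hb q'))
    refine (locally_eq_of_cocontinuousElt_repElt_eq (projU f₁ g f₂) _ J₁ hU').bind ?_
    intro Z i hi
    refine ((locally_eq_of_cocontinuousElt_repElt_eq (projV f₁ g f₂) _ J₂ hV').pullback i).bind ?_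
    intro Z' j hj
    have hi' : j.onU ≫ i.onU ≫ q.onU = j.onU ≫ i.onU ≫ q'.onU := congrArg _ hi
    have hj' : (j.onV ≫ i.onV) ≫ q.onV = (j.onV ≫ i.onV) ≫ q'.onV := hj
    refine (locally_onW_comp_eq J₁ J₂ Z' (w := (j ≫ i ≫ q).onW) (w' := (j ≫ i ≫ q').onW) ?_).mono ?_
    · rw [(j ≫ i ≫ q).comm_left, (j ≫ i ≫ q').comm_left]
      exact congrArg (fun k => f₁.map k ≫ X.left) hi'
    · intro Z'' k hk
      have : k ≫ j ≫ i ≫ q = k ≫ j ≫ i ≫ q' := by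
        apply FiveTuple.hom_ext
        · exact congrArg (k.onU ≫ ·) hi'
        · simpa using congrArg (k.onV ≫ ·) hj'
        · exact hk
      change ((k ≫ j) ≫ i) ≫ q = ((k ≫ j) ≫ i) ≫ q'
      simpa using this
  · intro Y x y hxy
    let A := ((toposFst f₁ g f₂ J₁ J₂).pullback.obj ((repSheaf J₁).obj X.U)).obj
    let B := ((toposSnd f₁ g f₂ J₁ J₂).pullback.obj ((repSheaf J₂).obj X.V)).obj
    refine (locally_exists_cocontinuousElt_repElt (projU f₁ g f₂) _ J₁ x).bind ?_
    rintro Y₁ i₁ ⟨u, hu⟩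
    refine ((locally_exists_cocontinuousElt_repElt (projV f₁ g f₂) _ J₂ y).pullback i₁).bind ?_
    rintro Y₂ i₂ ⟨v, hv⟩
    change Y₁.U ⟶ X.U at u
    change Y₂.V ⟶ X.V at v
    have hu : cocontinuousElt (projU f₁ g f₂) (topology f₁ g f₂ J₁ J₂) J₁ (repElt J₁ u) =
      A.map i₁.op x := hu
    have hv : cocontinuousElt (projV f₁ g f₂) (topology f₁ g f₂ J₁ J₂) J₂ (repElt J₂ v) =
      B.map (i₂ ≫ i₁).op y := hv
    refine (locally_exists_left_comp_eq J₁ J₂ Y₂ (f₁.map (i₂.onU ≫ u) ≫ X.left)).bind ?_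
    rintro Y₃ i₃ ⟨w, hw⟩
    have hu' : cocontinuousElt (projU f₁ g f₂) (topology f₁ g f₂ J₁ J₂) J₁
        (repElt J₁ (i₃.onU ≫ i₂.onU ≫ u)) = A.map (i₃ ≫ i₂ ≫ i₁).op x := by
      refine Eq.symm (((section_map_comp A (i₂ ≫ i₁) i₃ x).trans
        (congrArg _ ((section_map_comp A i₁ i₂ x).trans (congrArg _ hu.symm)))).trans ?_)
      refine ((congrArg _ (map_cocontinuousElt _ _ _ _ _)).trans
        ((map_cocontinuousElt _ _ _ _ _).trans (congrArg _ ?_)))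
      exact (congrArg _ (map_repElt _ _ _)).trans (map_repElt _ _ _)
    have hv' : cocontinuousElt (projV f₁ g f₂) (topology f₁ g f₂ J₁ J₂) J₂
        (repElt J₂ (i₃.onV ≫ v)) = B.map (i₃ ≫ i₂ ≫ i₁).op y := by
      refine Eq.symm (((section_map_comp B (i₂ ≫ i₁) i₃ y).trans (congrArg _ hv.symm)).trans ?_)
      exact ((map_cocontinuousElt _ _ _ _ _).trans (congrArg _ (map_repElt _ _ _)))
    have key : cocontinuousElt (projV f₁ g f₂) (topology f₁ g f₂ J₁ J₂) J₂
          (L₂.rightSec (Y₃.right ≫ f₂.map w)) =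
        cocontinuousElt (projV f₁ g f₂) (topology f₁ g f₂ J₁ J₂) J₂
          (L₂.rightSec ((i₃.onV ≫ v) ≫ X.right)) := by
      refine (hτ Y₃ X.W w).symm.trans ?_
      have e₁ : cocontinuousElt (projU f₁ g f₂) (topology f₁ g f₂ J₁ J₂) J₁
          (L₁.sec (Y₃.left ≫ g.map w)) =
          ((toposFst f₁ g f₂ J₁ J₂).pullback.map (secHom (L₁.sec X.left))).hom.app (op Y₃)
            (A.map (i₃ ≫ i₂ ≫ i₁).op x) := by
        rw [← hu']
        refine Eq.trans (congrArg _ ?_) (pullback_map_cocontinuousElt _ _ _ _ _).symm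
        refine Eq.trans ?_ (secHom_repElt _ _).symm
        refine Eq.trans (congrArg L₁.sec ?_) (L₁.map_sec _ _).symm
        refine hw.trans ((Category.assoc _ _ _).symm.trans ?_)
        exact congrArg (· ≫ X.left) (f₁.map_comp i₃.onU (i₂.onU ≫ u)).symm
      have e₂ : cocontinuousElt (projV f₁ g f₂) (topology f₁ g f₂ J₁ J₂) J₂
          (L₂.rightSec ((i₃.onV ≫ v) ≫ X.right)) =
          ((toposSnd f₁ g f₂ J₁ J₂).pullback.map (secHom (L₂.rightSec X.right))).hom.app (op Y₃)
            (B.map (i₃ ≫ i₂ ≫ i₁).op y) := by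
        rw [← hv']
        refine Eq.trans (congrArg _ ?_) (pullback_map_cocontinuousElt _ _ _ _ _).symm
        refine Eq.trans ?_ (secHom_repElt _ _).symm
        exact (L₂.map_rightSec _ _).symm
      refine (congrArg _ e₁).trans (Eq.trans ?_ e₂.symm)
      refine (sheafHom_app_map ((toposFst f₁ g f₂ J₁ J₂).pullback.map (secHom (L₁.sec X.left)) ≫
        τ.app.app ((repSheaf JD).obj X.W)) (i₃ ≫ i₂ ≫ i₁) x).trans ?_
      refine Eq.trans ?_ (sheafHom_app_map _ _ _).symm
      exact congrArg _ hxy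
    refine (LegPresentation.locally_eq_of_cocontinuousElt_rightSec_eq key).mono ?_
    intro Y₄ i₄ hi₄
    have hi : i₄ ≫ i₃ ≫ i₂ ≫ i₁ = ((i₄ ≫ i₃) ≫ i₂) ≫ i₁ := by simp
    refine ⟨(show Y₄ ⟶ X from ⟨i₄.onU ≫ i₃.onU ≫ i₂.onU ≫ u, i₄.onV ≫ i₃.onV ≫ v,
      i₄.onW ≫ w, ?_, ?_⟩), ?_, ?_⟩
    · rw [left_comp_map, hw]
      simp
    · exact (right_comp_map i₄ w).trans (hi₄.trans (Category.assoc _ _ _).symm)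
    · refine (ha _).trans ?_
      refine Eq.trans (Eq.symm ?_) (congrArg (fun k => A.map (Quiver.Hom.op k) x) hi)
      refine (section_map_comp A (i₃ ≫ i₂ ≫ i₁) i₄ x).trans ((congrArg _ hu'.symm).trans ?_)
      exact (map_cocontinuousElt _ _ _ _ _).trans (congrArg _ (map_repElt _ _ _))
    · refine (hb _).trans ?_
      refine Eq.trans (Eq.symm ?_) (congrArg (fun k => B.map (Quiver.Hom.op k) y) hi)
      refine (section_map_comp B (i₃ ≫ i₂ ≫ i₁) i₄ y).trans ((congrArg _ hv'.symm).trans ?_)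
      exact (map_cocontinuousElt _ _ _ _ _).trans (congrArg _ (map_repElt _ _ _))

end Cell

/-! ### Comparison with the morphism of topoi of a flat functor -/

section Comparison

variable {C B S : Type u} [SmallCategory C] [SmallCategory B] [SmallCategory S]
  {J : GrothendieckTopology C} {JB : GrothendieckTopology B} {K : GrothendieckTopology S}
  {Φ : C ⥤ Sheaf K (Type u)} (hΦ : LocallyFlat Φ)
  (hJ : ∀ t : Sheaf K (Type u), Presheaf.IsSheaf J ((sheafTensorRight Φ).obj t))

variable (Φ) in
/-- The section `z ⊗ γ` of the extension of `Φ` to presheaves. -/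
def sheafTensorElt {P : Cᵒᵖ ⥤ Type u} {X : C} {s : Sᵒᵖ} (z : (Φ.obj X).obj.obj s)
    (γ : P.obj (op X)) : ((sheafTensor Φ).obj P).obj.obj s :=
  (toSheafify K ((tensor (Φ ⋙ sheafToPresheaf K (Type u))).obj P)).app s (sheafTensorMk Φ X z γ)

lemma sheafTensor_map_sheafTensorElt {P Q : Cᵒᵖ ⥤ Type u} (b : P ⟶ Q) {X : C} {s : Sᵒᵖ}
    (z : (Φ.obj X).obj.obj s) (γ : P.obj (op X)) :
    ((sheafTensor Φ).map b).hom.app s (sheafTensorElt Φ z γ) =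
      sheafTensorElt Φ z (b.app _ γ) :=
  presheafToSheaf_map_toSheafify K ((tensor (Φ ⋙ sheafToPresheaf K (Type u))).map b)
    (sheafTensorMk Φ X z γ)

/-- Morphisms to `t` from the inverse image of the sheaf associated to `P`, under the morphism of
topoi of a flat functor `Φ`. -/
def homEquivOfFlat {P : Cᵒᵖ ⥤ Type u} {t : Sheaf K (Type u)} :
    ((hΦ.geometricMorphism Φ J hJ).pullback.obj ((presheafToSheaf J (Type u)).obj P) ⟶ t) ≃
      (P ⟶ (sheafTensorRight Φ).obj t) :=
  ((hΦ.geometricMorphism Φ J hJ).adj.homEquiv _ _).trans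
    ((sheafificationAdjunction J (Type u)).homEquiv P
      ((hΦ.geometricMorphism Φ J hJ).pushforward.obj t))

lemma homEquivOfFlat_eq {P : Cᵒᵖ ⥤ Type u} {t : Sheaf K (Type u)}
    (a : (hΦ.geometricMorphism Φ J hJ).pullback.obj ((presheafToSheaf J (Type u)).obj P) ⟶ t) :
    homEquivOfFlat hΦ hJ a = (sheafTensorAdj Φ).homEquiv _ _
      ((sheafTensor Φ).map (toSheafify J P) ≫ a) := by
  refine Eq.trans ?_ ((sheafTensorAdj Φ).homEquiv_naturality_left (toSheafify J P) a).symm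
  exact (sheafificationAdjunction J (Type u)).homEquiv_unit _ _ _

/-- The section `z ⊗ γ` of the inverse image of the sheaf associated to a presheaf under the
morphism of topoi of a flat functor. -/
def tensorElt {P : Cᵒᵖ ⥤ Type u} {X : C} {s : Sᵒᵖ} (z : (Φ.obj X).obj.obj s)
    (γ : P.obj (op X)) :
    ((hΦ.geometricMorphism Φ J hJ).pullback.obj
      ((presheafToSheaf J (Type u)).obj P)).obj.obj s :=
  sheafTensorElt Φ z ((toSheafify J P).app _ γ)

lemma pullback_map_tensorElt {P Q : Cᵒᵖ ⥤ Type u} (b : P ⟶ Q) {X : C} {s : Sᵒᵖ}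
    (z : (Φ.obj X).obj.obj s) (γ : P.obj (op X)) :
    ((hΦ.geometricMorphism Φ J hJ).pullback.map ((presheafToSheaf J (Type u)).map b)).hom.app s
      (tensorElt hΦ hJ z γ) = tensorElt hΦ hJ z (b.app _ γ) :=
  (sheafTensor_map_sheafTensorElt ((presheafToSheaf J (Type u)).map b).hom z _).trans
    (congrArg (sheafTensorElt Φ z) (presheafToSheaf_map_toSheafify J b γ))

lemma homEquivOfFlat_app {P : Cᵒᵖ ⥤ Type u} {t : Sheaf K (Type u)}
    (a : (hΦ.geometricMorphism Φ J hJ).pullback.obj ((presheafToSheaf J (Type u)).obj P) ⟶ t)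
    (X : C) (γ : P.obj (op X)) (s : Sᵒᵖ) (z : (Φ.obj X).obj.obj s) :
    NatTrans.app (F := (Φ.obj X).obj) (G := t.obj)
      ((homEquivOfFlat hΦ hJ a).app (op X) γ) s z = a.hom.app s (tensorElt hΦ hJ z γ) := by
  rw [homEquivOfFlat_eq]
  exact congrArg (a.hom.app s) (sheafTensor_map_sheafTensorElt (toSheafify J P) z γ)

lemma hom_ext_tensorElt {P : Cᵒᵖ ⥤ Type u} {t : Sheaf K (Type u)}
    {a b : (hΦ.geometricMorphism Φ J hJ).pullback.obj ((presheafToSheaf J (Type u)).obj P) ⟶ t}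
    (h : ∀ (X : C) (γ : P.obj (op X)) (s : Sᵒᵖ) (z : (Φ.obj X).obj.obj s),
      a.hom.app s (tensorElt hΦ hJ z γ) = b.hom.app s (tensorElt hΦ hJ z γ)) : a = b := by
  apply (homEquivOfFlat hΦ hJ).injective
  ext ⟨X⟩ γ
  refine NatTrans.ext (F := (Φ.obj X).obj) (G := t.obj) ?_
  funext s
  ext z
  exact (homEquivOfFlat_app hΦ hJ a X γ s z).trans
    ((h X γ s z).trans (homEquivOfFlat_app hΦ hJ b X γ s z).symm)

/-- The extension of `Φ` does not see sheafification, since the presheaves `X ↦ Hom(Φ(X), t)` are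
sheaves. -/
lemma isIso_sheafTensor_map_toSheafify (hΦ : LocallyFlat Φ)
    (hJ : ∀ t : Sheaf K (Type u), Presheaf.IsSheaf J ((sheafTensorRight Φ).obj t))
    (P : Cᵒᵖ ⥤ Type u) : IsIso ((sheafTensor Φ).map (toSheafify J P)) := by
  apply isIso_of_coyoneda_map_bijective
  intro t
  have h : (fun a => (sheafTensor Φ).map (toSheafify J P) ≫ a) =
      ((homEquivOfFlat hΦ hJ).trans ((sheafTensorAdj Φ).homEquiv P t).symm :) := by
    funext a
    exact ((((sheafTensorAdj Φ).homEquiv P t).symm_apply_eq).2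
      (homEquivOfFlat_eq hΦ hJ a)).symm
  rw [h]
  exact Equiv.bijective _

variable (F : C ⥤ B) [F.IsCocontinuous J JB]
  (x : GeometricMorphism (Sheaf K (Type u)) (Sheaf JB (Type u)))
  (π : Φ ⟶ F ⋙ repSheaf JB ⋙ x.pullback)

lemma flat_natTrans_naturality {X Y : C} (f : X ⟶ Y) {s : Sᵒᵖ} (z : (Φ.obj X).obj.obj s) :
    (π.app Y).hom.app s ((Φ.map f).hom.app s z) =
      (x.pullback.map ((repSheaf JB).map (F.map f))).hom.app s ((π.app X).hom.app s z) :=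
  congrArg (fun k : Φ.obj X ⟶ x.pullback.obj ((repSheaf JB).obj (F.obj Y)) => k.hom.app s z)
    (π.naturality f)

lemma pullback_map_secHom_map {V V' : B} (f : V' ⟶ V) {G : Sheaf JB (Type u)}
    (γ : G.obj.obj (op V)) {s : Sᵒᵖ}
    (z : (x.pullback.obj ((repSheaf JB).obj V')).obj.obj s) :
    (x.pullback.map (secHom (G.obj.map f.op γ))).hom.app s z =
      (x.pullback.map (secHom γ)).hom.app s
        ((x.pullback.map ((repSheaf JB).map f)).hom.app s z) := by
  rw [← map_secHom]
  exact map_comp_hom_app x.pullback _ _ z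

/-- The morphism `h^* p^* G → x^* G` sending `z ⊗ γ` to `x^*(γ)(π(z))`, where `h` is the morphism of
topoi of `Φ` and `p` is induced by the cocontinuous functor `F`. -/
def comparisonApp (G : Sheaf JB (Type u)) :
    (hΦ.geometricMorphism Φ J hJ).pullback.obj
      ((cocontinuousGeometricMorphism F J JB).pullback.obj G) ⟶ x.pullback.obj G :=
  (homEquivOfFlat hΦ hJ (P := F.op ⋙ G.obj)).symm
    { app := fun X => TypeCat.ofHom (fun γ =>
        show (Φ.obj X.unop).obj ⟶ (x.pullback.obj G).obj from
          (π.app X.unop ≫ x.pullback.map (secHom γ)).hom)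
      naturality := fun X Y f => by
        ext γ
        refine NatTrans.ext (F := (Φ.obj Y.unop).obj) (G := (x.pullback.obj G).obj) ?_
        funext s
        ext z
        refine (pullback_map_secHom_map x (F.map f.unop) γ _).trans (congrArg _ ?_)
        exact (flat_natTrans_naturality F x π f.unop z).symm }

lemma comparisonApp_tensorElt (G : Sheaf JB (Type u)) {X : C} (γ : G.obj.obj (op (F.obj X)))
    {s : Sᵒᵖ} (z : (Φ.obj X).obj.obj s) :
    (comparisonApp hΦ hJ F x π G).hom.app s (tensorElt hΦ hJ (P := F.op ⋙ G.obj) z γ) =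
      (x.pullback.map (secHom γ)).hom.app s ((π.app X).hom.app s z) := by
  refine (homEquivOfFlat_app hΦ hJ (P := F.op ⋙ G.obj) _ X γ s z).symm.trans ?_
  exact congrArg (fun k : F.op ⋙ G.obj ⟶ (sheafTensorRight Φ).obj (x.pullback.obj G) =>
    NatTrans.app (F := (Φ.obj X).obj) (G := (x.pullback.obj G).obj) (k.app (op X) γ) s z)
    (Equiv.apply_symm_apply (homEquivOfFlat hΦ hJ (P := F.op ⋙ G.obj)) _)

/-- The transformation `h^* p^* → x^*` given by a transformation `π` from `Φ` to the restriction of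
`x^*` along `F`, where `h` is the morphism of topoi of `Φ` and `p` is induced by the cocontinuous
functor `F`. -/
def comparison : (cocontinuousGeometricMorphism F J JB).pullback ⋙
    (hΦ.geometricMorphism Φ J hJ).pullback ⟶ x.pullback where
  app G := comparisonApp hΦ hJ F x π G
  naturality G G' b := by
    refine hom_ext_tensorElt hΦ hJ (P := F.op ⋙ G.obj) (fun X γ s z => ?_)
    refine (congrArg ((comparisonApp hΦ hJ F x π G').hom.app s)
      (pullback_map_tensorElt hΦ hJ (Functor.whiskerLeft F.op b.hom) z γ)).trans ?_
    refine (comparisonApp_tensorElt hΦ hJ F x π G' (b.hom.app _ γ) z).trans ?_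
    refine Eq.trans ?_ (congrArg ((x.pullback.map b).hom.app s)
      (comparisonApp_tensorElt hΦ hJ F x π G γ z)).symm
    rw [← secHom_comp]
    exact map_comp_hom_app x.pullback _ _ _

lemma comparison_app_tensorElt (G : Sheaf JB (Type u)) {X : C} (γ : G.obj.obj (op (F.obj X)))
    {s : Sᵒᵖ} (z : (Φ.obj X).obj.obj s) :
    ((comparison hΦ hJ F x π).app G).hom.app s (tensorElt hΦ hJ (P := F.op ⋙ G.obj) z γ) =
      (x.pullback.map (secHom γ)).hom.app s ((π.app X).hom.app s z) :=
  comparisonApp_tensorElt hΦ hJ F x π G γ z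

/-- The comparison transformation is invertible if sections of `x^*` on representable sheaves
locally come from `Φ`, and if sections of `Φ` can be lifted along morphisms to `F(X)`. -/
lemma isIso_comparison_app
    (hsurj : ∀ (s : S) (V : B) (w : (x.pullback.obj ((repSheaf JB).obj V)).obj.obj (op s)),
      Locally K s (fun s' i => ∃ (X : C) (f : F.obj X ⟶ V) (z : (Φ.obj X).obj.obj (op s')),
        (x.pullback.map ((repSheaf JB).map f)).hom.app _ ((π.app X).hom.app _ z) =
          (x.pullback.obj ((repSheaf JB).obj V)).obj.map i.op w))
    (hinj : ∀ (s : S) (X : C) (z : (Φ.obj X).obj.obj (op s)) (V : B) (b : V ⟶ F.obj X)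
      (w : (x.pullback.obj ((repSheaf JB).obj V)).obj.obj (op s)),
      (x.pullback.map ((repSheaf JB).map b)).hom.app _ w = (π.app X).hom.app _ z →
      Locally K s (fun s' i => ∃ (X' : C) (f : X' ⟶ X) (k : F.obj X' ⟶ V)
        (z' : (Φ.obj X').obj.obj (op s')), k ≫ b = F.map f ∧
          (Φ.map f).hom.app _ z' = (Φ.obj X).obj.map i.op z))
    (G : Sheaf JB (Type u)) : IsIso ((comparison hΦ hJ F x π).app G) := by
  let P : Cᵒᵖ ⥤ Type u := F.op ⋙ G.obj
  let j := (sheafTensor Φ).map (toSheafify J P)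
  have hj : IsIso j := isIso_sheafTensor_map_toSheafify hΦ hJ P
  let φ : (sheafTensor Φ).obj P ⟶ x.pullback.obj G := j ≫ (comparison hΦ hJ F x π).app G
  let ψ : (tensor (Φ ⋙ sheafToPresheaf K (Type u))).obj P ⟶ (x.pullback.obj G).obj :=
    toSheafify K _ ≫ φ.hom
  have hψ {s : Sᵒᵖ} {X : C} (z : (Φ.obj X).obj.obj s) (γ : G.obj.obj (op (F.obj X))) :
      ψ.app s (sheafTensorMk Φ (P := P) X z γ) =
        (x.pullback.map (secHom γ)).hom.app s ((π.app X).hom.app s z) := by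
    refine Eq.trans ?_ (comparison_app_tensorElt hΦ hJ F x π G γ z)
    exact congrArg (((comparison hΦ hJ F x π).app G).hom.app s)
      (sheafTensor_map_sheafTensorElt (toSheafify J P) z (show P.obj (op X) from γ))
  have i₁ : Presheaf.IsLocallyInjective K ψ := by
    refine isLocallyInjective_of_locally ψ (fun s w₁ w₂ h => ?_)
    obtain ⟨X₁, z₁, γ₁, rfl⟩ := tensorMk_surj w₁
    obtain ⟨X₂, z₂, γ₂, rfl⟩ := tensorMk_surj w₂
    have h' := (hψ z₁ γ₁).symm.trans (h.trans (hψ z₂ γ₂))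
    refine (hΦ.span z₁ z₂).bind ?_
    rintro s₁ i₁ ⟨X, f₁, f₂, z, hz₁, hz₂⟩
    have h₃ : (x.pullback.map (secHom (G.obj.map (F.map f₁).op γ₁))).hom.app _
          ((π.app X).hom.app _ z) =
        (x.pullback.map (secHom (G.obj.map (F.map f₂).op γ₂))).hom.app _
          ((π.app X).hom.app _ z) := by
      rw [pullback_map_secHom_map, pullback_map_secHom_map, ← flat_natTrans_naturality,
        ← flat_natTrans_naturality, hz₁, hz₂, sheafHom_app_map, sheafHom_app_map]
      refine (sheafHom_app_map _ _ _).trans ((congrArg _ h').trans (sheafHom_app_map _ _ _).symm)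
    refine (x.locally_exists_of_section_eq _ _ _ h₃).bind ?_
    rintro s₂ i₂ ⟨V, b, w, hb, hw⟩
    -- The two sections agree on `V`, and `z` can be lifted to some `X'` with `F(X')` over `V`.
    refine (hinj s₂ X ((Φ.obj X).obj.map i₂.op z) V b w ?_).mono ?_
    · exact hw.trans (sheafHom_app_map _ _ _).symm
    rintro s₃ i₃ ⟨X', f, k, z', hk, hz'⟩
    have e {X₀ : C} (f₀ : X ⟶ X₀) (z₀ : (Φ.obj X₀).obj.obj (op s))
        (h₀ : (Φ.map f₀).hom.app _ z = (Φ.obj X₀).obj.map i₁.op z₀) :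
        (Φ.map (f ≫ f₀)).hom.app _ z' = (Φ.obj X₀).obj.map ((i₃ ≫ i₂) ≫ i₁).op z₀ := by
      rw [map_comp_hom_app, hz', sheafHom_app_map, sheafHom_app_map, h₀]
      exact ((section_map_comp _ _ _ _).trans (section_map_comp _ _ _ _)).symm
    refine sheafTensorMk_eq (P := P) (f ≫ f₁) (f ≫ f₂) ?_ (e f₁ z₁ hz₁) (e f₂ z₂ hz₂)
    have e' {X₀ : C} (f₀ : X ⟶ X₀) (γ₀ : G.obj.obj (op (F.obj X₀))) :
        P.map (f ≫ f₀).op γ₀ = G.obj.map k.op (G.obj.map b.op (G.obj.map (F.map f₀).op γ₀)) := by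
      rw [← section_map_comp, ← section_map_comp, hk, ← F.map_comp]
      rfl
    exact (e' f₁ γ₁).trans ((congrArg _ hb).trans (e' f₂ γ₂).symm)
  have i₂ : Presheaf.IsLocallySurjective K ψ := by
    refine isLocallySurjective_of_locally ψ (fun s w => ?_)
    refine (x.locally_exists_section G w).bind ?_
    rintro s₁ i₁ ⟨V, γ, y, hy⟩
    refine (hsurj s₁ V y).mono ?_
    rintro s₂ i₂ ⟨X, f, z, hz⟩
    refine ⟨sheafTensorMk Φ (P := P) X z (show P.obj (op X) from G.obj.map f.op γ), ?_⟩
    refine (hψ z _).trans ?_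
    rw [pullback_map_secHom_map, hz, sheafHom_app_map, hy]
    exact (section_map_comp _ _ _ _).symm
  have j₁ : Sheaf.IsLocallyInjective φ :=
    (Presheaf.comp_isLocallyInjective_iff K (toSheafify K _) φ.hom).1 i₁
  have j₂ : Sheaf.IsLocallySurjective φ :=
    (Presheaf.comp_isLocallySurjective_iff K (toSheafify K _) φ.hom).1 i₂
  have hφ : IsIso φ := (Sheaf.isLocallyBijective_iff_isIso φ).1 ⟨j₁, j₂⟩
  exact IsIso.of_isIso_comp_left j ((comparison hΦ hJ F x π).app G)

end Comparison

/-! ### The flat functor of a triple -/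

section ConeFunctor

open FiveTuple

variable {C₁ C₂ E D S : Type u} [SmallCategory C₁] [SmallCategory C₂] [SmallCategory E]
  [SmallCategory D] [SmallCategory S] {f₁ : C₁ ⥤ E} {g : D ⥤ E} {f₂ : D ⥤ C₂}
  {J₁ : GrothendieckTopology C₁} {J₂ : GrothendieckTopology C₂} {JD : GrothendieckTopology D}
  {q₁ : GeometricMorphism (Sheaf J₁ (Type u)) (Sheaf JD (Type u))}
  {q₂ : GeometricMorphism (Sheaf J₂ (Type u)) (Sheaf JD (Type u))}
  (L₁ : LegPresentation f₁ g q₁) (L₂ : LegPresentation (𝟭 C₂) f₂ q₂)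
  {K : GrothendieckTopology S}

/-- The inverse image of `W` from the right leg is the sheaf associated to `f₂(W)`. -/
lemma LegPresentation.isIso_secHom_rightSec (W : D) :
    IsIso (secHom (L₂.rightSec (𝟙 (f₂.obj W)))) := by
  let φ := secHom (L₂.rightSec (𝟙 (f₂.obj W)))
  let ψ : yoneda.obj (f₂.obj W) ⟶ (q₂.pullback.obj ((repSheaf JD).obj W)).obj :=
    toSheafify J₂ (yoneda.obj (f₂.obj W)) ≫ φ.hom
  have hψ {V : C₂} (r : V ⟶ f₂.obj W) : ψ.app (op V) r = L₂.rightSec r := by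
    refine (congrArg (φ.hom.app (op V)) (toSheafify_app_yoneda J₂ r)).trans ?_
    refine (secHom_repElt r _).trans ((L₂.map_rightSec r _).trans ?_)
    rw [Category.comp_id]
  have i₁ : Presheaf.IsLocallyInjective J₂ ψ := isLocallyInjective_of_locally ψ (fun V r r' h =>
    L₂.locally_eq ((hψ r).symm.trans (h.trans (hψ r'))))
  have i₂ : Presheaf.IsLocallySurjective J₂ ψ := isLocallySurjective_of_locally ψ (fun V z => by
    refine (L₂.locally_exists (U := V) z).mono ?_
    rintro V' i ⟨r, hr⟩
    exact ⟨r, (hψ r).trans hr⟩)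
  have j₁ : Sheaf.IsLocallyInjective φ :=
    (Presheaf.comp_isLocallyInjective_iff J₂ (toSheafify J₂ _) φ.hom).1 i₁
  have j₂ : Sheaf.IsLocallySurjective φ :=
    (Presheaf.comp_isLocallySurjective_iff J₂ (toSheafify J₂ _) φ.hom).1 i₂
  exact (Sheaf.isLocallyBijective_iff_isIso φ).1 ⟨j₁, j₂⟩

variable (c : OrientedCone q₁ q₂ (Sheaf K (Type u)))

namespace OrientedCone

/-- The inverse images of representable sheaves on `D` under `T → C₂~ → D~`. -/
abbrev base : D ⥤ Sheaf K (Type u) := repSheaf JD ⋙ q₂.pullback ⋙ c.snd.pullback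

lemma preservesFiniteLimits_base [HasFiniteLimits D] (s : S) :
    PreservesFiniteLimits (c.base ⋙ sectionsFunctor K s) := by
  have := q₂.exact
  have := c.snd.exact
  have : PreservesFiniteLimits c.base :=
    comp_preservesFiniteLimits (repSheaf JD) (q₂.pullback ⋙ c.snd.pullback)
  infer_instance

lemma preservesFiniteLimits_snd [HasFiniteLimits C₂] (s : S) :
    PreservesFiniteLimits ((repSheaf J₂ ⋙ c.snd.pullback) ⋙ sectionsFunctor K s) := by
  have := c.snd.exact
  have : PreservesFiniteLimits (repSheaf J₂ ⋙ c.snd.pullback) :=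
    comp_preservesFiniteLimits (repSheaf J₂) c.snd.pullback
  infer_instance

/-- The morphism from the inverse image of `U` to that of `W` given by `l : f₁(U) → g(W)` and by
the 2-morphism of the triple. -/
def legMap {U : C₁} {W : D} (l : f₁.obj U ⟶ g.obj W) :
    c.fst.pullback.obj ((repSheaf J₁).obj U) ⟶ c.base.obj W :=
  c.fst.pullback.map (secHom (L₁.sec l)) ≫ c.nat.app ((repSheaf JD).obj W)

/-- The morphism from the inverse image of `V` to that of `W` given by `r : V → f₂(W)`. -/
def footMap {V : C₂} {W : D} (r : V ⟶ f₂.obj W) :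
    c.snd.pullback.obj ((repSheaf J₂).obj V) ⟶ c.base.obj W :=
  c.snd.pullback.map (secHom (L₂.rightSec r))

lemma map_legMap {U U' : C₁} {W : D} (i : U' ⟶ U) (l : f₁.obj U ⟶ g.obj W) :
    c.fst.pullback.map ((repSheaf J₁).map i) ≫ c.legMap L₁ l = c.legMap L₁ (f₁.map i ≫ l) := by
  rw [legMap, legMap, ← L₁.map_sec, ← map_secHom, c.fst.pullback.map_comp, Category.assoc]

lemma legMap_comp {U : C₁} {W W' : D} (l : f₁.obj U ⟶ g.obj W) (ω : W ⟶ W') :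
    c.legMap L₁ l ≫ c.base.map ω = c.legMap L₁ (l ≫ g.map ω) := by
  have h := c.nat.naturality ((repSheaf JD).map ω)
  rw [legMap, legMap, ← L₁.sec_comp, ← secHom_comp, c.fst.pullback.map_comp]
  refine (Category.assoc _ _ _).trans (Eq.trans ?_ (Category.assoc _ _ _).symm)
  exact congrArg _ h.symm

lemma map_footMap {V V' : C₂} {W : D} (i : V' ⟶ V) (r : V ⟶ f₂.obj W) :
    c.snd.pullback.map ((repSheaf J₂).map i) ≫ c.footMap L₂ r = c.footMap L₂ (i ≫ r) := by
  rw [footMap, footMap, ← L₂.map_rightSec, ← map_secHom, c.snd.pullback.map_comp]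

lemma footMap_comp {V : C₂} {W W' : D} (r : V ⟶ f₂.obj W) (ω : W ⟶ W') :
    c.footMap L₂ r ≫ c.base.map ω = c.footMap L₂ (r ≫ f₂.map ω) := by
  have h := L₂.sec_comp (U := V) r ω
  refine (c.snd.pullback.map_comp _ _).symm.trans (congrArg _ ?_)
  exact (secHom_comp _ _).trans (congrArg secHom h)

lemma isIso_footMap_id (W : D) : IsIso (c.footMap L₂ (𝟙 (f₂.obj W))) := by
  have := L₂.isIso_secHom_rightSec W
  exact inferInstanceAs (IsIso (c.snd.pullback.map _))

lemma legMap_app_map {U U' : C₁} {W : D} (i : U' ⟶ U) (l : f₁.obj U ⟶ g.obj W) {s : Sᵒᵖ}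
    (u : (c.fst.pullback.obj ((repSheaf J₁).obj U')).obj.obj s) :
    (c.legMap L₁ l).hom.app s ((c.fst.pullback.map ((repSheaf J₁).map i)).hom.app s u) =
      (c.legMap L₁ (f₁.map i ≫ l)).hom.app s u :=
  congrArg (fun k : c.fst.pullback.obj ((repSheaf J₁).obj U') ⟶ c.base.obj W => k.hom.app s u)
    (c.map_legMap L₁ i l)

lemma base_map_legMap_app {U : C₁} {W W' : D} (l : f₁.obj U ⟶ g.obj W) (ω : W ⟶ W') {s : Sᵒᵖ}
    (u : (c.fst.pullback.obj ((repSheaf J₁).obj U)).obj.obj s) :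
    (c.base.map ω).hom.app s ((c.legMap L₁ l).hom.app s u) =
      (c.legMap L₁ (l ≫ g.map ω)).hom.app s u :=
  congrArg (fun k : c.fst.pullback.obj ((repSheaf J₁).obj U) ⟶ c.base.obj W' => k.hom.app s u)
    (c.legMap_comp L₁ l ω)

lemma footMap_app_map {V V' : C₂} {W : D} (i : V' ⟶ V) (r : V ⟶ f₂.obj W) {s : Sᵒᵖ}
    (v : (c.snd.pullback.obj ((repSheaf J₂).obj V')).obj.obj s) :
    (c.footMap L₂ r).hom.app s ((c.snd.pullback.map ((repSheaf J₂).map i)).hom.app s v) =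
      (c.footMap L₂ (i ≫ r)).hom.app s v :=
  congrArg (fun k : c.snd.pullback.obj ((repSheaf J₂).obj V') ⟶ c.base.obj W => k.hom.app s v)
    (c.map_footMap L₂ i r)

lemma base_map_footMap_app {V : C₂} {W W' : D} (r : V ⟶ f₂.obj W) (ω : W ⟶ W') {s : Sᵒᵖ}
    (v : (c.snd.pullback.obj ((repSheaf J₂).obj V)).obj.obj s) :
    (c.base.map ω).hom.app s ((c.footMap L₂ r).hom.app s v) =
      (c.footMap L₂ (r ≫ f₂.map ω)).hom.app s v :=
  congrArg (fun k : c.snd.pullback.obj ((repSheaf J₂).obj V) ⟶ c.base.obj W' => k.hom.app s v)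
    (c.footMap_comp L₂ r ω)

/-- The morphism between pullbacks of inverse images given by a morphism of 5-tuples. -/
def functorMap {X Y : FiveTuple f₁ g f₂} (i : X ⟶ Y) :
    pullback (c.legMap L₁ X.left) (c.footMap L₂ X.right) ⟶
      pullback (c.legMap L₁ Y.left) (c.footMap L₂ Y.right) :=
  pullback.lift
    (pullback.fst _ _ ≫ c.fst.pullback.map ((repSheaf J₁).map i.onU))
    (pullback.snd _ _ ≫ c.snd.pullback.map ((repSheaf J₂).map i.onV)) (by
      rw [Category.assoc, Category.assoc, map_legMap, map_footMap, ← i.comm_left, ← i.comm_right,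
        ← legMap_comp, ← footMap_comp, pullback.condition_assoc])

lemma functorMap_fst {X Y : FiveTuple f₁ g f₂} (i : X ⟶ Y) :
    c.functorMap L₁ L₂ i ≫ pullback.fst _ _ =
      pullback.fst _ _ ≫ c.fst.pullback.map ((repSheaf J₁).map i.onU) :=
  pullback.lift_fst _ _ _

lemma functorMap_snd {X Y : FiveTuple f₁ g f₂} (i : X ⟶ Y) :
    c.functorMap L₁ L₂ i ≫ pullback.snd _ _ =
      pullback.snd _ _ ≫ c.snd.pullback.map ((repSheaf J₂).map i.onV) :=
  pullback.lift_snd _ _ _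

/-- The functor sending `(U → W ← V)` to the pullback of the inverse images of `U` and `V` over the
inverse image of `W`. -/
def functor : FiveTuple f₁ g f₂ ⥤ Sheaf K (Type u) where
  obj X := pullback (c.legMap L₁ X.left) (c.footMap L₂ X.right)
  map i := c.functorMap L₁ L₂ i
  map_id X := by
    apply pullback.hom_ext
    · rw [functorMap_fst]; simp
    · rw [functorMap_snd]; simp
  map_comp i j := by
    apply pullback.hom_ext
    · rw [functorMap_fst, Category.assoc, functorMap_fst, reassoc_of% functorMap_fst L₁ L₂ c i]
      simp
    · rw [functorMap_snd, Category.assoc, functorMap_snd, reassoc_of% functorMap_snd L₁ L₂ c i]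
      simp

/-- The first projection of the pullbacks defining `c.functor`. -/
def functorFst : c.functor L₁ L₂ ⟶ projU f₁ g f₂ ⋙ repSheaf J₁ ⋙ c.fst.pullback where
  app X := pullback.fst (c.legMap L₁ X.left) (c.footMap L₂ X.right)
  naturality _ _ i := c.functorMap_fst L₁ L₂ i

/-- The second projection of the pullbacks defining `c.functor`. -/
def functorSnd : c.functor L₁ L₂ ⟶ projV f₁ g f₂ ⋙ repSheaf J₂ ⋙ c.snd.pullback where
  app X := pullback.snd (c.legMap L₁ X.left) (c.footMap L₂ X.right)
  naturality _ _ i := c.functorMap_snd L₁ L₂ i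

lemma isPullback_functor (X : FiveTuple f₁ g f₂) :
    IsPullback ((c.functorFst L₁ L₂).app X) ((c.functorSnd L₁ L₂).app X)
      (c.legMap L₁ X.left) (c.footMap L₂ X.right) :=
  IsPullback.of_hasPullback _ _

lemma functorFst_naturality {X Y : FiveTuple f₁ g f₂} (i : X ⟶ Y) {s : Sᵒᵖ}
    (z : ((c.functor L₁ L₂).obj X).obj.obj s) :
    ((c.functorFst L₁ L₂).app Y).hom.app s (((c.functor L₁ L₂).map i).hom.app s z) =
      (c.fst.pullback.map ((repSheaf J₁).map i.onU)).hom.app s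
        (((c.functorFst L₁ L₂).app X).hom.app s z) :=
  flat_natTrans_naturality (projU f₁ g f₂) c.fst (c.functorFst L₁ L₂) i z

lemma functorSnd_naturality {X Y : FiveTuple f₁ g f₂} (i : X ⟶ Y) {s : Sᵒᵖ}
    (z : ((c.functor L₁ L₂).obj X).obj.obj s) :
    ((c.functorSnd L₁ L₂).app Y).hom.app s (((c.functor L₁ L₂).map i).hom.app s z) =
      (c.snd.pullback.map ((repSheaf J₂).map i.onV)).hom.app s
        (((c.functorSnd L₁ L₂).app X).hom.app s z) :=
  flat_natTrans_naturality (projV f₁ g f₂) c.snd (c.functorSnd L₁ L₂) i z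

lemma functor_w {X : FiveTuple f₁ g f₂} {s : Sᵒᵖ} (z : ((c.functor L₁ L₂).obj X).obj.obj s) :
    (c.legMap L₁ X.left).hom.app s (((c.functorFst L₁ L₂).app X).hom.app s z) =
      (c.footMap L₂ X.right).hom.app s (((c.functorSnd L₁ L₂).app X).hom.app s z) :=
  congrArg (fun k : (c.functor L₁ L₂).obj X ⟶ c.base.obj X.W => k.hom.app s z)
    (c.isPullback_functor L₁ L₂ X).w

lemma functor_ext {X : FiveTuple f₁ g f₂} {s : Sᵒᵖ} {z z' : ((c.functor L₁ L₂).obj X).obj.obj s}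
    (h₁ : ((c.functorFst L₁ L₂).app X).hom.app s z = ((c.functorFst L₁ L₂).app X).hom.app s z')
    (h₂ : ((c.functorSnd L₁ L₂).app X).hom.app s z = ((c.functorSnd L₁ L₂).app X).hom.app s z') :
    z = z' :=
  (c.isPullback_functor L₁ L₂ X).section_ext h₁ h₂

lemma exists_functor_elt {X : FiveTuple f₁ g f₂} {s : Sᵒᵖ}
    (u : (c.fst.pullback.obj ((repSheaf J₁).obj X.U)).obj.obj s)
    (v : (c.snd.pullback.obj ((repSheaf J₂).obj X.V)).obj.obj s)
    (h : (c.legMap L₁ X.left).hom.app s u = (c.footMap L₂ X.right).hom.app s v) :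
    ∃ z : ((c.functor L₁ L₂).obj X).obj.obj s, ((c.functorFst L₁ L₂).app X).hom.app s z = u ∧
      ((c.functorSnd L₁ L₂).app X).hom.app s z = v :=
  (c.isPullback_functor L₁ L₂ X).exists_section u v h

variable [HasFiniteLimits C₂] [HasFiniteLimits D] [PreservesFiniteLimits g]
  [PreservesFiniteLimits f₂]

/-- The functor of a triple is locally flat: this uses flatness of `c.fst.pullback` for the first
components, and finite limits in `C₂` and `D` for the other ones. -/
lemma locallyFlat_functor : LocallyFlat (c.functor L₁ L₂) where
  nonempty s := by
    refine (c.fst.locallyFlat.nonempty s).mono ?_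
    rintro s' i ⟨U, ⟨u⟩⟩
    have := c.preservesFiniteLimits_base s'
    have := c.preservesFiniteLimits_snd s'
    obtain ⟨v⟩ := exists_elem_terminal ((repSheaf J₂ ⋙ c.snd.pullback) ⋙ sectionsFunctor K s')
    have hsub := subsingleton_elem_terminal (c.base ⋙ sectionsFunctor K s')
    -- `f₂` and `g` preserve the terminal object, so both legs exist.
    let X : FiveTuple f₁ g f₂ := ⟨U, ⊤_ C₂, ⊤_ D,
      (terminalIsTerminal.isTerminalObj g _).from _, (terminalIsTerminal.isTerminalObj f₂ _).from _⟩
    obtain ⟨z, -⟩ := c.exists_functor_elt L₁ L₂ (X := X) (s := op s') u v (hsub.elim _ _)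
    exact ⟨X, ⟨z⟩⟩
  span {s X₁ X₂} z₁ z₂ := by
    refine (c.fst.locallyFlat.span (((c.functorFst L₁ L₂).app X₁).hom.app _ z₁)
      (((c.functorFst L₁ L₂).app X₂).hom.app _ z₂)).mono ?_
    rintro s' i ⟨U, a₁, a₂, u, hu₁, hu₂⟩
    have := c.preservesFiniteLimits_base s'
    have := c.preservesFiniteLimits_snd s'
    obtain ⟨v, hv₁, hv₂⟩ := exists_elem_prod
      ((repSheaf J₂ ⋙ c.snd.pullback) ⋙ sectionsFunctor K s') (X := X₁.V) (Y := X₂.V)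
      (((c.functorSnd L₁ L₂).app X₁).hom.app _ (((c.functor L₁ L₂).obj X₁).obj.map i.op z₁))
      (((c.functorSnd L₁ L₂).app X₂).hom.app _ (((c.functor L₁ L₂).obj X₂).obj.map i.op z₂))
    obtain ⟨l, hl₁, hl₂⟩ := BinaryFan.IsLimit.lift'
      (isLimitOfHasBinaryProductOfPreservesLimit g X₁.W X₂.W)
      (f₁.map a₁ ≫ X₁.left) (f₁.map a₂ ≫ X₂.left)
    obtain ⟨r, hr₁, hr₂⟩ := BinaryFan.IsLimit.lift'
      (isLimitOfHasBinaryProductOfPreservesLimit f₂ X₁.W X₂.W)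
      (prod.fst ≫ X₁.right) (prod.snd ≫ X₂.right)
    -- The two elements of the base at `X₁.W ⨯ X₂.W` agree since both projections agree.
    have key {X₀ : FiveTuple f₁ g f₂} (a : U ⟶ X₀.U) (b : X₁.V ⨯ X₂.V ⟶ X₀.V)
        (ω : X₁.W ⨯ X₂.W ⟶ X₀.W) (z : ((c.functor L₁ L₂).obj X₀).obj.obj (op s'))
        (hu : (c.fst.pullback.map ((repSheaf J₁).map a)).hom.app _ u =
          ((c.functorFst L₁ L₂).app X₀).hom.app _ z)
        (hv : (c.snd.pullback.map ((repSheaf J₂).map b)).hom.app _ v =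
          ((c.functorSnd L₁ L₂).app X₀).hom.app _ z)
        (hl : l ≫ g.map ω = f₁.map a ≫ X₀.left) (hr : r ≫ f₂.map ω = b ≫ X₀.right) :
        (c.base.map ω).hom.app _ ((c.legMap L₁ l).hom.app _ u) =
          (c.base.map ω).hom.app _ ((c.footMap L₂ r).hom.app _ v) := by
      rw [base_map_legMap_app, base_map_footMap_app, hl, hr, ← legMap_app_map, ← footMap_app_map,
        hu, hv, functor_w]
    have hu₁' := hu₁.trans (sheafHom_app_map _ _ _).symm
    have hu₂' := hu₂.trans (sheafHom_app_map _ _ _).symm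
    obtain ⟨z, hzu, hzv⟩ := c.exists_functor_elt L₁ L₂ (X := ⟨U, X₁.V ⨯ X₂.V, X₁.W ⨯ X₂.W, l, r⟩)
      (s := op s') u v (elem_prod_ext (c.base ⋙ sectionsFunctor K s')
        (key a₁ prod.fst prod.fst _ hu₁' hv₁ hl₁ hr₁) (key a₂ prod.snd prod.snd _ hu₂' hv₂ hl₂ hr₂))
    refine ⟨_, ⟨a₁, prod.fst, prod.fst, hl₁, hr₁⟩, ⟨a₂, prod.snd, prod.snd, hl₂, hr₂⟩, z, ?_, ?_⟩
    · apply c.functor_ext L₁ L₂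
      · exact (c.functorFst_naturality L₁ L₂ _ z).trans ((congrArg _ hzu).trans hu₁')
      · exact (c.functorSnd_naturality L₁ L₂ _ z).trans ((congrArg _ hzv).trans hv₁)
    · apply c.functor_ext L₁ L₂
      · exact (c.functorFst_naturality L₁ L₂ _ z).trans ((congrArg _ hzu).trans hu₂')
      · exact (c.functorSnd_naturality L₁ L₂ _ z).trans ((congrArg _ hzv).trans hv₂)
  fork {s X Y} a b z h := by
    have hU := congrArg (((c.functorFst L₁ L₂).app Y).hom.app _) h
    have hV := congrArg (((c.functorSnd L₁ L₂).app Y).hom.app _) h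
    rw [functorFst_naturality, functorFst_naturality] at hU
    rw [functorSnd_naturality, functorSnd_naturality] at hV
    refine (c.fst.locallyFlat.fork a.onU b.onU _ hU).mono ?_
    rintro s' i ⟨U, k, u, hk, hu⟩
    have := c.preservesFiniteLimits_base s'
    have := c.preservesFiniteLimits_snd s'
    let zi := ((c.functor L₁ L₂).obj X).obj.map i.op z
    have hu' : (c.fst.pullback.map ((repSheaf J₁).map k)).hom.app _ u =
      ((c.functorFst L₁ L₂).app X).hom.app _ zi := hu.trans (sheafHom_app_map _ _ _).symm
    obtain ⟨v, hv⟩ := exists_elem_equalizer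
      ((repSheaf J₂ ⋙ c.snd.pullback) ⋙ sectionsFunctor K s') a.onV b.onV
      (x := ((c.functorSnd L₁ L₂).app X).hom.app _ zi) (by
        have e (k : X ⟶ Y) : (c.snd.pullback.map ((repSheaf J₂).map k.onV)).hom.app _
            (((c.functorSnd L₁ L₂).app X).hom.app _ zi) =
            (c.snd.pullback.obj ((repSheaf J₂).obj Y.V)).obj.map i.op
              ((c.snd.pullback.map ((repSheaf J₂).map k.onV)).hom.app _
                (((c.functorSnd L₁ L₂).app X).hom.app _ z)) :=
          (congrArg _ (sheafHom_app_map _ _ _)).trans (sheafHom_app_map _ _ _)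
        exact (e a).trans ((congrArg _ hV).trans (e b).symm))
    obtain ⟨l, hl⟩ := Fork.IsLimit.lift' (isLimitOfHasEqualizerOfPreservesLimit g a.onW b.onW)
      (f₁.map k ≫ X.left) (by
        rw [Category.assoc, Category.assoc, a.comm_left, b.comm_left, ← f₁.map_comp_assoc, hk,
          f₁.map_comp_assoc])
    obtain ⟨r, hr⟩ := Fork.IsLimit.lift' (isLimitOfHasEqualizerOfPreservesLimit f₂ a.onW b.onW)
      (equalizer.ι a.onV b.onV ≫ X.right) (by
        rw [Category.assoc, Category.assoc, a.comm_right, b.comm_right,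
          equalizer.condition_assoc])
    have hinj : Function.Injective
        ((c.base ⋙ sectionsFunctor K s').map (equalizer.ι a.onW b.onW)) :=
      (mono_iff_injective _).1 inferInstance
    have hl' : l ≫ g.map (equalizer.ι a.onW b.onW) = f₁.map k ≫ X.left := hl
    have hr' : r ≫ f₂.map (equalizer.ι a.onW b.onW) = equalizer.ι a.onV b.onV ≫ X.right := hr
    have hv' : (c.snd.pullback.map ((repSheaf J₂).map (equalizer.ι a.onV b.onV))).hom.app _ v =
      ((c.functorSnd L₁ L₂).app X).hom.app _ zi := hv
    have key : (c.base.map (equalizer.ι a.onW b.onW)).hom.app _ ((c.legMap L₁ l).hom.app _ u) =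
        (c.base.map (equalizer.ι a.onW b.onW)).hom.app _ ((c.footMap L₂ r).hom.app _ v) := by
      rw [base_map_legMap_app, base_map_footMap_app, hl', hr', ← legMap_app_map,
        ← footMap_app_map, hu', hv', functor_w]
    obtain ⟨z', hzu, hzv⟩ := c.exists_functor_elt L₁ L₂
      (X := ⟨U, equalizer a.onV b.onV, equalizer a.onW b.onW, l, r⟩) (s := op s') u v (hinj key)
    refine ⟨_, ⟨k, equalizer.ι _ _, equalizer.ι _ _, hl', hr'⟩, z', ?_, ?_⟩
    · apply FiveTuple.hom_ext
      · exact hk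
      · exact equalizer.condition _ _
      · exact equalizer.condition _ _
    · apply c.functor_ext L₁ L₂
      · exact (c.functorFst_naturality L₁ L₂ _ z').trans ((congrArg _ hzu).trans hu')
      · exact (c.functorSnd_naturality L₁ L₂ _ z').trans ((congrArg _ hzv).trans hv')

end OrientedCone

end ConeFunctor

/-! ### Isomorphisms of triples -/

section ConeIso

variable {X₁ : Type w₁} [Category.{v₁} X₁] {X₂ : Type w₂} [Category.{v₂} X₂]
  {S : Type w₃} [Category.{v₃} S] {f₁ : GeometricMorphism X₁ S} {f₂ : GeometricMorphism X₂ S}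

namespace OrientedCone

/-- An isomorphism of triples, from isomorphisms of inverse image functors. -/
def isoMk {T : Type w₄} [Category.{v₄} T] {c c' : OrientedCone f₁ f₂ T}
    (α : c'.fst.pullback ≅ c.fst.pullback) (β : c'.snd.pullback ≅ c.snd.pullback)
    (w : Functor.whiskerLeft f₁.pullback α.hom ≫ c.nat =
      c'.nat ≫ Functor.whiskerLeft f₂.pullback β.hom) : c ≅ c' where
  hom := ⟨⟨α.hom⟩, ⟨β.hom⟩, w⟩
  inv := ⟨⟨α.inv⟩, ⟨β.inv⟩, by
    ext F
    have h := congrArg (fun k => NatTrans.app k F) w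
    dsimp at h ⊢
    rw [← cancel_mono (β.hom.app (f₂.pullback.obj F)), Category.assoc, ← h]
    simp⟩
  hom_inv_id := by
    apply OrientedCone.hom_ext <;> apply GeometricMorphism.hom_ext
    · exact α.inv_hom_id
    · exact β.inv_hom_id
  inv_hom_id := by
    apply OrientedCone.hom_ext <;> apply GeometricMorphism.hom_ext
    · exact α.hom_inv_id
    · exact β.hom_inv_id

end OrientedCone

end ConeIso

/-! ### Essential surjectivity -/

lemma GeometricMorphism.pullback_map_repSheaf_map_id {C S : Type u} [SmallCategory C]
    [SmallCategory S] {J : GrothendieckTopology C} {K : GrothendieckTopology S}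
    (x : GeometricMorphism (Sheaf K (Type u)) (Sheaf J (Type u))) {V : C} {s : Sᵒᵖ}
    (w : (x.pullback.obj ((repSheaf J).obj V)).obj.obj s) :
    (x.pullback.map ((repSheaf J).map (𝟙 V))).hom.app s w = w := by
  rw [(repSheaf J).map_id, x.pullback.map_id]
  rfl

section EssentialSurjectivity

open FiveTuple

variable {C₁ C₂ E D S : Type u} [SmallCategory C₁] [SmallCategory C₂] [SmallCategory E]
  [SmallCategory D] [SmallCategory S] {f₁ : C₁ ⥤ E} {g : D ⥤ E} {f₂ : D ⥤ C₂}
  {J₁ : GrothendieckTopology C₁} {J₂ : GrothendieckTopology C₂} {JD : GrothendieckTopology D}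
  {q₁ : GeometricMorphism (Sheaf J₁ (Type u)) (Sheaf JD (Type u))}
  {q₂ : GeometricMorphism (Sheaf J₂ (Type u)) (Sheaf JD (Type u))}
  (L₁ : LegPresentation f₁ g q₁) (L₂ : LegPresentation (𝟭 C₂) f₂ q₂)
  {K : GrothendieckTopology S} (c : OrientedCone q₁ q₂ (Sheaf K (Type u)))

namespace OrientedCone

/-- The component in `C₁~` of a section of `c.functor` over `(U → W ← V)` can be lifted along any
morphism `U' → U` through which it factors. -/
lemma exists_functor_elt_restrictU {X : FiveTuple f₁ g f₂} {s : Sᵒᵖ}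
    (z : ((c.functor L₁ L₂).obj X).obj.obj s) {U : C₁} (φ : U ⟶ X.U)
    (u : (c.fst.pullback.obj ((repSheaf J₁).obj U)).obj.obj s)
    (hu : (c.fst.pullback.map ((repSheaf J₁).map φ)).hom.app s u =
      ((c.functorFst L₁ L₂).app X).hom.app s z) :
    ∃ z' : ((c.functor L₁ L₂).obj (X.restrictU φ)).obj.obj s,
      ((c.functor L₁ L₂).map (X.restrictUHom φ)).hom.app s z' = z := by
  obtain ⟨z', hz₁, hz₂⟩ := c.exists_functor_elt L₁ L₂ (X := X.restrictU φ) u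
    (((c.functorSnd L₁ L₂).app X).hom.app s z) (by
      refine Eq.trans ?_ (c.functor_w L₁ L₂ z)
      exact (c.legMap_app_map L₁ φ X.left u).symm.trans (congrArg _ hu))
  refine ⟨z', c.functor_ext L₁ L₂ ?_ ?_⟩
  · exact (c.functorFst_naturality L₁ L₂ _ z').trans ((congrArg _ hz₁).trans hu)
  · refine (c.functorSnd_naturality L₁ L₂ _ z').trans ((congrArg _ hz₂).trans ?_)
    exact c.snd.pullback_map_repSheaf_map_id _

/-- The component in `C₂~` of a section of `c.functor` over `(U → W ← V)` can be lifted along any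
morphism `V' → V` through which it factors. -/
lemma exists_functor_elt_restrictV {X : FiveTuple f₁ g f₂} {s : Sᵒᵖ}
    (z : ((c.functor L₁ L₂).obj X).obj.obj s) {V : C₂} (φ : V ⟶ X.V)
    (v : (c.snd.pullback.obj ((repSheaf J₂).obj V)).obj.obj s)
    (hv : (c.snd.pullback.map ((repSheaf J₂).map φ)).hom.app s v =
      ((c.functorSnd L₁ L₂).app X).hom.app s z) :
    ∃ z' : ((c.functor L₁ L₂).obj (X.restrictV φ)).obj.obj s,
      ((c.functor L₁ L₂).map (X.restrictVHom φ)).hom.app s z' = z := by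
  obtain ⟨z', hz₁, hz₂⟩ := c.exists_functor_elt L₁ L₂ (X := X.restrictV φ)
    (((c.functorFst L₁ L₂).app X).hom.app s z) v (by
      refine (c.functor_w L₁ L₂ z).trans ?_
      exact (congrArg _ hv.symm).trans (c.footMap_app_map L₂ φ X.right v))
  refine ⟨z', c.functor_ext L₁ L₂ ?_ ?_⟩
  · refine (c.functorFst_naturality L₁ L₂ _ z').trans ((congrArg _ hz₁).trans ?_)
    exact c.fst.pullback_map_repSheaf_map_id _
  · exact (c.functorSnd_naturality L₁ L₂ _ z').trans ((congrArg _ hz₂).trans hv)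

variable [HasFiniteLimits C₂]

/-- The functor of a triple sends the generating coverings to locally jointly surjective
families. For the base change coverings, this is because the inverse image of `W` from the right
leg is the sheaf associated to `f₂(W)`. -/
lemma coversLocally_functor {X : FiveTuple f₁ g f₂} {R : Presieve X}
    (hR : IsGeneratingCover f₁ g f₂ J₁ J₂ X R) : CoversLocally (c.functor L₁ L₂) R := by
  intro s z
  cases hR with
  | coverU X U' φ hφ =>
    refine (c.fst.coversLocally hφ s (((c.functorFst L₁ L₂).app X).hom.app _ z)).mono ?_
    rintro s' i ⟨_, _, ⟨_, h, _, ⟨a⟩, rfl⟩, u, hu⟩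
    obtain ⟨z', hz'⟩ := c.exists_functor_elt_restrictU L₁ L₂
      (((c.functor L₁ L₂).obj X).obj.map i.op z) (φ a)
      ((c.fst.pullback.map ((repSheaf J₁).map h)).hom.app _ u) (by
        refine Eq.trans ?_ (hu.trans (sheafHom_app_map _ _ _).symm)
        exact (map_comp_hom_app (repSheaf J₁ ⋙ c.fst.pullback) _ _ _).symm)
    exact ⟨_, _, ⟨a⟩, z', hz'⟩
  | coverV X V' φ hφ =>
    refine (c.snd.coversLocally hφ s (((c.functorSnd L₁ L₂).app X).hom.app _ z)).mono ?_
    rintro s' i ⟨_, _, ⟨_, h, _, ⟨a⟩, rfl⟩, v, hv⟩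
    obtain ⟨z', hz'⟩ := c.exists_functor_elt_restrictV L₁ L₂
      (((c.functor L₁ L₂).obj X).obj.map i.op z) (φ a)
      ((c.snd.pullback.map ((repSheaf J₂).map h)).hom.app _ v) (by
        refine Eq.trans ?_ (hv.trans (sheafHom_app_map _ _ _).symm)
        exact (map_comp_hom_app (repSheaf J₂ ⋙ c.snd.pullback) _ _ _).symm)
    exact ⟨_, _, ⟨a⟩, z', hz'⟩
  | @baseChange U V V' W W' left right left' right' ψ ω hl h =>
    refine Locally.of_forall (fun s' i => ?_)
    let zi := ((c.functor L₁ L₂).obj ⟨U, V', W', left', right'⟩).obj.map i.op z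
    let u : (c.fst.pullback.obj ((repSheaf J₁).obj U)).obj.obj (op s') :=
      ((c.functorFst L₁ L₂).app ⟨U, V', W', left', right'⟩).hom.app _ zi
    let v' : (c.snd.pullback.obj ((repSheaf J₂).obj V')).obj.obj (op s') :=
      ((c.functorSnd L₁ L₂).app ⟨U, V', W', left', right'⟩).hom.app _ zi
    have huv : (c.legMap L₁ left').hom.app _ u = (c.footMap L₂ right').hom.app _ v' :=
      c.functor_w L₁ L₂ zi
    -- The image of `u` in the base is a section of `f₂(W)`, because `f₂(W)` has the same inverse
    -- image as `W`; with `v'` it gives a section of the base change `V`.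
    have hbij (W : D) : Function.Bijective ((c.footMap L₂ (𝟙 (f₂.obj W))).hom.app (op s')) := by
      have := c.isIso_footMap_id L₂ W
      exact (isIso_iff_bijective _).1
        (inferInstanceAs (IsIso ((sectionsFunctor K s').map (c.footMap L₂ (𝟙 (f₂.obj W))))))
    have hfoot {V : C₂} {W : D} (r : V ⟶ f₂.obj W)
        (v : (c.snd.pullback.obj ((repSheaf J₂).obj V)).obj.obj (op s')) :
        (c.footMap L₂ (𝟙 _)).hom.app _
          ((c.snd.pullback.map ((repSheaf J₂).map r)).hom.app _ v) =
        (c.footMap L₂ r).hom.app _ v := by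
      rw [footMap_app_map, Category.comp_id]
    obtain ⟨w, hw⟩ := (hbij W).2 ((c.legMap L₁ left).hom.app _ u)
    have hw' : (c.snd.pullback.map ((repSheaf J₂).map (f₂.map ω))).hom.app _ w =
        (c.snd.pullback.map ((repSheaf J₂).map right')).hom.app _ v' := by
      apply (hbij W').1
      rw [hfoot, hfoot, ← huv, ← hl, ← base_map_legMap_app, ← hw, base_map_footMap_app,
        Category.id_comp]
    have := c.preservesFiniteLimits_snd s'
    obtain ⟨v, hv₁, hv₂⟩ := Types.exists_of_isPullback
      (h.map ((repSheaf J₂ ⋙ c.snd.pullback) ⋙ sectionsFunctor K s')) w v' hw'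
    obtain ⟨z', hz₁, hz₂⟩ := c.exists_functor_elt L₁ L₂ (X := ⟨U, V, W, left, right⟩)
      (s := op s') u v (by
        rw [← hw, ← hfoot right v]
        exact congrArg _ hv₁.symm)
    refine ⟨_, _, ⟨⟩, z', c.functor_ext L₁ L₂ ?_ ?_⟩
    · refine (c.functorFst_naturality L₁ L₂ _ z').trans ((congrArg _ hz₁).trans ?_)
      exact c.fst.pullback_map_repSheaf_map_id _
    · exact (c.functorSnd_naturality L₁ L₂ _ z').trans ((congrArg _ hz₂).trans hv₂)

variable [HasFiniteLimits D] [PreservesFiniteLimits g] [PreservesFiniteLimits f₂]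

lemma isSheaf_functor (t : Sheaf K (Type u)) :
    Presheaf.IsSheaf (topology f₁ g f₂ J₁ J₂) ((sheafTensorRight (c.functor L₁ L₂)).obj t) :=
  (c.locallyFlat_functor L₁ L₂).isSheaf
    { coverings := fun X => {R | IsGeneratingCover f₁ g f₂ J₁ J₂ X R} } (fun X R hR =>
    c.coversLocally_functor L₁ L₂ (show IsGeneratingCover f₁ g f₂ J₁ J₂ X R from hR)) t

/-- The morphism of topoi `T → C~` given by a triple on the topos of sheaves `T`. -/
def morphism : GeometricMorphism (Sheaf K (Type u)) (Sheaf (topology f₁ g f₂ J₁ J₂) (Type u)) :=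
  (c.locallyFlat_functor L₁ L₂).geometricMorphism (c.functor L₁ L₂) _ (c.isSheaf_functor L₁ L₂)

/-- The comparison of the first component of the triple with the one defined by `c.morphism`. -/
def comparisonFst : (toposFst f₁ g f₂ J₁ J₂).pullback ⋙ (c.morphism L₁ L₂).pullback ⟶
    c.fst.pullback :=
  comparison (c.locallyFlat_functor L₁ L₂) (c.isSheaf_functor L₁ L₂) (projU f₁ g f₂) c.fst
    (c.functorFst L₁ L₂)

/-- The comparison of the second component of the triple with the one defined by `c.morphism`. -/
def comparisonSnd : (toposSnd f₁ g f₂ J₁ J₂).pullback ⋙ (c.morphism L₁ L₂).pullback ⟶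
    c.snd.pullback :=
  comparison (c.locallyFlat_functor L₁ L₂) (c.isSheaf_functor L₁ L₂) (projV f₁ g f₂) c.snd
    (c.functorSnd L₁ L₂)

/-- Here a section over `U` is completed to a section of `c.functor` by the terminal objects of `C₂`
and `D`, and sections are lifted along morphisms to `X.U` by restricting `X`. -/
instance isIso_comparisonFst : IsIso (c.comparisonFst L₁ L₂) := by
  have (G : Sheaf J₁ (Type u)) : IsIso ((c.comparisonFst L₁ L₂).app G) := by
    refine isIso_comparison_app _ _ _ _ _ ?_ ?_ G
    · intro s U u
      refine Locally.of_forall (fun s' i => ?_)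
      have := c.preservesFiniteLimits_base s'
      have := c.preservesFiniteLimits_snd s'
      obtain ⟨v⟩ := exists_elem_terminal ((repSheaf J₂ ⋙ c.snd.pullback) ⋙ sectionsFunctor K s')
      have hsub := subsingleton_elem_terminal (c.base ⋙ sectionsFunctor K s')
      let X : FiveTuple f₁ g f₂ := ⟨U, ⊤_ C₂, ⊤_ D,
        (terminalIsTerminal.isTerminalObj g _).from _,
        (terminalIsTerminal.isTerminalObj f₂ _).from _⟩
      obtain ⟨z, hz, -⟩ := c.exists_functor_elt L₁ L₂ (X := X) (s := op s')
        ((c.fst.pullback.obj ((repSheaf J₁).obj U)).obj.map i.op u) v (hsub.elim _ _)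
      exact ⟨X, 𝟙 U, z, (c.fst.pullback_map_repSheaf_map_id _).trans hz⟩
    · intro s X z U b w hw
      obtain ⟨z', hz'⟩ := c.exists_functor_elt_restrictU L₁ L₂ z b w hw
      refine Locally.of_forall (fun s' i => ⟨_, X.restrictUHom b, 𝟙 _,
        ((c.functor L₁ L₂).obj _).obj.map i.op z', Category.id_comp _, ?_⟩)
      rw [sheafHom_app_map, hz']
  exact NatIso.isIso_of_isIso_app _

/-- Here a section over `V` is completed to a section of `c.functor` by the terminal object of `D`
and by an object of `C₁`, which exists only locally. -/
instance isIso_comparisonSnd : IsIso (c.comparisonSnd L₁ L₂) := by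
  have (G : Sheaf J₂ (Type u)) : IsIso ((c.comparisonSnd L₁ L₂).app G) := by
    refine isIso_comparison_app _ _ _ _ _ ?_ ?_ G
    · intro s V v
      refine (c.fst.locallyFlat.nonempty s).mono ?_
      rintro s' i ⟨U, ⟨u⟩⟩
      have := c.preservesFiniteLimits_base s'
      have hsub := subsingleton_elem_terminal (c.base ⋙ sectionsFunctor K s')
      let X : FiveTuple f₁ g f₂ := ⟨U, V, ⊤_ D,
        (terminalIsTerminal.isTerminalObj g _).from _,
        (terminalIsTerminal.isTerminalObj f₂ _).from _⟩
      obtain ⟨z, -, hz⟩ := c.exists_functor_elt L₁ L₂ (X := X) (s := op s') u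
        ((c.snd.pullback.obj ((repSheaf J₂).obj V)).obj.map i.op v) (hsub.elim _ _)
      exact ⟨X, 𝟙 V, z, (c.snd.pullback_map_repSheaf_map_id _).trans hz⟩
    · intro s X z V b w hw
      obtain ⟨z', hz'⟩ := c.exists_functor_elt_restrictV L₁ L₂ z b w hw
      refine Locally.of_forall (fun s' i => ⟨_, X.restrictVHom b, 𝟙 _,
        ((c.functor L₁ L₂).obj _).obj.map i.op z', Category.id_comp _, ?_⟩)
      rw [sheafHom_app_map, hz']
  exact NatIso.isIso_of_isIso_app _

end OrientedCone

variable {L₁ L₂}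

/-- For the canonical 2-morphism, the two morphisms out of the sheaf associated to `X ↦ Hom(X.W, W)`
are compatible. -/
lemma CellIsCanonical.leftSheafMap_comp
    {τ : (toposSnd f₁ g f₂ J₁ J₂).comp q₂ ⟶ (toposFst f₁ g f₂ J₁ J₂).comp q₁}
    (hτ : CellIsCanonical L₁ L₂ τ) (W : D) :
    leftSheafMap L₁ f₂ J₂ W ≫ τ.app.app ((repSheaf JD).obj W) = rightSheafMap L₂ f₁ g J₁ W := by
  apply ((sheafificationAdjunction (topology f₁ g f₂ J₁ J₂) (Type u)).homEquiv _ _).injective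
  refine (Adjunction.homEquiv_unit _ _ _ _).trans
    (Eq.trans ?_ (Adjunction.homEquiv_unit _ _ _ _).symm)
  ext ⟨X⟩ w
  refine (congrArg ((τ.app.app ((repSheaf JD).obj W)).hom.app (op X))
    (presheafToSheaf_map_toSheafify _ (leftPresheafMap L₁ f₂ W) w)).trans ?_
  exact (hτ X W w).trans (presheafToSheaf_map_toSheafify _ (rightPresheafMap L₂ f₁ g W) w).symm

variable [HasFiniteLimits C₂] [HasFiniteLimits D] [PreservesFiniteLimits g]
  [PreservesFiniteLimits f₂]

/-- Every triple on a topos of sheaves `T` comes, up to isomorphism, from the morphism of topoi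
`T → C~` given by its flat functor. -/
lemma CellIsCanonical.nonempty_iso
    {τ : (toposSnd f₁ g f₂ J₁ J₂).comp q₂ ⟶ (toposFst f₁ g f₂ J₁ J₂).comp q₁}
    (hτ : CellIsCanonical L₁ L₂ τ) :
    Nonempty ((cocontinuousCone (projU f₁ g f₂) (projV f₁ g f₂) (topology f₁ g f₂ J₁ J₂)
      J₁ J₂ τ).precomp (c.morphism L₁ L₂) ≅ c) := by
  let h := c.morphism L₁ L₂
  have key : Functor.whiskerLeft q₁.pullback (c.comparisonFst L₁ L₂) ≫ c.nat =
      (Functor.whiskerRight τ.app h.pullback :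
        q₁.pullback ⋙ (toposFst f₁ g f₂ J₁ J₂).pullback ⋙ h.pullback ⟶ _) ≫
        Functor.whiskerLeft q₂.pullback (c.comparisonSnd L₁ L₂) := by
    refine ((h.comp (toposFst f₁ g f₂ J₁ J₂)).comp q₁).natTrans_ext (fun W => ?_)
    let l := leftSheafMap L₁ f₂ J₂ W
    have hl : IsIso l := isIso_leftSheafMap L₁ W
    -- Precomposition with the isomorphism `l` reduces the equality to the sections `z ⊗ w`.
    refine (cancel_epi (h.pullback.map l)).1 ?_
    refine hom_ext_tensorElt (c.locallyFlat_functor L₁ L₂) (c.isSheaf_functor L₁ L₂)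
      (fun X w s z => ?_)
    change X.W ⟶ W at w
    let e := tensorElt (c.locallyFlat_functor L₁ L₂) (c.isSheaf_functor L₁ L₂)
      (P := (projW f₁ g f₂).op ⋙ yoneda.obj W) z w
    have e₁ : ((c.comparisonFst L₁ L₂).app (q₁.pullback.obj ((repSheaf JD).obj W))).hom.app s
        ((h.pullback.map l).hom.app s e) =
        (c.fst.pullback.map (secHom (L₁.sec (X.left ≫ g.map w)))).hom.app s
          (((c.functorFst L₁ L₂).app X).hom.app s z) :=
      (congrArg (((c.comparisonFst L₁ L₂).app _).hom.app s)
        (pullback_map_tensorElt _ _ (leftPresheafMap L₁ f₂ W) z w)).trans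
        (comparison_app_tensorElt _ _ (projU f₁ g f₂) c.fst (c.functorFst L₁ L₂) _
          (L₁.sec (X.left ≫ g.map w)) z)
    have e₂ : ((c.comparisonSnd L₁ L₂).app (q₂.pullback.obj ((repSheaf JD).obj W))).hom.app s
        ((h.pullback.map (rightSheafMap L₂ f₁ g J₁ W)).hom.app s e) =
        (c.footMap L₂ (X.right ≫ f₂.map w)).hom.app s
          (((c.functorSnd L₁ L₂).app X).hom.app s z) :=
      (congrArg (((c.comparisonSnd L₁ L₂).app _).hom.app s)
        (pullback_map_tensorElt _ _ (rightPresheafMap L₂ f₁ g W) z w)).trans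
        (comparison_app_tensorElt _ _ (projV f₁ g f₂) c.snd (c.functorSnd L₁ L₂) _
          (L₂.rightSec (X.right ≫ f₂.map w)) z)
    have e₃ : (h.pullback.map (τ.app.app ((repSheaf JD).obj W))).hom.app s
        ((h.pullback.map l).hom.app s e) =
        (h.pullback.map (rightSheafMap L₂ f₁ g J₁ W)).hom.app s e :=
      (map_comp_hom_app h.pullback l (τ.app.app ((repSheaf JD).obj W)) e).symm.trans
        (congrArg (fun k => (h.pullback.map k).hom.app s e) (hτ.leftSheafMap_comp W))
    refine (congrArg ((c.nat.app ((repSheaf JD).obj W)).hom.app s) e₁).trans ?_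
    refine Eq.trans ?_ ((congrArg (((c.comparisonSnd L₁ L₂).app _).hom.app s) e₃).trans e₂).symm
    refine (c.base_map_legMap_app L₁ X.left w _).symm.trans ?_
    refine Eq.trans ?_ (c.base_map_footMap_app L₂ X.right w _)
    exact congrArg _ (c.functor_w L₁ L₂ z)
  have := c.isIso_comparisonFst L₁ L₂
  have := c.isIso_comparisonSnd L₁ L₂
  let α := asIso (c.comparisonFst L₁ L₂)
  let β := asIso (c.comparisonSnd L₁ L₂)
  exact ⟨(OrientedCone.isoMk α β key).symm⟩

end EssentialSurjectivity

/-! ### Uniqueness of oriented products -/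

namespace GeometricMorphism

variable {X : Type w₁} [Category.{v₁} X] {Y : Type w₂} [Category.{v₂} Y]

variable (X) in
/-- The identity morphism of topoi. -/
def identity : GeometricMorphism X X where
  pushforward := 𝟭 X
  pullback := 𝟭 X
  adj := Adjunction.id
  exact := inferInstance

/-- The morphism of topoi given by an equivalence of categories. -/
def ofEquivalence (e : X ≌ Y) : GeometricMorphism X Y where
  pushforward := e.functor
  pullback := e.inverse
  adj := e.symm.toAdjunction
  exact := inferInstance

/-- The isomorphism of inverse image functors underlying an isomorphism of morphisms of topoi. -/
def pullbackIso {f f' : GeometricMorphism X Y} (i : f ≅ f') : f.pullback ≅ f'.pullback where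
  hom := GeometricMorphism.Hom.app i.inv
  inv := GeometricMorphism.Hom.app i.hom
  hom_inv_id := congrArg GeometricMorphism.Hom.app i.hom_inv_id
  inv_hom_id := congrArg GeometricMorphism.Hom.app i.inv_hom_id

/-- A morphism of topoi with a two-sided inverse up to isomorphism is an equivalence. -/
lemma isEquivalence_of_iso {f : GeometricMorphism X Y} {f' : GeometricMorphism Y X}
    (i : f.comp f' ≅ identity X) (j : f'.comp f ≅ identity Y) : f.IsEquivalence :=
  Functor.IsEquivalence.mk' f'.pullback (pullbackIso j).symm (pullbackIso i)

end GeometricMorphism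

namespace OrientedCone

section

variable {X₁ : Type w₁} [Category.{v₁} X₁] {X₂ : Type w₂} [Category.{v₂} X₂]
  {S : Type w₃} [Category.{v₃} S] {f₁ : GeometricMorphism X₁ S} {f₂ : GeometricMorphism X₂ S}
  {P : Type w₄} [Category.{v₄} P]

/-- Precomposition of triples with a morphism of topoi preserves isomorphisms. -/
def precompIso {c c' : OrientedCone f₁ f₂ P} (i : c ≅ c') {T : Type*} [Category* T]
    (h : GeometricMorphism T P) : c.precomp h ≅ c'.precomp h :=
  OrientedCone.isoMk (Functor.isoWhiskerRight (GeometricMorphism.pullbackIso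
      ⟨i.inv.fst, i.hom.fst, congrArg Hom.fst i.inv_hom_id, congrArg Hom.fst i.hom_inv_id⟩)
      h.pullback)
    (Functor.isoWhiskerRight (GeometricMorphism.pullbackIso
      ⟨i.inv.snd, i.hom.snd, congrArg Hom.snd i.inv_hom_id, congrArg Hom.snd i.hom_inv_id⟩)
      h.pullback) (by
    ext F
    have w := congrArg (fun k => h.pullback.map (NatTrans.app k F)) i.hom.w
    exact (h.pullback.map_comp _ _).symm.trans (w.trans (h.pullback.map_comp _ _)))

/-- Precomposition of triples is compatible with composition of morphisms of topoi. -/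
def precompComp (c : OrientedCone f₁ f₂ P) {T T' : Type*} [Category* T] [Category* T']
    (h : GeometricMorphism T P) (h' : GeometricMorphism T' T) :
    c.precomp (h'.comp h) ≅ (c.precomp h).precomp h' :=
  OrientedCone.isoMk (Iso.refl _) (Iso.refl _) (by
    ext F
    exact (Category.id_comp _).trans (Category.comp_id _).symm)

/-- Precomposition with the identity does not change triples. -/
def precompIdentity (c : OrientedCone f₁ f₂ P) :
    c.precomp (GeometricMorphism.identity P) ≅ c :=
  OrientedCone.isoMk (Iso.refl _) (Iso.refl _) (by
    ext F
    exact (Category.id_comp _).trans (Category.comp_id _).symm)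

/-- Precomposition with an equivalence and its inverse does not change triples. -/
def precompOfEquivalence (c : OrientedCone f₁ f₂ P) {T : Type*} [Category* T] (e : P ≌ T) :
    (c.precomp (GeometricMorphism.ofEquivalence e.symm)).precomp
      (GeometricMorphism.ofEquivalence e) ≅ c :=
  OrientedCone.isoMk (Functor.isoWhiskerLeft c.fst.pullback e.unitIso)
    (Functor.isoWhiskerLeft c.snd.pullback e.unitIso) (by
    ext F
    exact (e.unitIso.hom.naturality (c.nat.app F)).symm)

/-- It suffices to realize triples on a topos equivalent to the given one. -/
lemma essSurj_precompFunctor_of_equivalence (c : OrientedCone f₁ f₂ P) {T T' : Type*}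
    [Category* T] [Category* T'] (e : T ≌ T') [(c.precompFunctor T').EssSurj] :
    (c.precompFunctor T).EssSurj where
  mem_essImage d := by
    let h := (c.precompFunctor T').objPreimage (d.precomp (GeometricMorphism.ofEquivalence e.symm))
    let i : c.precomp h ≅ d.precomp (GeometricMorphism.ofEquivalence e.symm) :=
      (c.precompFunctor T').objObjPreimageIso _
    exact ⟨(GeometricMorphism.ofEquivalence e).comp h, ⟨c.precompComp h _ ≪≫ precompIso i _ ≪≫
      d.precompOfEquivalence e⟩⟩

end

variable {X₁ : Type w₁} [Category.{v₁} X₁] {X₂ : Type w₂} [Category.{v₂} X₂]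
  {S : Type w₃} [Category.{v₃} S] {f₁ : GeometricMorphism X₁ S} {f₂ : GeometricMorphism X₂ S}
  {P P' : Type (u + 1)} [LargeCategory.{u} P] [LargeCategory.{u} P']

/-- Two oriented products of the same morphisms of topoi are equivalent. -/
lemma IsOrientedProduct.exists_equivalence {c : OrientedCone f₁ f₂ P} {c' : OrientedCone f₁ f₂ P'}
    (hP : IsGrothendieckTopos.{u} P) (hP' : IsGrothendieckTopos.{u} P')
    (hc : c.IsOrientedProduct) (hc' : c'.IsOrientedProduct) :
    ∃ e : GeometricMorphism P' P, e.IsEquivalence ∧ Nonempty (c.precomp e ≅ c') := by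
  have := hc P hP
  have := hc P' hP'
  have := hc' P hP
  have := hc' P' hP'
  let e : GeometricMorphism P' P := (c.precompFunctor P').objPreimage c'
  let e' : GeometricMorphism P P' := (c'.precompFunctor P).objPreimage c
  let i : c.precomp e ≅ c' := (c.precompFunctor P').objObjPreimageIso c'
  let i' : c'.precomp e' ≅ c := (c'.precompFunctor P).objObjPreimageIso c
  have j : e.comp e' ≅ GeometricMorphism.identity P' :=
    (c'.precompFunctor P').preimageIso (c'.precompComp e' e ≪≫ precompIso i' e ≪≫ i ≪≫
      c'.precompIdentity.symm)
  have j' : e'.comp e ≅ GeometricMorphism.identity P :=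
    (c.precompFunctor P).preimageIso (c.precompComp e e' ≪≫ precompIso i e' ≪≫ i' ≪≫
      c.precompIdentity.symm)
  exact ⟨e, GeometricMorphism.isEquivalence_of_iso j j', ⟨i⟩⟩

end OrientedCone

/-! ### The universal property of the topos of sheaves on 5-tuples -/

section UniversalProperty

open FiveTuple

variable {C₁ C₂ E D : Type u} [SmallCategory C₁] [SmallCategory C₂] [SmallCategory E]
  [SmallCategory D] {f₁ : C₁ ⥤ E} {g : D ⥤ E} {f₂ : D ⥤ C₂}
  {J₁ : GrothendieckTopology C₁} {J₂ : GrothendieckTopology C₂} {JD : GrothendieckTopology D}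
  {q₁ : GeometricMorphism (Sheaf J₁ (Type u)) (Sheaf JD (Type u))}
  {q₂ : GeometricMorphism (Sheaf J₂ (Type u)) (Sheaf JD (Type u))}
  {L₁ : LegPresentation f₁ g q₁} {L₂ : LegPresentation (𝟭 C₂) f₂ q₂}

/-- The topos of sheaves on 5-tuples, with the canonical 2-morphism, is the oriented product. -/
lemma CellIsCanonical.isOrientedProduct [HasFiniteLimits C₂] [HasFiniteLimits D]
    [PreservesFiniteLimits g] [PreservesFiniteLimits f₂]
    {τ : (toposSnd f₁ g f₂ J₁ J₂).comp q₂ ⟶ (toposFst f₁ g f₂ J₁ J₂).comp q₁}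
    (hτ : CellIsCanonical L₁ L₂ τ) :
    (cocontinuousCone (projU f₁ g f₂) (projV f₁ g f₂) (topology f₁ g f₂ J₁ J₂)
      J₁ J₂ τ).IsOrientedProduct := by
  intro T _ hT
  obtain ⟨S, _, K, ⟨e⟩⟩ := hT
  have hrep := hτ.representablesArePullbacks
  have hK : ((cocontinuousCone (projU f₁ g f₂) (projV f₁ g f₂) (topology f₁ g f₂ J₁ J₂)
      J₁ J₂ τ).precompFunctor (Sheaf K (Type u))).EssSurj :=
    ⟨fun d => ⟨d.morphism L₁ L₂, hτ.nonempty_iso d⟩⟩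
  exact
    { faithful := hrep.faithful T
      full := hrep.full T
      essSurj := OrientedCone.essSurj_precompFunctor_of_equivalence _ e }

end UniversalProperty

/-! ### The canonical 2-morphism on arbitrary sheaves -/

section CanonicalCell

variable {C₁ C₂ E E' D : Type u} [SmallCategory C₁] [SmallCategory C₂] [SmallCategory E]
  [SmallCategory E'] [SmallCategory D]
  (J₁ : GrothendieckTopology C₁) (J₂ : GrothendieckTopology C₂)
  (JE : GrothendieckTopology E) (JE' : GrothendieckTopology E') (JD : GrothendieckTopology D)
  (g₁ : C₁ ⥤ E') (a : E' ⥤ E) (g : D ⥤ E) (f₂ : D ⥤ C₂)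
  [JE.Subcanonical]
  [g₁.IsContinuous J₁ JE'] [g₁.IsCocontinuous J₁ JE']
  [InducesMorphismOfSites a JE' JE] [InducesMorphismOfSites g JD JE]
  [(a.sheafPushforwardContinuous (Type u) JE' JE).IsEquivalence]
  [InducesMorphismOfSites f₂ JD J₂]

/-- Sections of the inverse image of `W` under `C₂~ → D~` are locally morphisms to `f₂(W)`. -/
def rightPresentation : LegPresentation (𝟭 C₂) f₂ (rightLeg J₂ JD f₂) :=
  sitePresentation f₂ JD J₂

/-- By naturality, a 2-morphism that is canonical on representable sheaves is canonical. -/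
lemma CellIsCanonical.isCanonicalCell
    {τ : (FiveTuple.toposSnd (g₁ ⋙ a) g f₂ J₁ J₂).comp (rightLeg J₂ JD f₂) ⟶
      (FiveTuple.toposFst (g₁ ⋙ a) g f₂ J₁ J₂).comp (leftLeg J₁ JE JE' JD g₁ a g)}
    (hτ : CellIsCanonical (leftPresentation J₁ JE JE' JD g₁ a g) (rightPresentation J₂ JD f₂) τ) :
    IsCanonicalCell J₁ J₂ JE JE' JD g₁ a g f₂ τ := by
  intro F X s
  let L₁ := leftPresentation J₁ JE JE' JD g₁ a g
  let L₂ := rightPresentation J₂ JD f₂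
  let q₁ := leftLeg J₁ JE JE' JD g₁ a g
  let q₂ := rightLeg J₂ JD f₂
  let p₁ := FiveTuple.toposFst (g₁ ⋙ a) g f₂ J₁ J₂
  let p₂ := FiveTuple.toposSnd (g₁ ⋙ a) g f₂ J₁ J₂
  have h₁ : (q₁.pullback.map (secHom s)).hom.app _ (L₁.sec X.left) =
      leftLegSection J₁ JE JE' g₁ a g F X.U
        (((g.sheafPullback (Type u) JD JE).obj F).obj.map X.left.op (pullbackSec g JD JE s)) := by
    refine (leftLeg_map_leftLegSection _ _ _ _ _ _ _ _ _).trans (congrArg _ ?_)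
    refine (sheafHom_app_map ((g.sheafPullback (Type u) JD JE).map (secHom s)) X.left _).trans
      (congrArg _ ?_)
    exact (sheafPullback_map_pullbackSec _ _ _ _ _).trans (congrArg _ (secHom_app_one _))
  have h₂ : (q₂.pullback.map (secHom s)).hom.app _ (L₂.rightSec X.right) =
      ((f₂.sheafPullback (Type u) JD J₂).obj F).obj.map X.right.op (pullbackSec f₂ JD J₂ s) := by
    refine (sheafHom_app_map ((f₂.sheafPullback (Type u) JD J₂).map (secHom s)) _ _).trans
      (congrArg _ ?_)
    rw [sheafPullback_map_pullbackSec, secHom_app_one]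
  have h₃ : (p₁.pullback.map (q₁.pullback.map (secHom s))).hom.app _
      (cocontinuousElt _ _ J₁ (L₁.sec X.left)) = leftSection J₁ J₂ JE JE' g₁ a g f₂ F X s :=
    (pullback_map_cocontinuousElt _ _ _ _ _).trans (congrArg _ h₁)
  have h₄ : (p₂.pullback.map (q₂.pullback.map (secHom s))).hom.app _
      (cocontinuousElt _ _ J₂ (L₂.rightSec X.right)) = rightSection J₁ J₂ g₁ a g f₂ F X s :=
    (pullback_map_cocontinuousElt _ _ _ _ _).trans (congrArg _ h₂)
  refine (congrArg _ h₃.symm).trans (Eq.trans ?_ h₄)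
  refine (congrArg (fun k => k.hom.app (op X) (cocontinuousElt _ _ J₁ (L₁.sec X.left)))
    (τ.app.naturality (secHom s))).trans ?_
  exact congrArg ((p₂.pullback.map (q₂.pullback.map (secHom s))).hom.app (op X))
    (hτ.app_cocontinuousElt X)

end CanonicalCell

end
theorem mainTheorem12
    {C₁ C₂ E E' D : Type u} [SmallCategory C₁] [SmallCategory C₂] [SmallCategory E]
    [SmallCategory E'] [SmallCategory D]
    (J₁ : GrothendieckTopology C₁) (J₂ : GrothendieckTopology C₂)
    (JE : GrothendieckTopology E) (JE' : GrothendieckTopology E') (JD : GrothendieckTopology D)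
    (g₁ : C₁ ⥤ E') (a : E' ⥤ E) (g : D ⥤ E) (f₂ : D ⥤ C₂)
    [JE.Subcanonical] [HasFiniteLimits C₂] [HasFiniteLimits D]
    [g₁.IsContinuous J₁ JE'] [g₁.IsCocontinuous J₁ JE']
    [InducesMorphismOfSites a JE' JE] [InducesMorphismOfSites g JD JE]
    [(a.sheafPushforwardContinuous (Type u) JE' JE).IsEquivalence]
    [PreservesFiniteLimits f₂] [InducesMorphismOfSites f₂ JD J₂] :
    ∃ τ : (FiveTuple.toposSnd (g₁ ⋙ a) g f₂ J₁ J₂).comp (rightLeg J₂ JD f₂) ⟶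
        (FiveTuple.toposFst (g₁ ⋙ a) g f₂ J₁ J₂).comp (leftLeg J₁ JE JE' JD g₁ a g),
      IsCanonicalCell J₁ J₂ JE JE' JD g₁ a g f₂ τ ∧
      (siteCone J₁ J₂ JE JE' JD g₁ a g f₂ τ).IsOrientedProduct ∧
      ∀ (P : Type (u + 1)) [LargeCategory.{u} P], IsGrothendieckTopos.{u} P →
        ∀ c : OrientedCone (leftLeg J₁ JE JE' JD g₁ a g) (rightLeg J₂ JD f₂) P,
          c.IsOrientedProduct →
          ∃ e : GeometricMorphism P
              (Sheaf (FiveTuple.topology (g₁ ⋙ a) g f₂ J₁ J₂) (Type u)),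
            e.IsEquivalence ∧
              Nonempty ((siteCone J₁ J₂ JE JE' JD g₁ a g f₂ τ).precomp e ≅ c) := by
  have : PreservesFiniteLimits g :=
    preservesFiniteLimits_of_inducesMorphismOfSites g JD JE InducesMorphismOfSites.exact
  obtain ⟨τ, hτ⟩ := exists_cellIsCanonical (leftPresentation J₁ JE JE' JD g₁ a g)
    (rightPresentation J₂ JD f₂)
  have hP : (siteCone J₁ J₂ JE JE' JD g₁ a g f₂ τ).IsOrientedProduct := hτ.isOrientedProduct
  exact ⟨τ, hτ.isCanonicalCell, hP, fun P _ h c hc =>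
    hP.exists_equivalence ⟨_, _, _, ⟨CategoryTheory.Equivalence.refl⟩⟩ h hc⟩
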